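/- Let $\mathcal X$ be the space of bounded functions $f:\mathbb R\to\mathbb R$ that are absolutely continuous on bounded intervals with $f_x\in L^2(\mathbb R)$, normed by $\|f\|_{\mathcal X}=\|f\|_{L^\infty}+\|f_x\|_{L^2}$. For $\bar u\in\mathcal X$, $t\ge0$ and $y\in\mathbb R$ put $$\varphi(t,y)=\tfrac14\int_{\{\bar u_x>-2/t\}}\mathrm{sign}(y-x)\,\bar u_x^2(x)\,dx\quad(t>0),\qquad \varphi(0,y)=\tfrac14\int_{\mathbb R}\mathrm{sign}(y-x)\,\bar u_x^2(x)\,dx,$$ $$\xi(t,y)=y+t\bar u(y)+\int_0^t(t-s)\varphi(s,y)\,ds,\qquad u\big(t,\xi(t,y)\big)=\bar u(y)+\int_0^t\varphi(s,y)\,ds .$$ The last formula defines the dissipative solution $u$ with datum $\bar u$ of the Hunter–Saxton equation $u_t+(u^2/2)_x=\frac14\big(\int_{-\infty}^x-\int_x^\infty\big)u_x^2\,dx$. For $\kappa_0>0$ let $X=(\mathbb R^2\times(-\frac\pi2,\frac\pi2])\cup\{\infty\}$ with $$d\big((x,u,w),(\tilde x,\tilde u,\tilde w)\big)=\min\big\{|x-\tilde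 x|+|u-\tilde u|+\kappa_0|w-\tilde w|,\ \kappa_0|\tfrac\pi2+w|+\kappa_0|\tfrac\pi2+\tilde w|\big\},\quad d\big((x,u,w),\infty\big)=\kappa_0|\tfrac\pi2+w|,$$ and write $P_f(x)=(x,f(x),\arctan f_x(x))$. For $u,v\in\mathcal X$ let $$J(u,v)=\inf\Big\{\int d\big(P_u(x),P_v(\psi(x))\big)\phi_1u_x^2\,dx+\int d(P_u(x),\infty)(1-\phi_1)u_x^2\,dx+\int d\big(P_v(\psi(x)),\infty\big)\big(1-\phi_2(\psi(x))\big)v_x^2(\psi(x))\psi'(x)\,dx\Big\},$$ the infimum being over all nondecreasing, locally absolutely continuous, surjective $\psi:\mathbb R\to\mathbb R$ and all simple Borel functions $\phi_1,\phi_2:\mathbb R\to[0,1]$ with $\phi_1u_x^2=\psi'\cdot\phi_2(\psi)\,v_x^2(\psi)$ a.e. **Theorem 2.** Let $\kappa_0>0$. 1. $J$ is finite and symmetric on $\mathcal X$ and satisfies the triangle inequality; $J(u,v)=0$ if and only if $u=v$ or both $u$ and $v$ are constant. 2. For every $\bar u\in\mathcal X$ and $t\ge0$ the map $\xi(t,\cdot)$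 is onto, $u(t)$ is well defined by the formula above and belongs to $\mathcal X$, and $u(0)=\bar u$. 3. If $c$ is a constant such that $\frac\pi2+\arctan y\le c/|y|$ for all $y\le-1$, then for every $\bar u\in\mathcal X$ and $t\ge0$ $$J(\bar u,u(t))\le\Big(\frac{\pi t}4+\frac{c+\kappa_0}2+\|\bar u\|_{L^\infty}+\frac{t+2}8\|\bar u_x\|_{L^2}^2\Big)\,t\,\|\bar u_x\|_{L^2}^2 .$$ 4. For all $R,T$ there is a constant $L\geq 0$ (depending only on $\kappa_0,R,T$) such that for all data $\bar u,\tilde{\bar u}\in\mathcal X$ of norm at most $R$, with corresponding solutions $u,\tilde u$, and all $s,t\in[0,T]$ $$J(u(s),u(t))\le L|t-s|,\qquad \big|J(u(t),\tilde u(t))-J(u(s),\tilde u(s))\big|\le L|t-s| .$$ In particular every trajectory is locally Lipschitz from $[0,\infty)$ into $(\mathcal X,J)$, and so is the distance between two trajectories as a real function of $t \in [0,\infty)$. 5. If $\|\bar u_x\|_{L^2}^2\le\kappa_0$, then for every $\tilde{\bar u}\in\mathcal X$ and $t\ge0$ $$J(u(t),\tilde u(t))\le e^{2t}J(\bar u,\tilde{\bar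 u}) .$$ -/

import Mathlib

open Real MeasureTheory Set
open scoped ENNReal NNReal

namespace HunterSaxton

/-! ### The space of bounded continuous functions with square integrable derivative -/

/-- Membership in `𝒳`: bounded functions `f : ℝ → ℝ` that are absolutely continuous (on every bounded
interval) with `f_x ∈ L²(ℝ)`; `f_x` is the almost everywhere derivative `deriv f`. -/
structure MemX (f : ℝ → ℝ) : Prop where
  bounded : ∃ C : ℝ, ∀ x, |f x| ≤ C
  ac : ∀ a b : ℝ, AbsolutelyContinuousOnInterval f a b
  memLp : MemLp (deriv f) 2 volume

/-- The energy `∫ f_x² dx`, the square of the `L²` norm of `f_x`. -/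
noncomputable def energy (f : ℝ → ℝ) : ℝ := ∫ x, (deriv f x) ^ 2

/-- The supremum norm. -/
noncomputable def supNorm (f : ℝ → ℝ) : ℝ := ⨆ x, |f x|

/-- The norm of `𝒳`. -/
noncomputable def normX (f : ℝ → ℝ) : ℝ := supNorm f + √(energy f)

/-! ### The dissipative solution of the Hunter-Saxton equation -/

/-- The source term `φ(t, y) = ¼ ∫_{ū_x > -2/t} sign(y - x) ū_x(x)² dx` for `t > 0`, and
`φ(0, y) = ¼ ∫_ℝ sign(y - x) ū_x(x)² dx`. For `t > 0` the condition `ū_x > -2/t` is `-2 < t ū_x`;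
for `t = 0` the latter always holds. -/
noncomputable def source (ubar : ℝ → ℝ) (t y : ℝ) : ℝ :=
  (1 / 4) * ∫ x in {x : ℝ | -2 < t * deriv ubar x}, Real.sign (y - x) * (deriv ubar x) ^ 2

/-- The characteristic `ξ(t, y) = y + t ū(y) + ∫₀ᵗ (t - s) φ(s, y) ds`. -/
noncomputable def char (ubar : ℝ → ℝ) (t y : ℝ) : ℝ :=
  y + t * ubar y + ∫ s in (0 : ℝ)..t, (t - s) * source ubar s y

/-- The value `ū(y) + ∫₀ᵗ φ(s, y) ds` carried by the characteristic issued from `y`. -/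
noncomputable def charValue (ubar : ℝ → ℝ) (t y : ℝ) : ℝ :=
  ubar y + ∫ s in (0 : ℝ)..t, source ubar s y

/-- The solution `u(t, x)` with initial datum `ū`: the value carried to `x` by a characteristic
`y` with `ξ(t, y) = x` (the map `ξ(t, ·)` is onto for `t ≥ 0`, and the value does not depend on
the chosen `y`). -/
noncomputable def sol (ubar : ℝ → ℝ) (t : ℝ) : ℝ → ℝ := fun x =>
  charValue ubar t (Function.invFun (char ubar t) x)

/-! ### The transport distance -/

/-- The space `X = (ℝ² × ]-π/2, π/2]) ∪ {∞}`; the point `∞` is `none`. -/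
abbrev PointSpace : Type := Option (ℝ × ℝ × Set.Ioc (-(π / 2)) (π / 2))

/-- The distance on `X`, with parameter `κ`. -/
noncomputable def dX (κ : ℝ) : PointSpace → PointSpace → ℝ
  | some (x, u, w), some (x', u', w') =>
      min (|x - x'| + |u - u'| + κ * |(w : ℝ) - w'|) (κ * |π / 2 + w| + κ * |π / 2 + w'|)
  | some (_, _, w), none => κ * |π / 2 + w|
  | none, some (_, _, w) => κ * |π / 2 + w|
  | none, none => 0

/-- The point `(x, f(x), arctan f_x(x))` of `X`. -/
noncomputable def pointAt (f : ℝ → ℝ) (x : ℝ) : PointSpace :=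
  some (x, f x, ⟨arctan (deriv f x),
    neg_pi_div_two_lt_arctan (deriv f x), (arctan_lt_pi_div_two (deriv f x)).le⟩)

/-- Simple Borel measurable maps with values in `[0, 1]`. -/
structure IsWeight (φ : ℝ → ℝ) : Prop where
  measurable : Measurable φ
  finite_range : (Set.range φ).Finite
  mem_Icc : ∀ x, φ x ∈ Set.Icc (0 : ℝ) 1

/-- `(ψ, φ₁, φ₂)` is a transportation plan from `u` to `v`: a triple of the family `ℱ`
such that `φ₁ u_x² = ψ' · φ₂(ψ) · v_x²(ψ)` almost everywhere. -/
structure IsPlan (u v ψ φ₁ φ₂ : ℝ → ℝ) : Prop where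
  mono : Monotone ψ
  ac : ∀ a b : ℝ, AbsolutelyContinuousOnInterval ψ a b
  surj : Function.Surjective ψ
  weight₁ : IsWeight φ₁
  weight₂ : IsWeight φ₂
  balance : ∀ᵐ x : ℝ,
    φ₁ x * (deriv u x) ^ 2 = deriv ψ x * φ₂ (ψ x) * (deriv v (ψ x)) ^ 2

/-- The cost `J^{(ψ, φ₁, φ₂)}(u, v)` of a plan (all integrands are nonnegative). -/
noncomputable def planCost (κ : ℝ) (u v ψ φ₁ φ₂ : ℝ → ℝ) : ℝ≥0∞ :=
  (∫⁻ x, ENNReal.ofReal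
      (dX κ (pointAt u x) (pointAt v (ψ x)) * (φ₁ x * (deriv u x) ^ 2)))
  + (∫⁻ x, ENNReal.ofReal
      (dX κ (pointAt u x) none * ((1 - φ₁ x) * (deriv u x) ^ 2)))
  + ∫⁻ x, ENNReal.ofReal
      (dX κ (pointAt v (ψ x)) none * ((1 - φ₂ (ψ x)) * (deriv v (ψ x)) ^ 2 * deriv ψ x))

/-- The distance functional `J(u, v)`: the infimum of the costs of all plans from `u` to `v`. -/
noncomputable def distJ (κ : ℝ) (u v : ℝ → ℝ) : ℝ≥0∞ :=
  ⨅ (ψ : ℝ → ℝ) (φ₁ : ℝ → ℝ) (φ₂ : ℝ → ℝ) (_ : IsPlan u v ψ φ₁ φ₂), planCost κ u v ψ φ₁ φ₂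

end HunterSaxton

/-!
The functional `J` is an infimum over plans `(ψ, φ₁, φ₂)` in which the two functions play different
roles. Everything becomes easy once the infimum is taken over a larger, symmetric family: plans `(a,
b, w₁, w₂)` parametrised by an auxiliary variable `z`, where `a` and `b` are two changes of
parameter, `w₁` and `w₂` two weights, and the point `a z` is sent to `b z` (`IsParamPlan`,
`paramCost`). The key fact is `distJ_le_paramCost`: this does not lower the infimum. Indeed, for
almost every `z` with `a' z > 0` the increments of `b` from `z`, within a bounded interval, are at
most `n` times those of `a`, for some `n`. On the closed set `slopeSet a b R n` of these `z`, the
map `b ∘ a⁻¹` is therefore Lipschitz, and it extends to an admissible `ψ` of the whole line.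
Transporting only the mass that sits on this set costs little more than the given plan, because the
remaining mass is small and `d ≤ 2κπ` there.

*Distance axioms.* Symmetry is the exchange of `a` and `b`. For the triangle inequality two plans
are written with a common parametrisation of the middle function `v`, and the mass that both of them
transport, with weight `min(p₂, p₃)`, is moved directly. If `J(u, v) = 0`, plans with summable costs
show that `u = v` at almost every point where `u' ≠ 0`, and likewise where `v' ≠ 0`; hence `(u -
v)²` has zero derivative.

*The solution.* The source of the equation at `y` only involves the energy that is still alive, and
`ξ_y = (1 + tū'/2)₊²`, `(u ∘ ξ)_y = ū' (1 + tū'/2)₊` (`MemX.hasDensity_char`,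
`MemX.hasDensity_charValue`). So the value carried by characteristics is constant where `ξ` is, the
slope along a living characteristic is `p / (1 + tp/2)` with `p = ū'`, and `u_x² dx` is transported
without change as long as `tp > -2`. A characteristic map is a change of parameter, which is what
makes parametrised plans fit the flow: `J(u(s), u(t))` is estimated by the plan that sends `ξ(s, y)`
to `ξ(t, y)` with the energy alive at time `t`.

*Growth of the distance.* A plan between `ū` and `v̄` is transported along the two flows, keeping in
motion only the energy that is alive for both (`IsPlan.evolve`). The difference of the two source
terms is at most a quarter of the orphan energy, which is the living energy that has no living
partner. It increases the transport distance, by at most `orphanIntegral` times the transported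
energy; the latter is at most `κ`. On the other hand the angle `θ = π/2 + arctan u_x` along a
characteristic solves `θ' = -cos² θ / 2 ≤ θ - 1/4`, so energy that waits at distance `κθ` from `∞`
loses at rate `κ/4` relative to exponential growth (`angle_add_integral_le`,
`angle_add_angle_add_integral_le`). Integrated over the orphan energy, this gain is exactly `κ ·
orphanIntegral`, by Fubini. The two contributions cancel, and `J(u(t), v(t)) ≤ eᵗ J(ū, v̄)`.
-/

namespace HunterSaxton
open Filter Topology

/-! ### Functions with a locally integrable density -/

/-- `f` is a primitive of the locally integrable function `k`. Equivalently `f` is locally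
absolutely continuous and `f' = k` almost everywhere. -/
structure HasDensity (f k : ℝ → ℝ) : Prop where
  locInt : LocallyIntegrable k
  integral_eq : ∀ x y, ∫ z in x..y, k z = f y - f x

namespace HasDensity
variable {f g k l : ℝ → ℝ}

theorem of_le (hint : ∀ x y, x ≤ y → IntegrableOn k (Ioc x y))
    (hle : ∀ x y, x ≤ y → ∫ z in x..y, k z = f y - f x) : HasDensity f k where
  locInt := by
    rw [locallyIntegrable_iff]
    intro K hK
    obtain ⟨R, hR⟩ := hK.isBounded.subset_closedBall 0
    rw [Real.closedBall_eq_Icc] at hR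
    have hRR : 0 - |R| ≤ 0 + |R| := by have := abs_nonneg R; linarith
    refine IntegrableOn.mono_set (t := Icc (0 - |R|) (0 + |R|)) ?_ (hR.trans
      (Icc_subset_Icc (by have := le_abs_self R; linarith) (by have := le_abs_self R; linarith)))
    rw [integrableOn_Icc_iff_integrableOn_Ioc]
    exact hint _ _ hRR
  integral_eq x y := by
    rcases le_total x y with hxy | hxy
    · exact hle x y hxy
    · rw [intervalIntegral.integral_symm, hle y x hxy]; ring

theorem of_ac (hf : ∀ a b, AbsolutelyContinuousOnInterval f a b) : HasDensity f (deriv f) :=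
  of_le (fun x y hxy => (intervalIntegrable_iff_integrableOn_Ioc_of_le hxy).1
    (hf x y).intervalIntegrable_deriv) fun x y _ => (hf x y).integral_deriv_eq_sub

theorem intervalIntegrable (h : HasDensity f k) (x y : ℝ) : IntervalIntegrable k volume x y :=
  intervalIntegrable_iff.mpr
    ((h.locInt.integrableOn_isCompact isCompact_uIcc).mono_set uIoc_subset_uIcc)

theorem ae_hasDerivAt (h : HasDensity f k) : ∀ᵐ x, HasDerivAt f (k x) x := by
  filter_upwards [LocallyIntegrable.ae_hasDerivAt_integral h.locInt] with x hx
  have h1 := (hx 0).add_const (f 0)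
  refine h1.congr_of_eventuallyEq (Eventually.of_forall fun y => ?_)
  simp [h.integral_eq]

theorem ae_deriv_eq (h : HasDensity f k) : deriv f =ᵐ[volume] k := by
  filter_upwards [h.ae_hasDerivAt] with x hx using hx.deriv

theorem ac (h : HasDensity f k) (a b : ℝ) : AbsolutelyContinuousOnInterval f a b := by
  have h1 := (h.intervalIntegrable a b).absolutelyContinuousOnInterval_intervalIntegral
    (c := a) (by simp)
  have h2 : AbsolutelyContinuousOnInterval (fun _ : ℝ => f a) a b :=
    (LipschitzWith.const (f a)).lipschitzOnWith.absolutelyContinuousOnInterval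
  have h3 := h1.add h2
  have : f = (fun x ↦ ∫ v in a..x, k v) + (fun _ : ℝ => f a) := by
    ext x; simp [h.integral_eq]
  rwa [this]

theorem continuous (h : HasDensity f k) : Continuous f := by
  have : f = fun x => (∫ v in (0:ℝ)..x, k v) + f 0 := by
    ext x; simp [h.integral_eq]
  rw [this]
  exact (intervalIntegral.continuous_primitive (fun a b => h.intervalIntegrable a b) 0).add
    continuous_const

theorem monotone (h : HasDensity f k) (hk : ∀ x, 0 ≤ k x) : Monotone f := by
  intro x y hxy
  have := intervalIntegral.integral_nonneg (μ := volume) hxy (fun z _ => hk z)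
  rw [h.integral_eq] at this
  linarith

theorem congr_density (h : HasDensity f k) (hkl : k =ᵐ[volume] l) : HasDensity f l where
  locInt := by
    rw [locallyIntegrable_iff]
    intro K hK
    exact (h.locInt.integrableOn_isCompact hK).congr (ae_restrict_of_ae hkl)
  integral_eq x y := by
    rw [← h.integral_eq]
    exact intervalIntegral.integral_congr_ae (hkl.symm.mono fun z hz _ => hz)

theorem add (hf : HasDensity f k) (hg : HasDensity g l) :
    HasDensity (fun x => f x + g x) (fun x => k x + l x) where
  locInt := hf.locInt.add hg.locInt
  integral_eq x y := by
    rw [intervalIntegral.integral_add (hf.intervalIntegrable x y) (hg.intervalIntegrable x y),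
      hf.integral_eq, hg.integral_eq]
    ring

theorem const_mul (hf : HasDensity f k) (c : ℝ) :
    HasDensity (fun x => c * f x) (fun x => c * k x) where
  locInt := hf.locInt.smul c
  integral_eq x y := by
    rw [intervalIntegral.integral_const_mul, hf.integral_eq]; ring

end HasDensity

/-! ### Changes of parameter -/

/-- Changes of parameter of the line: nondecreasing, locally absolutely continuous, surjective maps.
They may be constant on intervals, so that they need not be injective. -/
structure Reparam (a : ℝ → ℝ) : Prop where
  mono : Monotone a
  ac : ∀ x y : ℝ, AbsolutelyContinuousOnInterval a x y
  surj : Function.Surjective a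

namespace Reparam
variable {a : ℝ → ℝ}

theorem id : Reparam (fun x => x) where
  mono := fun _ _ h => h
  ac _ _ := LipschitzWith.id.lipschitzOnWith.absolutelyContinuousOnInterval
  surj x := ⟨x, rfl⟩

theorem of_hasDensity {k : ℝ → ℝ} (h : HasDensity a k) (hk : ∀ x, 0 ≤ k x)
    (hs : Function.Surjective a) : Reparam a := ⟨h.monotone hk, h.ac, hs⟩

theorem hasDensity (h : Reparam a) : HasDensity a (deriv a) := .of_ac h.ac

theorem continuous (h : Reparam a) : Continuous a := h.hasDensity.continuous

theorem deriv_nonneg (h : Reparam a) (x : ℝ) : 0 ≤ deriv a x := h.mono.deriv_nonneg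

/-- A change of parameter is strictly increasing at a point of positive derivative. -/
theorem lt_of_lt_of_deriv_pos (h : Reparam a) {x y : ℝ} (hxy : x < y)
    (hd : 0 < deriv a x ∨ 0 < deriv a y) : a x < a y := by
  refine lt_of_le_of_ne (h.mono hxy.le) fun heq => ?_
  -- `a` is constant on `[x, y]`, so the derivative vanishes at both end points
  have hc : ∀ z ∈ Icc x y, a z = a x := fun z hz =>
    le_antisymm ((h.mono hz.2).trans heq.ge) (h.mono hz.1)
  have key : ∀ z ∈ Icc x y, deriv a z = 0 := by
    intro z hz
    by_cases hdz : DifferentiableAt ℝ a z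
    · have hu : UniqueDiffWithinAt ℝ (Icc x y) z := uniqueDiffOn_Icc hxy z hz
      rw [← hdz.derivWithin hu]
      rw [derivWithin_congr (f := fun _ => a x) hc (hc z hz)]
      simp
    · exact deriv_zero_of_not_differentiableAt hdz
  have h1 := key x (left_mem_Icc.2 hxy.le)
  have h2 := key y (right_mem_Icc.2 hxy.le)
  rcases hd with hd | hd <;> linarith

theorem lt_iff_of_deriv_pos (h : Reparam a) {x y : ℝ} (hd : 0 < deriv a x ∨ 0 < deriv a y) :
    a x < a y ↔ x < y :=
  ⟨fun hl => lt_of_not_ge fun hge => absurd (h.mono hge) (not_le.2 hl),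
    fun hl => h.lt_of_lt_of_deriv_pos hl hd⟩

theorem eq_of_deriv_pos (h : Reparam a) {x y : ℝ} (hd : 0 < deriv a x) (he : a x = a y) :
    x = y := by
  rcases lt_trichotomy x y with hl | hl | hl
  · exact absurd he (h.lt_of_lt_of_deriv_pos hl (.inl hd)).ne
  · exact hl
  · exact absurd he (h.lt_of_lt_of_deriv_pos hl (.inr hd)).ne'

/-- The measure `a'(z) dz`, which a change of parameter `a` pushes forward to Lebesgue measure. -/
noncomputable def mass (a : ℝ → ℝ) : Measure ℝ :=
  volume.withDensity fun z => ENNReal.ofReal (deriv a z)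

theorem measurable_ofReal_deriv (a : ℝ → ℝ) : Measurable fun z => ENNReal.ofReal (deriv a z) :=
  (measurable_deriv a).ennreal_ofReal

theorem mass_Ioc (h : Reparam a) {x y : ℝ} (hxy : x ≤ y) :
    mass a (Ioc x y) = ENNReal.ofReal (a y - a x) := by
  rw [mass, withDensity_apply _ measurableSet_Ioc, ← h.hasDensity.integral_eq,
    intervalIntegral.integral_of_le hxy, ofReal_integral_eq_lintegral_ofReal]
  · exact (intervalIntegrable_iff_integrableOn_Ioc_of_le hxy).1 (h.hasDensity.intervalIntegrable x y)
  · exact Eventually.of_forall h.deriv_nonneg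

/-- The area formula in one dimension. It suffices to test on the intervals `(a x, a y]`, whose
preimage differs from `(x, y]` by points where `a' = 0` only. -/
theorem measurePreserving (h : Reparam a) : MeasurePreserving a (mass a) volume where
  measurable := h.continuous.measurable
  map_eq := by
    symm
    refine Measure.ext_of_Ioc _ _ fun c d hcd => ?_
    obtain ⟨x, rfl⟩ := h.surj c
    obtain ⟨y, rfl⟩ := h.surj d
    rw [Measure.map_apply h.continuous.measurable measurableSet_Ioc, Real.volume_Ioc]
    have hxy : x ≤ y := le_of_lt (lt_of_not_ge fun hge => absurd (h.mono hge) (not_le.2 hcd))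
    rw [← h.mass_Ioc hxy, mass, withDensity_apply _ measurableSet_Ioc,
      withDensity_apply _ (h.continuous.measurable measurableSet_Ioc),
      ← lintegral_indicator measurableSet_Ioc,
      ← lintegral_indicator (h.continuous.measurable measurableSet_Ioc)]
    congr 1
    ext z
    rcases (h.deriv_nonneg z).eq_or_lt with hz | hz
    · simp [indicator, ← hz]
    · have : (z ∈ Ioc x y ↔ z ∈ a ⁻¹' Ioc (a x) (a y)) := by
        simp only [mem_Ioc, mem_preimage]
        rw [h.lt_iff_of_deriv_pos (.inr hz), ← not_lt, ← not_lt, h.lt_iff_of_deriv_pos (.inr hz)]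
      by_cases hz' : z ∈ Ioc x y
      · rw [indicator_of_mem hz', indicator_of_mem (this.1 hz')]
      · rw [indicator_of_notMem hz', indicator_of_notMem (mt this.2 hz')]

theorem ae_mass_iff {p : ℝ → Prop} :
    (∀ᵐ z ∂(mass a), p z) ↔ ∀ᵐ z, 0 < deriv a z → p z := by
  rw [mass, ae_withDensity_iff (measurable_ofReal_deriv a)]
  simp

theorem ae_comp (h : Reparam a) {p : ℝ → Prop} (hp : ∀ᵐ x, p x) :
    ∀ᵐ z, 0 < deriv a z → p (a z) :=
  ae_mass_iff.1 (h.measurePreserving.quasiMeasurePreserving.ae hp)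

theorem ae_of_comp (h : Reparam a) {p : ℝ → Prop} (hm : MeasurableSet {x | p x})
    (hp : ∀ᵐ z, 0 < deriv a z → p (a z)) : ∀ᵐ x, p x := by
  rw [← h.measurePreserving.map_eq, ae_map_iff h.continuous.aemeasurable hm]
  exact ae_mass_iff.2 hp

theorem lintegral_comp (h : Reparam a) {f : ℝ → ℝ≥0∞} (hf : Measurable f) :
    ∫⁻ z, f (a z) * ENNReal.ofReal (deriv a z) = ∫⁻ x, f x := by
  rw [← h.measurePreserving.lintegral_comp hf, mass]
  refine Eq.trans ?_ (lintegral_withDensity_eq_lintegral_mul _ (measurable_ofReal_deriv a)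
      (hf.comp h.continuous.measurable)).symm
  simp [mul_comm]

theorem lintegral_ofReal_comp (h : Reparam a) {f : ℝ → ℝ} (hf : Measurable f) :
    ∫⁻ z, ENNReal.ofReal (f (a z) * deriv a z) = ∫⁻ x, ENNReal.ofReal (f x) := by
  rw [← h.lintegral_comp hf.ennreal_ofReal]
  congr 1; ext z
  rw [ENNReal.ofReal_mul' (h.deriv_nonneg z)]

theorem integral_comp (h : Reparam a) {f : ℝ → ℝ} (hf : AEStronglyMeasurable f) :
    ∫ z, f (a z) * deriv a z = ∫ x, f x := by
  have hf' : AEStronglyMeasurable f ((mass a).map a) := by rwa [h.measurePreserving.map_eq]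
  have h1 := integral_map h.continuous.aemeasurable hf'
  rw [h.measurePreserving.map_eq] at h1
  rw [h1, mass, integral_withDensity_eq_integral_toReal_smul (measurable_ofReal_deriv a)
      (Eventually.of_forall fun _ => ENNReal.ofReal_lt_top)]
  refine integral_congr_ae (Eventually.of_forall fun z => ?_)
  simp only
  rw [ENNReal.toReal_ofReal (h.deriv_nonneg z), smul_eq_mul, mul_comm]

theorem integrable_comp_iff (h : Reparam a) {f : ℝ → ℝ} (hf : AEStronglyMeasurable f) :
    Integrable (fun z => f (a z) * deriv a z) ↔ Integrable f := by
  have hf' : AEStronglyMeasurable f ((mass a).map a) := by rwa [h.measurePreserving.map_eq]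
  have h1 := integrable_map_measure hf' h.continuous.aemeasurable
  rw [h.measurePreserving.map_eq] at h1
  rw [h1, mass, integrable_withDensity_iff_integrable_smul' (measurable_ofReal_deriv a)
      (Eventually.of_forall fun _ => ENNReal.ofReal_lt_top)]
  refine integrable_congr (Eventually.of_forall fun z => ?_)
  simp [ENNReal.toReal_ofReal (h.deriv_nonneg z), mul_comm]

theorem indicator_comp_mul_deriv (h : Reparam a) (k : ℝ → ℝ) (x y z : ℝ) :
    (Ioc x y).indicator (fun z => k (a z) * deriv a z) z =
      (Ioc (a x) (a y)).indicator k (a z) * deriv a z := by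
  rcases (h.deriv_nonneg z).eq_or_lt with hz | hz
  · simp [indicator, ← hz]
  · have : (z ∈ Ioc x y ↔ a z ∈ Ioc (a x) (a y)) := by
      simp only [mem_Ioc]
      rw [h.lt_iff_of_deriv_pos (.inr hz), ← not_lt, ← not_lt, h.lt_iff_of_deriv_pos (.inr hz)]
    by_cases hz' : z ∈ Ioc x y
    · rw [indicator_of_mem hz', indicator_of_mem (this.1 hz')]
    · rw [indicator_of_notMem hz', indicator_of_notMem (mt this.2 hz'), zero_mul]

theorem integrableOn_comp_iff (h : Reparam a) {k : ℝ → ℝ} (hk : AEStronglyMeasurable k) (x y : ℝ) :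
    IntegrableOn (fun z => k (a z) * deriv a z) (Ioc x y) ↔ IntegrableOn k (Ioc (a x) (a y)) := by
  rw [← integrable_indicator_iff measurableSet_Ioc, ← integrable_indicator_iff measurableSet_Ioc,
    ← h.integrable_comp_iff (hk.indicator measurableSet_Ioc)]
  exact integrable_congr (Eventually.of_forall (h.indicator_comp_mul_deriv k x y))

theorem intervalIntegral_comp (h : Reparam a) {k : ℝ → ℝ} (hk : AEStronglyMeasurable k) {x y : ℝ}
    (hxy : x ≤ y) : ∫ z in x..y, k (a z) * deriv a z = ∫ z in (a x)..(a y), k z := by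
  rw [intervalIntegral.integral_of_le hxy, ← integral_indicator measurableSet_Ioc,
    intervalIntegral.integral_of_le (h.mono hxy), ← integral_indicator measurableSet_Ioc,
    ← h.integral_comp (hk.indicator measurableSet_Ioc)]
  exact integral_congr_ae (Eventually.of_forall (h.indicator_comp_mul_deriv k x y))

theorem hasDensity_comp (h : Reparam a) {f k : ℝ → ℝ} (hf : HasDensity f k) :
    HasDensity (fun z => f (a z)) (fun z => k (a z) * deriv a z) := by
  have hm := hf.locInt.aestronglyMeasurable
  refine .of_le (fun x y hxy => (h.integrableOn_comp_iff hm x y).2 ?_) fun x y hxy => ?_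
  · exact (intervalIntegrable_iff_integrableOn_Ioc_of_le (h.mono hxy)).1 (hf.intervalIntegrable _ _)
  · rw [h.intervalIntegral_comp hm hxy, hf.integral_eq]

/-- The chain rule read backwards: if `f ∘ a` has the density `(k ∘ a) a'`, then `f` has the
density `k`. -/
theorem hasDensity_of_comp (h : Reparam a) {f k l : ℝ → ℝ} (hk : Measurable k)
    (hl : HasDensity (fun z => f (a z)) l) (he : ∀ᵐ z, l z = k (a z) * deriv a z) :
    HasDensity f k := by
  have hl' := hl.congr_density he
  have hm := hk.aestronglyMeasurable (μ := volume)
  refine .of_le (fun x y hxy => ?_) fun x y hxy => ?_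
  all_goals
    obtain ⟨x, rfl⟩ := h.surj x
    obtain ⟨y, rfl⟩ := h.surj y
    wlog hxy' : x ≤ y generalizing x y
    · rw [le_antisymm hxy (h.mono (le_of_not_ge hxy'))]
      simp
  · rw [← h.integrableOn_comp_iff hm]
    exact (intervalIntegrable_iff_integrableOn_Ioc_of_le hxy').1 (hl'.intervalIntegrable _ _)
  · rw [← h.intervalIntegral_comp hm hxy', hl'.integral_eq]

theorem comp {b : ℝ → ℝ} (hb : Reparam b) (ha : Reparam a) : Reparam (fun z => b (a z)) where
  mono := hb.mono.comp ha.mono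
  ac := (ha.hasDensity_comp hb.hasDensity).ac
  surj := hb.surj.comp ha.surj

theorem ae_deriv_comp {b : ℝ → ℝ} (hb : Reparam b) (ha : Reparam a) :
    deriv (fun z => b (a z)) =ᵐ[volume] fun z => deriv b (a z) * deriv a z :=
  (ha.hasDensity_comp hb.hasDensity).ae_deriv_eq

/-- A right inverse of a change of parameter is monotone, hence measurable, and it is a two-sided
inverse at the points where the derivative is positive. -/
theorem exists_section (h : Reparam a) :
    ∃ σ : ℝ → ℝ, Measurable σ ∧ (∀ x, a (σ x) = x) ∧ ∀ z, 0 < deriv a z → σ (a z) = z := by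
  obtain ⟨σ, hσ⟩ := h.surj.hasRightInverse
  refine ⟨σ, Monotone.measurable fun x y hxy => ?_, hσ, fun z hz =>
    (h.eq_of_deriv_pos hz (hσ (a z)).symm).symm⟩
  by_contra hlt
  have := h.mono (not_le.1 hlt).le
  rw [hσ, hσ] at this
  obtain rfl := le_antisymm hxy this
  exact hlt le_rfl

end Reparam

/-! ### The distance on the extended phase space -/

/-- The distance `κ (π/2 + arctan f'(x))` of the point `(x, f x, arctan f'(x))` to `∞`. -/
noncomputable def height (κ : ℝ) (f : ℝ → ℝ) (x : ℝ) : ℝ := κ * (π / 2 + arctan (deriv f x))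

theorem dX_pointAt_none (κ : ℝ) (f : ℝ → ℝ) (x : ℝ) :
    dX κ (pointAt f x) none = height κ f x := by
  simp only [pointAt, dX, height]
  rw [abs_of_pos]
  linarith [neg_pi_div_two_lt_arctan (deriv f x)]

theorem dX_pointAt (κ : ℝ) (f g : ℝ → ℝ) (x y : ℝ) :
    dX κ (pointAt f x) (pointAt g y) =
      min (|x - y| + |f x - g y| + κ * |arctan (deriv f x) - arctan (deriv g y)|)
        (height κ f x + height κ g y) := by
  rw [← dX_pointAt_none, ← dX_pointAt_none]
  rfl

theorem height_pos {κ : ℝ} (hκ : 0 < κ) (f : ℝ → ℝ) (x : ℝ) : 0 < height κ f x := by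
  have := neg_pi_div_two_lt_arctan (deriv f x)
  exact mul_pos hκ (by linarith)

theorem height_le {κ : ℝ} (hκ : 0 < κ) (f : ℝ → ℝ) (x : ℝ) : height κ f x ≤ κ * π := by
  have := arctan_lt_pi_div_two (deriv f x)
  exact mul_le_mul_of_nonneg_left (by linarith) hκ.le

theorem measurable_height (κ : ℝ) (f : ℝ → ℝ) : Measurable (height κ f) :=
  ((measurable_arctan.comp (measurable_deriv f)).const_add _).const_mul _

theorem dX_nonneg {κ : ℝ} (hκ : 0 < κ) (p q : PointSpace) : 0 ≤ dX κ p q := by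
  rcases p with _ | ⟨x, u, w⟩ <;> rcases q with _ | ⟨x', u', w'⟩ <;> simp only [dX] <;> positivity

theorem dX_comm (κ : ℝ) (p q : PointSpace) : dX κ p q = dX κ q p := by
  rcases p with _ | ⟨x, u, w⟩ <;> rcases q with _ | ⟨x', u', w'⟩ <;> simp only [dX]
  rw [abs_sub_comm x, abs_sub_comm u, abs_sub_comm (w : ℝ), add_comm (κ * |π / 2 + (w : ℝ)|)]

/-- Passing through `∞` is the second alternative in the minimum, and the distance to `∞` is
`κ`-Lipschitz in the angle. -/
theorem dX_triangle {κ : ℝ} (hκ : 0 < κ) (p q r : PointSpace) :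
    dX κ p r ≤ dX κ p q + dX κ q r := by
  have habs : ∀ s t : ℝ, κ * |π / 2 + s| ≤ κ * |s - t| + κ * |π / 2 + t| := fun s t => by
    rw [← mul_add]
    refine mul_le_mul_of_nonneg_left ?_ hκ.le
    have := abs_add_le (s - t) (π / 2 + t)
    rwa [show s - t + (π / 2 + t) = π / 2 + s by ring] at this
  have hpos : ∀ s : ℝ, 0 ≤ κ * |π / 2 + s| := fun s => by positivity
  have hp2 : ∀ s : ℝ, 0 ≤ κ * |s| := fun s => by positivity
  rcases p with _ | ⟨x, u, w⟩ <;> rcases q with _ | ⟨x', u', w'⟩ <;>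
    rcases r with _ | ⟨x'', u'', w''⟩ <;> simp only [dX]
  · simp
  · simp
  · have := hpos w'; linarith
  · rcases min_cases (|x' - x''| + |u' - u''| + κ * |(w' : ℝ) - w''|)
      (κ * |π / 2 + (w' : ℝ)| + κ * |π / 2 + (w'' : ℝ)|) with ⟨h, -⟩ | ⟨h, -⟩ <;> rw [h]
    · have := habs w'' w'
      rw [abs_sub_comm (w'' : ℝ)] at this
      have := abs_nonneg (x' - x''); have := abs_nonneg (u' - u''); linarith
    · have := hpos w'; linarith
  · simp
  · exact min_le_right _ _
  · rcases min_cases (|x - x'| + |u - u'| + κ * |(w : ℝ) - w'|)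
      (κ * |π / 2 + (w : ℝ)| + κ * |π / 2 + (w' : ℝ)|) with ⟨h, -⟩ | ⟨h, -⟩ <;> rw [h]
    · have := habs w w'
      have := abs_nonneg (x - x'); have := abs_nonneg (u - u'); linarith
    · have := hpos w'; linarith
  · rcases min_cases (|x - x'| + |u - u'| + κ * |(w : ℝ) - w'|)
      (κ * |π / 2 + (w : ℝ)| + κ * |π / 2 + (w' : ℝ)|) with ⟨h, -⟩ | ⟨h, -⟩ <;> rw [h] <;>
    rcases min_cases (|x' - x''| + |u' - u''| + κ * |(w' : ℝ) - w''|)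
      (κ * |π / 2 + (w' : ℝ)| + κ * |π / 2 + (w'' : ℝ)|) with ⟨h', -⟩ | ⟨h', -⟩ <;> rw [h']
    · refine (min_le_left _ _).trans ?_
      have h1 := abs_sub_le x x' x''
      have h2 := abs_sub_le u u' u''
      have h3 := mul_le_mul_of_nonneg_left (abs_sub_le (w : ℝ) w' w'') hκ.le
      rw [mul_add] at h3
      linarith
    · refine (min_le_right _ _).trans ?_
      have := habs w w'
      have := abs_nonneg (x - x'); have := abs_nonneg (u - u'); linarith
    · refine (min_le_right _ _).trans ?_
      have := habs w'' w'
      rw [abs_sub_comm (w'' : ℝ)] at this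
      have := abs_nonneg (x' - x''); have := abs_nonneg (u' - u''); linarith
    · refine (min_le_right _ _).trans ?_
      have := hpos w'; linarith

theorem dX_pointAt_self {κ : ℝ} (hκ : 0 < κ) (f : ℝ → ℝ) (x : ℝ) :
    dX κ (pointAt f x) (pointAt f x) = 0 := by
  rw [dX_pointAt]
  have := height_pos hκ f x
  simp [this.le]

theorem measurable_dX_pointAt (κ : ℝ) {f g a b : ℝ → ℝ} (hf : Measurable f) (hg : Measurable g)
    (ha : Measurable a) (hb : Measurable b) :
    Measurable fun z => dX κ (pointAt f (a z)) (pointAt g (b z)) := by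
  simp only [dX_pointAt]
  have h1 : Measurable fun z => deriv f (a z) := (measurable_deriv f).comp ha
  have h2 : Measurable fun z => deriv g (b z) := (measurable_deriv g).comp hb
  have h3 : Measurable fun z => f (a z) := hf.comp ha
  have h4 : Measurable fun z => g (b z) := hg.comp hb
  have h5 := (measurable_height κ f).comp ha
  have h6 := (measurable_height κ g).comp hb
  refine Measurable.min (((ha.sub hb).abs.add (h3.sub h4).abs).add
    ((((measurable_arctan.comp h1).sub (measurable_arctan.comp h2)).abs).const_mul κ)) (h5.add h6)

namespace MemX
variable {u : ℝ → ℝ}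

theorem hasDensity (hu : MemX u) : HasDensity u (deriv u) := .of_ac hu.ac

theorem continuous (hu : MemX u) : Continuous u := hu.hasDensity.continuous

theorem integrable_sq (hu : MemX u) : Integrable fun x => deriv u x ^ 2 := hu.memLp.integrable_sq

end MemX

theorem energy_nonneg (u : ℝ → ℝ) : 0 ≤ energy u := integral_nonneg fun _ => sq_nonneg _

namespace IsWeight
variable {w : ℝ → ℝ}

theorem comp (hw : IsWeight w) {σ : ℝ → ℝ} (hσ : Measurable σ) : IsWeight fun x => w (σ x) where
  measurable := hw.measurable.comp hσ
  finite_range := hw.finite_range.subset (range_comp_subset_range σ w)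
  mem_Icc _ := hw.mem_Icc _

theorem indicator (hw : IsWeight w) {K : Set ℝ} (hK : MeasurableSet K) :
    IsWeight (K.indicator w) where
  measurable := hw.measurable.indicator hK
  finite_range := (hw.finite_range.insert 0).subset (by
    rintro _ ⟨x, rfl⟩
    by_cases hx : x ∈ K <;> simp [hx])
  mem_Icc x := by
    by_cases hx : x ∈ K
    · simpa [hx] using hw.mem_Icc x
    · simp [hx]

theorem const {c : ℝ} (hc : c ∈ Icc (0 : ℝ) 1) : IsWeight fun _ => c where
  measurable := measurable_const
  finite_range := (finite_singleton c).subset (by rintro _ ⟨_, rfl⟩; rfl)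
  mem_Icc _ := hc

end IsWeight

/-! ### Parametrised plans -/

/-- A parametrised plan from `u` to `v`: the point `a z` of the graph of `u` is sent to the point
`b z` of the graph of `v`, and `w₁ z`, `w₂ z` are the fractions of energy that take part in the
transport. All data are functions of the parameter `z`, so that `u` and `v` play the same role; the
plans in the definition of `J` are those with `a = id` and `w₂ = φ₂ ∘ ψ`. -/
structure IsParamPlan (u v a b w₁ w₂ : ℝ → ℝ) : Prop where
  left : Reparam a
  right : Reparam b
  weight₁ : IsWeight w₁
  weight₂ : IsWeight w₂
  balance : ∀ᵐ z, w₁ z * (deriv u (a z) ^ 2 * deriv a z) = w₂ z * (deriv v (b z) ^ 2 * deriv b z)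

/-- The cost of a parametrised plan per unit of parameter. Its terms are the transport from `u` to
`v`, and the transport to `∞` of the remaining energies of `u` and of `v`. -/
noncomputable def costDensity (κ : ℝ) (u v a b w₁ w₂ : ℝ → ℝ) (z : ℝ) : ℝ :=
  dX κ (pointAt u (a z)) (pointAt v (b z)) * (w₁ z * (deriv u (a z) ^ 2 * deriv a z))
  + height κ u (a z) * ((1 - w₁ z) * (deriv u (a z) ^ 2 * deriv a z))
  + height κ v (b z) * ((1 - w₂ z) * (deriv v (b z) ^ 2 * deriv b z))

/-- The total cost of a parametrised plan. -/
noncomputable def paramCost (κ : ℝ) (u v a b w₁ w₂ : ℝ → ℝ) : ℝ≥0∞ :=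
  ∫⁻ z, ENNReal.ofReal (costDensity κ u v a b w₁ w₂ z)

theorem paramCost_eq {κ : ℝ} (hκ : 0 < κ) {u v a b w₁ w₂ : ℝ → ℝ} (hu : Measurable u)
    (hv : Measurable v) (ha : Reparam a) (hb : Reparam b) (h₁ : IsWeight w₁) (h₂ : IsWeight w₂) :
    paramCost κ u v a b w₁ w₂ =
      (∫⁻ z, ENNReal.ofReal (dX κ (pointAt u (a z)) (pointAt v (b z)) *
        (w₁ z * (deriv u (a z) ^ 2 * deriv a z))))
      + (∫⁻ z, ENNReal.ofReal (height κ u (a z) * ((1 - w₁ z) * (deriv u (a z) ^ 2 * deriv a z))))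
      + ∫⁻ z, ENNReal.ofReal (height κ v (b z) * ((1 - w₂ z) * (deriv v (b z) ^ 2 * deriv b z))) := by
  have hU : Measurable fun z => deriv u (a z) ^ 2 * deriv a z :=
    (((measurable_deriv u).comp ha.continuous.measurable).pow_const 2).mul (measurable_deriv a)
  have m1 : Measurable fun z => dX κ (pointAt u (a z)) (pointAt v (b z)) *
        (w₁ z * (deriv u (a z) ^ 2 * deriv a z)) :=
    (measurable_dX_pointAt κ hu hv ha.continuous.measurable hb.continuous.measurable).mul
      (h₁.measurable.mul hU)
  have m2 : Measurable fun z => height κ u (a z) * ((1 - w₁ z) * (deriv u (a z) ^ 2 * deriv a z)) :=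
    ((measurable_height κ u).comp ha.continuous.measurable).mul
      ((h₁.measurable.const_sub 1).mul hU)
  have hU0 : ∀ z, 0 ≤ deriv u (a z) ^ 2 * deriv a z := fun z =>
    mul_nonneg (sq_nonneg _) (ha.deriv_nonneg z)
  have hV0 : ∀ z, 0 ≤ deriv v (b z) ^ 2 * deriv b z := fun z =>
    mul_nonneg (sq_nonneg _) (hb.deriv_nonneg z)
  have n1 : ∀ z, 0 ≤ dX κ (pointAt u (a z)) (pointAt v (b z)) *
        (w₁ z * (deriv u (a z) ^ 2 * deriv a z)) := fun z =>
    mul_nonneg (dX_nonneg hκ _ _) (mul_nonneg (h₁.mem_Icc z).1 (hU0 z))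
  have n2 : ∀ z, 0 ≤ height κ u (a z) * ((1 - w₁ z) * (deriv u (a z) ^ 2 * deriv a z)) := fun z =>
    mul_nonneg (height_pos hκ _ _).le (mul_nonneg (by linarith [(h₁.mem_Icc z).2]) (hU0 z))
  have n3 : ∀ z, 0 ≤ height κ v (b z) * ((1 - w₂ z) * (deriv v (b z) ^ 2 * deriv b z)) := fun z =>
    mul_nonneg (height_pos hκ _ _).le (mul_nonneg (by linarith [(h₂.mem_Icc z).2]) (hV0 z))
  have m12 : Measurable fun z => ENNReal.ofReal (dX κ (pointAt u (a z)) (pointAt v (b z)) *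
        (w₁ z * (deriv u (a z) ^ 2 * deriv a z))) +
      ENNReal.ofReal (height κ u (a z) * ((1 - w₁ z) * (deriv u (a z) ^ 2 * deriv a z))) :=
    m1.ennreal_ofReal.add m2.ennreal_ofReal
  rw [← lintegral_add_left m1.ennreal_ofReal, ← lintegral_add_left m12]
  refine lintegral_congr fun z => ?_
  simp only [costDensity]
  rw [ENNReal.ofReal_add (add_nonneg (n1 z) (n2 z)) (n3 z), ENNReal.ofReal_add (n1 z) (n2 z)]

theorem planCost_eq_paramCost {κ : ℝ} (hκ : 0 < κ) {u v ψ φ₁ φ₂ : ℝ → ℝ} (hu : Measurable u)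
    (hv : Measurable v) (hψ : Reparam ψ) (h₁ : IsWeight φ₁) (h₂ : IsWeight φ₂) :
    planCost κ u v ψ φ₁ φ₂ = paramCost κ u v (fun x => x) ψ φ₁ (fun x => φ₂ (ψ x)) := by
  rw [paramCost_eq hκ hu hv .id hψ h₁ (h₂.comp hψ.continuous.measurable), planCost]
  simp only [dX_pointAt_none, deriv_id'', mul_one, mul_assoc]

theorem IsPlan.reparam {u v ψ φ₁ φ₂ : ℝ → ℝ} (h : IsPlan u v ψ φ₁ φ₂) : Reparam ψ :=
  ⟨h.mono, h.ac, h.surj⟩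

theorem IsPlan.isParamPlan {u v ψ φ₁ φ₂ : ℝ → ℝ} (h : IsPlan u v ψ φ₁ φ₂) :
    IsParamPlan u v (fun x => x) ψ φ₁ (fun x => φ₂ (ψ x)) where
  left := .id
  right := h.reparam
  weight₁ := h.weight₁
  weight₂ := h.weight₂.comp h.reparam.continuous.measurable
  balance := by
    filter_upwards [h.balance] with x hx
    simp only [deriv_id'', mul_one, hx]
    ring

/-! ### Straightening a parametrised plan -/

/-- Two primitives that agree on a set have the same density almost everywhere on it: almost every
point of the set is a limit of points of the set from the right. -/
theorem HasDensity.ae_eq_of_eqOn {f g k l : ℝ → ℝ} (hf : HasDensity f k) (hg : HasDensity g l)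
    {K : Set ℝ} (h : EqOn f g K) : ∀ᵐ z, z ∈ K → k z = l z := by
  have hc : {x ∈ K | 𝓝[K ∩ Ioi x] x = ⊥}.Countable := countable_setOfPred_isolated_right_within
  filter_upwards [hf.ae_hasDerivAt, hg.ae_hasDerivAt, hc.ae_notMem volume] with z h1 h2 h3 hz
  have hne : (𝓝[K ∩ Ioi z] z).NeBot := ⟨fun hb => h3 ⟨hz, hb⟩⟩
  have t1 := hasDerivWithinAt_iff_tendsto_slope.1 (h1.hasDerivWithinAt (s := K ∩ Ioi z))
  have t2 := hasDerivWithinAt_iff_tendsto_slope.1 (h2.hasDerivWithinAt (s := K ∩ Ioi z))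
  have hd : (K ∩ Ioi z) \ {z} = K ∩ Ioi z := by
    ext y; simp only [Set.mem_sdiff, mem_inter_iff, mem_Ioi, mem_singleton_iff]
    exact ⟨fun h => h.1, fun h => ⟨h, h.2.ne'⟩⟩
  rw [hd] at t1 t2
  refine tendsto_nhds_unique (t1.congr' ?_) t2
  filter_upwards [self_mem_nhdsWithin] with y hy
  simp only [slope, h hy.1, h hz]

/-- The Lipschitz extension of `b ∘ a⁻¹` from `a '' K` to a change of parameter. The candidate is
the one-sided McShane extension `x ↦ inf_{z ∈ K} (b z + n (x - a z)₊)`, which is nondecreasing. -/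
theorem exists_reparam_extension {a b : ℝ → ℝ} (ha : Monotone a) (hb : Monotone b) {K : Set ℝ}
    {R : ℝ} (hR : K ⊆ Icc (-R) R) {n : ℝ} (hn : 0 < n)
    (hK : ∀ z ∈ K, ∀ z' ∈ K, |b z' - b z| ≤ n * |a z' - a z|) :
    ∃ ψ, Reparam ψ ∧ ∀ z ∈ K, ψ (a z) = b z := by
  rcases K.eq_empty_or_nonempty with rfl | ⟨z₀, hz₀⟩
  · exact ⟨fun x => x, .id, by simp⟩
  have : Nonempty K := ⟨⟨z₀, hz₀⟩⟩
  set G : ℝ → ℝ := fun x => ⨅ z : K, (b z + n * max (x - a z) 0) with hG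
  have hbdd : ∀ x, BddBelow (range fun z : K => b z + n * max (x - a z) 0) := by
    intro x
    refine ⟨b (-R), ?_⟩
    rintro _ ⟨z, rfl⟩
    have h1 := hb (hR z.2).1
    have : 0 ≤ n * max (x - a z) 0 := mul_nonneg hn.le (le_max_right _ _)
    simp only; linarith
  have hGle : ∀ x (z : K), G x ≤ b z + n * max (x - a z) 0 := fun x z => ciInf_le (hbdd x) z
  have hGmono : Monotone G := fun x y hxy => ciInf_mono (hbdd x) fun z => by gcongr
  have hGlip : ∀ x y, x ≤ y → G y ≤ G x + n * (y - x) := by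
    intro x y hxy
    rw [← sub_le_iff_le_add]
    refine le_ciInf fun z => ?_
    have h1 := hGle y z
    have h2 : max (y - a z) 0 ≤ max (x - a z) 0 + (y - x) := by
      refine max_le ?_ ?_
      · linarith [le_max_left (x - a z) 0]
      · linarith [le_max_right (x - a z) 0]
    have := mul_le_mul_of_nonneg_left h2 hn.le
    linarith
  have hGeq : ∀ z ∈ K, G (a z) = b z := by
    intro z hz
    refine le_antisymm ((hGle _ ⟨z, hz⟩).trans (by simp)) (le_ciInf fun y => ?_)
    rcases le_total (y : ℝ) z with h | h
    · have h1 := hK y y.2 z hz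
      rw [abs_of_nonneg (sub_nonneg.2 (hb h)), abs_of_nonneg (sub_nonneg.2 (ha h))] at h1
      have := mul_le_mul_of_nonneg_left (le_max_left (a z - a y) 0) hn.le
      linarith
    · have := hb h
      have : 0 ≤ n * max (a z - a y) 0 := mul_nonneg hn.le (le_max_right _ _)
      linarith
  -- the second summand makes the extension onto and does not change it on `a '' K`
  set ψ : ℝ → ℝ := fun x => G x + min (x - a (-R)) 0 with hψ
  have hmono : Monotone ψ := fun x y hxy => add_le_add (hGmono hxy) (by gcongr)
  have hlip : ∀ x y, x ≤ y → ψ y ≤ ψ x + (n + 1) * (y - x) := by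
    intro x y hxy
    have h1 := hGlip x y hxy
    have h2 : min (y - a (-R)) 0 ≤ min (x - a (-R)) 0 + (y - x) := by
      rw [← sub_le_iff_le_add]
      refine le_min ?_ ?_
      · linarith [min_le_left (y - a (-R)) 0]
      · linarith [min_le_right (y - a (-R)) 0]
    simp only [hψ]; linarith
  have hL : LipschitzWith (Real.toNNReal (n + 1)) ψ := by
    refine LipschitzWith.of_dist_le_mul fun x y => ?_
    rw [Real.coe_toNNReal _ (by linarith), Real.dist_eq, Real.dist_eq]
    rcases le_total x y with h | h
    · rw [abs_sub_comm, abs_sub_comm x, abs_of_nonneg (sub_nonneg.2 (hmono h)),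
        abs_of_nonneg (sub_nonneg.2 h)]
      linarith [hlip x y h]
    · rw [abs_of_nonneg (sub_nonneg.2 (hmono h)), abs_of_nonneg (sub_nonneg.2 h)]
      linarith [hlip y x h]
  have haR : ∀ z ∈ K, a (-R) ≤ a z := fun z hz => ha (hR hz).1
  refine ⟨ψ, ⟨hmono, fun x y => hL.lipschitzOnWith.absolutelyContinuousOnInterval, ?_⟩, ?_⟩
  · refine hL.continuous.surjective ?_ ?_
    · refine tendsto_atTop_mono' _ (f₁ := fun x => b (-R) + n * (x - a R)) ?_ ?_
      · filter_upwards [eventually_ge_atTop (a (-R))] with x hx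
        have h1 : min (x - a (-R)) 0 = 0 := min_eq_right (by linarith)
        simp only [hψ, h1, add_zero]
        refine le_ciInf fun z => ?_
        have h2 := hb (hR z.2).1
        have h3 := ha (hR z.2).2
        have h4 : x - a R ≤ max (x - a z) 0 := le_max_of_le_left (by linarith)
        have := mul_le_mul_of_nonneg_left h4 hn.le
        linarith
      · exact tendsto_atTop_add_const_left _ _
          ((tendsto_atTop_add_const_right _ (-a R) tendsto_id).const_mul_atTop hn)
    · refine tendsto_atBot_mono' _ (f₁ := fun x => b z₀ + (x - a (-R))) ?_ ?_
      · filter_upwards [eventually_le_atBot (a (-R))] with x hx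
        have h1 := hGle x ⟨z₀, hz₀⟩
        rw [max_eq_right (by linarith [haR z₀ hz₀] : x - a z₀ ≤ 0), mul_zero, add_zero] at h1
        exact add_le_add h1 (min_le_left _ _)
      · exact tendsto_atBot_add_const_left _ _ (tendsto_atBot_add_const_right _ (-a (-R)) tendsto_id)
  · intro z hz
    have : min (a z - a (-R)) 0 = 0 := min_eq_right (by linarith [haR z hz])
    simp only [hψ, this, add_zero, hGeq z hz]

/-- The points `z` of `[-R, R]` from which the increments of `b` within `[-R, R]` are bounded by `n`
times the increments of `a`. -/
def slopeSet (a b : ℝ → ℝ) (R : ℝ) (n : ℕ) : Set ℝ :=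
  {z | z ∈ Icc (-R) R ∧ ∀ z' ∈ Icc (-R) R, |b z' - b z| ≤ (n : ℝ) * |a z' - a z|}

theorem isClosed_slopeSet {a b : ℝ → ℝ} (ha : Continuous a) (hb : Continuous b) (R : ℝ) (n : ℕ) :
    IsClosed (slopeSet a b R n) := by
  have : slopeSet a b R n = Icc (-R) R ∩
      ⋂ z' ∈ Icc (-R) R, {z | |b z' - b z| ≤ (n : ℝ) * |a z' - a z|} := by
    ext z; simp [slopeSet]
  rw [this]
  refine isClosed_Icc.inter (isClosed_biInter fun z' _ => isClosed_le ?_ ?_)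
  · exact (continuous_const.sub hb).abs
  · exact continuous_const.mul (continuous_const.sub ha).abs

theorem monotone_slopeSet (a b : ℝ → ℝ) (R : ℝ) : Monotone (slopeSet a b R) := by
  intro m n hmn z hz
  refine ⟨hz.1, fun z' hz' => (hz.2 z' hz').trans ?_⟩
  gcongr

/-- Near `z` the bound holds because both functions are differentiable and `a' z > 0`; away from `z`
because `a` stays away from `a z`. -/
theorem exists_mem_slopeSet {a b : ℝ → ℝ} (ha : Reparam a) (hb : Monotone b) {R z : ℝ}
    (hz : z ∈ Icc (-R) R) (hda : 0 < deriv a z) (hdb : DifferentiableAt ℝ b z) :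
    ∃ n, z ∈ slopeSet a b R n := by
  have hdiff : DifferentiableAt ℝ a z := differentiableAt_of_deriv_ne_zero hda.ne'
  have h0 : (fun y => y - z) =O[𝓝 z] fun y => a y - a z := by
    have := (hdiff.hasDerivAt.isTheta_sub hda.ne').isBigO_symm
    rwa [prod_pure, Asymptotics.isBigO_map] at this
  have h1 : (fun y => b y - b z) =O[𝓝 z] fun y => a y - a z :=
    hdb.hasDerivAt.isBigO_sub.trans h0
  obtain ⟨C, hC⟩ := h1.bound
  obtain ⟨δ, hδ, hball⟩ := Metric.eventually_nhds_iff.1 hC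
  set m := min (a (z + δ) - a z) (a z - a (z - δ)) with hm
  have hmpos : 0 < m := lt_min
    (sub_pos.2 (ha.lt_of_lt_of_deriv_pos (by linarith) (.inl hda)))
    (sub_pos.2 (ha.lt_of_lt_of_deriv_pos (by linarith) (.inr hda)))
  set D := b R - b (-R)
  have hD : ∀ z' ∈ Icc (-R) R, |b z' - b z| ≤ D := by
    intro z' hz'
    rw [abs_le]
    have := hb hz.1; have := hb hz.2; have := hb hz'.1; have := hb hz'.2
    constructor <;> simp only [D] <;> linarith
  obtain ⟨n, hn⟩ := exists_nat_ge (max C (D / m))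
  refine ⟨n, hz, fun z' hz' => ?_⟩
  by_cases hd : dist z' z < δ
  · have h2 := hball hd
    simp only [Real.norm_eq_abs] at h2
    refine h2.trans ?_
    gcongr
    exact (le_max_left _ _).trans hn
  · have h3 : m ≤ |a z' - a z| := by
      rw [Real.dist_eq, not_lt] at hd
      rcases le_abs.1 hd with h | h
      · have h4 := ha.mono (show z + δ ≤ z' by linarith)
        exact (min_le_left _ _).trans ((by linarith : _ ≤ a z' - a z).trans (le_abs_self _))
      · have h4 := ha.mono (show z' ≤ z - δ by linarith)
        exact (min_le_right _ _).trans ((by linarith : _ ≤ -(a z' - a z)).trans (neg_le_abs _))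
    calc |b z' - b z| ≤ D := hD z' hz'
      _ = D / m * m := by field_simp
      _ ≤ n * |a z' - a z| := by
        gcongr
        exact (le_max_right _ _).trans hn

/-- If `ψ` sends `a z` to `b z` for `z ∈ K`, the restriction of a parametrised plan to the
parameters in `K` is a plan in the sense of the definition of `J`, with the same cost. -/
theorem IsParamPlan.exists_plan {κ : ℝ} (hκ : 0 < κ) {u v a b w₁ w₂ : ℝ → ℝ} (hu : Measurable u)
    (hv : Measurable v) (h : IsParamPlan u v a b w₁ w₂) {K : Set ℝ} (hK : MeasurableSet K)
    {ψ : ℝ → ℝ} (hψ : Reparam ψ) (hext : ∀ z ∈ K, ψ (a z) = b z) :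
    ∃ φ₁ φ₂, IsPlan u v ψ φ₁ φ₂ ∧
      planCost κ u v ψ φ₁ φ₂ = paramCost κ u v a b (K.indicator w₁) (K.indicator w₂) := by
  obtain ⟨σ, hσm, hσ, hσ'⟩ := h.left.exists_section
  obtain ⟨τ, hτm, hτ, hτ'⟩ := h.right.exists_section
  have ha := h.left
  have hb := h.right
  have hw₁ := (h.weight₁.indicator hK)
  have hw₂ := (h.weight₂.indicator hK)
  have hφ₁ := hw₁.comp hσm
  have hφ₂ := hw₂.comp hτm
  have hφ₁a : ∀ z, 0 < deriv a z → K.indicator w₁ (σ (a z)) = K.indicator w₁ z := fun z hz => by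
    rw [hσ' z hz]
  have hφ₂b : ∀ z, 0 < deriv b z → K.indicator w₂ (τ (b z)) = K.indicator w₂ z := fun z hz => by
    rw [hτ' z hz]
  have hderiv := (ha.hasDensity_comp hψ.hasDensity).ae_eq_of_eqOn hb.hasDensity (K := K) hext
  refine ⟨fun x => K.indicator w₁ (σ x), fun x => K.indicator w₂ (τ x),
    ⟨hψ.mono, hψ.ac, hψ.surj, hφ₁, hφ₂, ?_⟩, ?_⟩
  · refine ha.ae_of_comp (measurableSet_eq_fun ?_ ?_) ?_
    · exact hφ₁.measurable.mul ((measurable_deriv u).pow_const 2)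
    · exact ((measurable_deriv ψ).mul (hφ₂.measurable.comp hψ.continuous.measurable)).mul
        (((measurable_deriv v).comp hψ.continuous.measurable).pow_const 2)
    · filter_upwards [hderiv, h.balance] with z h1 h2 hz
      rw [hφ₁a z hz]
      by_cases hzK : z ∈ K
      · have h3 := h1 hzK
        rw [hext z hzK, indicator_of_mem hzK]
        refine mul_right_cancel₀ hz.ne' ?_
        rcases (hb.deriv_nonneg z).eq_or_lt with hbz | hbz
        · rw [← hbz] at h2 h3
          have h4 : deriv ψ (a z) = 0 := by
            rcases mul_eq_zero.1 h3 with h | h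
            · exact h
            · exact absurd h hz.ne'
          rw [h4]
          linarith
        · rw [hφ₂b z hbz, indicator_of_mem hzK]
          rw [← h3] at h2
          linarith
      · rw [indicator_of_notMem hzK, zero_mul]
        rcases (hψ.deriv_nonneg (a z)).eq_or_lt with h0 | h0
        · simp [← h0]
        · -- if `ψ (a z)` were reached from `K`, `ψ` would be constant near `a z`
          have hn : τ (ψ (a z)) ∉ K := by
            intro hmem
            have h3 := hext _ hmem
            rw [hτ] at h3
            have h4 := hψ.eq_of_deriv_pos h0 h3.symm
            exact hzK (ha.eq_of_deriv_pos hz h4 ▸ hmem)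
          rw [indicator_of_notMem hn]
          ring
  · rw [planCost_eq_paramCost hκ hu hv hψ hφ₁ hφ₂,
      paramCost_eq hκ hu hv .id hψ hφ₁ (hφ₂.comp hψ.continuous.measurable),
      paramCost_eq hκ hu hv ha hb hw₁ hw₂]
    simp only [deriv_id'', mul_one]
    have mu := (measurable_deriv u).pow_const 2
    have mv := (measurable_deriv v).pow_const 2
    congr 1
    · congr 1
      · rw [← ha.lintegral_ofReal_comp]
        · refine lintegral_congr fun z => ?_
          congr 1
          rcases (ha.deriv_nonneg z).eq_or_lt with hz | hz
          · simp [← hz]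
          · simp only [hφ₁a z hz]
            by_cases hzK : z ∈ K
            · rw [hext z hzK]; ring
            · rw [indicator_of_notMem hzK]; ring
        · exact (measurable_dX_pointAt κ hu hv measurable_id hψ.continuous.measurable).mul
            (hφ₁.measurable.mul mu)
      · rw [← ha.lintegral_ofReal_comp]
        · refine lintegral_congr fun z => ?_
          congr 1
          rcases (ha.deriv_nonneg z).eq_or_lt with hz | hz
          · simp [← hz]
          · simp only [hφ₁a z hz]
            ring
        · exact (measurable_height κ u).mul ((hφ₁.measurable.const_sub 1).mul mu)
    · have hm : Measurable fun x => height κ v x * ((1 - K.indicator w₂ (τ x)) * deriv v x ^ 2) :=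
        (measurable_height κ v).mul ((hφ₂.measurable.const_sub 1).mul mv)
      have e1 := hψ.lintegral_ofReal_comp hm
      rw [← hb.lintegral_ofReal_comp hm] at e1
      simp only [mul_assoc] at e1 ⊢
      rw [e1]
      refine lintegral_congr fun z => ?_
      congr 1
      rcases (hb.deriv_nonneg z).eq_or_lt with hz | hz
      · simp [← hz]
      · rw [hφ₂b z hz]

/-- Sending the energy with parameter outside `K` to `∞`, instead of transporting it, costs at most
`2κπ` per unit of energy. -/
theorem paramCost_indicator_le {κ : ℝ} (hκ : 0 < κ) {u v a b w₁ w₂ : ℝ → ℝ}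
    (h : IsParamPlan u v a b w₁ w₂) {K : Set ℝ} (hK : MeasurableSet K) :
    paramCost κ u v a b (K.indicator w₁) (K.indicator w₂) ≤ paramCost κ u v a b w₁ w₂ +
      (volume.withDensity fun z => ENNReal.ofReal
        (2 * (κ * π) * (w₁ z * (deriv u (a z) ^ 2 * deriv a z)))) Kᶜ := by
  have mg : Measurable fun z => ENNReal.ofReal
      (2 * (κ * π) * (w₁ z * (deriv u (a z) ^ 2 * deriv a z))) :=
    ((h.weight₁.measurable.mul ((((measurable_deriv u).comp
      h.left.continuous.measurable).pow_const 2).mul (measurable_deriv a))).const_mul _).ennreal_ofReal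
  rw [withDensity_apply _ hK.compl, ← lintegral_indicator hK.compl, paramCost, paramCost,
    ← lintegral_add_right _ (mg.indicator hK.compl)]
  refine lintegral_mono_ae ?_
  filter_upwards [h.balance] with z hz
  by_cases hzK : z ∈ K
  · simp [hzK, costDensity]
  · rw [indicator_of_mem (show z ∈ Kᶜ from hzK), ← ENNReal.ofReal_add]
    · refine ENNReal.ofReal_le_ofReal ?_
      simp only [costDensity, indicator_of_notMem hzK]
      have h1 := height_le hκ u (a z)
      have h2 := height_le hκ v (b z)
      have hg : 0 ≤ w₁ z * (deriv u (a z) ^ 2 * deriv a z) :=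
        mul_nonneg (h.weight₁.mem_Icc z).1 (mul_nonneg (sq_nonneg _) (h.left.deriv_nonneg z))
      have h3 := mul_le_mul_of_nonneg_right h1 hg
      have h4 := mul_le_mul_of_nonneg_right h2 hg
      have h5 := mul_nonneg (dX_nonneg hκ (pointAt u (a z)) (pointAt v (b z))) hg
      have e1 : height κ v (b z) * ((1 - w₂ z) * (deriv v (b z) ^ 2 * deriv b z)) =
        height κ v (b z) * (deriv v (b z) ^ 2 * deriv b z) -
          height κ v (b z) * (w₁ z * (deriv u (a z) ^ 2 * deriv a z)) := by
        rw [hz]; ring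
      rw [e1]
      linarith
    · refine add_nonneg (add_nonneg ?_ ?_) ?_
      · exact mul_nonneg (dX_nonneg hκ _ _) (mul_nonneg (h.weight₁.mem_Icc z).1
          (mul_nonneg (sq_nonneg _) (h.left.deriv_nonneg z)))
      · exact mul_nonneg (height_pos hκ _ _).le (mul_nonneg (by linarith [(h.weight₁.mem_Icc z).2])
          (mul_nonneg (sq_nonneg _) (h.left.deriv_nonneg z)))
      · exact mul_nonneg (height_pos hκ _ _).le (mul_nonneg (by linarith [(h.weight₂.mem_Icc z).2])
          (mul_nonneg (sq_nonneg _) (h.right.deriv_nonneg z)))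
    · exact mul_nonneg (by positivity) (mul_nonneg (h.weight₁.mem_Icc z).1
          (mul_nonneg (sq_nonneg _) (h.left.deriv_nonneg z)))

theorem distJ_le_planCost {κ : ℝ} {u v ψ φ₁ φ₂ : ℝ → ℝ} (h : IsPlan u v ψ φ₁ φ₂) :
    distJ κ u v ≤ planCost κ u v ψ φ₁ φ₂ :=
  iInf_le_of_le ψ <| iInf_le_of_le φ₁ <| iInf_le_of_le φ₂ <| iInf_le _ h

theorem le_distJ {κ : ℝ} {u v : ℝ → ℝ} {c : ℝ≥0∞}
    (h : ∀ ψ φ₁ φ₂, IsPlan u v ψ φ₁ φ₂ → c ≤ planCost κ u v ψ φ₁ φ₂) : c ≤ distJ κ u v :=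
  le_iInf fun ψ => le_iInf fun φ₁ => le_iInf fun φ₂ => le_iInf fun hp => h ψ φ₁ φ₂ hp

theorem lintegral_energy_comp {u a : ℝ → ℝ} (ha : Reparam a) :
    ∫⁻ z, ENNReal.ofReal (deriv u (a z) ^ 2 * deriv a z) = ∫⁻ x, ENNReal.ofReal (deriv u x ^ 2) :=
  ha.lintegral_ofReal_comp ((measurable_deriv u).pow_const 2)

theorem MemX.lintegral_eq {u : ℝ → ℝ} (hu : MemX u) :
    ∫⁻ x, ENNReal.ofReal (deriv u x ^ 2) = ENNReal.ofReal (energy u) :=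
  (ofReal_integral_eq_lintegral_ofReal hu.integrable_sq
    (Eventually.of_forall fun _ => sq_nonneg _)).symm

/-- Parametrised plans are competitors for `J`. The proof exhausts the measure `μ` of the
transported energy (times `2κπ`) by the sets `slopeSet a b R n`, with `n → ∞` and then `R → ∞`. -/
theorem distJ_le_paramCost {κ : ℝ} (hκ : 0 < κ) {u v a b w₁ w₂ : ℝ → ℝ} (hu : MemX u)
    (hv : MemX v) (h : IsParamPlan u v a b w₁ w₂) :
    distJ κ u v ≤ paramCost κ u v a b w₁ w₂ := by
  set μ : Measure ℝ := volume.withDensity fun z => ENNReal.ofReal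
    (2 * (κ * π) * (w₁ z * (deriv u (a z) ^ 2 * deriv a z))) with hμ
  have ha := h.left
  have hb := h.right
  have hfin : μ univ ≠ ⊤ := by
    rw [hμ, withDensity_apply _ MeasurableSet.univ, Measure.restrict_univ]
    refine ne_top_of_le_ne_top (b := ENNReal.ofReal (2 * (κ * π)) * ENNReal.ofReal (energy u))
      (ENNReal.mul_ne_top ENNReal.ofReal_ne_top ENNReal.ofReal_ne_top) ?_
    rw [← hu.lintegral_eq, ← lintegral_energy_comp ha, ← lintegral_const_mul' _ _
      ENNReal.ofReal_ne_top]
    refine lintegral_mono fun z => ?_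
    rw [← ENNReal.ofReal_mul (by positivity)]
    refine ENNReal.ofReal_le_ofReal ?_
    refine mul_le_mul_of_nonneg_left ?_ (by positivity)
    exact mul_le_of_le_one_left (mul_nonneg (sq_nonneg _) (ha.deriv_nonneg z))
      (h.weight₁.mem_Icc z).2
  have : IsFiniteMeasure μ := ⟨lt_top_iff_ne_top.2 hfin⟩
  have hKm : ∀ R n, MeasurableSet (slopeSet a b R n) := fun R n =>
    (isClosed_slopeSet ha.continuous hb.continuous R n).measurableSet
  have step1 : ∀ (R : ℝ) (n : ℕ),
      distJ κ u v + μ (slopeSet a b R n) ≤ paramCost κ u v a b w₁ w₂ + μ univ := by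
    intro R n
    obtain ⟨ψ, hψ, hext⟩ := exists_reparam_extension ha.mono hb.mono
      (K := slopeSet a b R n) (fun z hz => hz.1) (n := n + 1) (by positivity)
      (fun z hz z' hz' => (hz.2 z' hz'.1).trans (by gcongr; linarith))
    obtain ⟨φ₁, φ₂, hp, hcost⟩ := h.exists_plan hκ hu.continuous.measurable
      hv.continuous.measurable (hKm R n) hψ hext
    have h1 := (distJ_le_planCost hp).trans (hcost.le.trans (paramCost_indicator_le hκ h (hKm R n)))
    calc distJ κ u v + μ (slopeSet a b R n)
        ≤ paramCost κ u v a b w₁ w₂ + μ (slopeSet a b R n)ᶜ + μ (slopeSet a b R n) := by gcongr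
      _ = paramCost κ u v a b w₁ w₂ + μ univ := by
        rw [add_assoc, add_comm (μ _ᶜ), measure_add_measure_compl (hKm R n)]
  have step2 : ∀ R : ℝ, distJ κ u v + μ (Icc (-R) R) ≤ paramCost κ u v a b w₁ w₂ + μ univ := by
    intro R
    have hle : μ (Icc (-R) R) ≤ μ (⋃ n, slopeSet a b R n) := by
      refine measure_mono_ae ?_
      refine (ae_withDensity_iff ?_).2 ?_
      · exact ((h.weight₁.measurable.mul ((((measurable_deriv u).comp
          ha.continuous.measurable).pow_const 2).mul (measurable_deriv a))).const_mul _).ennreal_ofReal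
      · filter_upwards [hb.hasDensity.ae_hasDerivAt] with z hz hne hmem
        have hda : 0 < deriv a z := by
          refine lt_of_le_of_ne (ha.deriv_nonneg z) fun h0 => hne ?_
          simp [← h0]
        exact mem_iUnion.2 (exists_mem_slopeSet ha hb.mono hmem hda hz.differentiableAt)
    refine (add_le_add le_rfl hle).trans ?_
    have ht := tendsto_measure_iUnion_atTop (μ := μ) (monotone_slopeSet a b R)
    exact le_of_tendsto' (ht.const_add _) fun n => step1 R n
  have step3 : distJ κ u v + μ univ ≤ paramCost κ u v a b w₁ w₂ + μ univ := by
    have hmono : Monotone fun n : ℕ => Icc (-(n : ℝ)) n := fun m n hmn =>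
      Icc_subset_Icc (by simpa using hmn) (by simpa using hmn)
    have ht := tendsto_measure_iUnion_atTop (μ := μ) hmono
    have hU : (⋃ n : ℕ, Icc (-(n : ℝ)) n) = univ := by
      refine eq_univ_of_forall fun z => mem_iUnion.2 ?_
      obtain ⟨n, hn⟩ := exists_nat_ge |z|
      exact ⟨n, abs_le.1 hn⟩
    rw [hU] at ht
    exact le_of_tendsto' (ht.const_add _) fun n => step2 n
  exact (ENNReal.add_le_add_iff_right hfin).1 step3

/-! ### Distance axioms -/

theorem distJ_lt_top {κ : ℝ} (hκ : 0 < κ) {u v : ℝ → ℝ} (hu : MemX u) (hv : MemX v) :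
    distJ κ u v < ⊤ := by
  have h0 : IsWeight fun _ => (0 : ℝ) := .const (by simp)
  have hp : IsParamPlan u v (fun x => x) (fun x => x) (fun _ => 0) (fun _ => 0) :=
    ⟨.id, .id, h0, h0, by simp⟩
  refine (distJ_le_paramCost hκ hu hv hp).trans_lt ?_
  rw [paramCost_eq hκ hu.continuous.measurable hv.continuous.measurable .id .id h0 h0]
  have key : ∀ f : ℝ → ℝ, MemX f →
      ∫⁻ z, ENNReal.ofReal (height κ f z * deriv f z ^ 2) < ⊤ := by
    intro f hf
    refine lt_of_le_of_lt (b := ENNReal.ofReal (κ * π) * ENNReal.ofReal (energy f)) ?_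
      (ENNReal.mul_lt_top ENNReal.ofReal_lt_top ENNReal.ofReal_lt_top)
    rw [← hf.lintegral_eq, ← lintegral_const_mul' _ _ ENNReal.ofReal_ne_top]
    refine lintegral_mono fun z => ?_
    rw [← ENNReal.ofReal_mul (by positivity)]
    exact ENNReal.ofReal_le_ofReal (by gcongr; exact height_le hκ f z)
  simpa using ⟨key u hu, key v hv⟩

theorem IsParamPlan.symm {u v a b w₁ w₂ : ℝ → ℝ} (h : IsParamPlan u v a b w₁ w₂) :
    IsParamPlan v u b a w₂ w₁ :=
  ⟨h.right, h.left, h.weight₂, h.weight₁, h.balance.mono fun _ hz => hz.symm⟩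

theorem IsParamPlan.paramCost_symm {κ : ℝ} {u v a b w₁ w₂ : ℝ → ℝ}
    (h : IsParamPlan u v a b w₁ w₂) :
    paramCost κ v u b a w₂ w₁ = paramCost κ u v a b w₁ w₂ := by
  refine lintegral_congr_ae ?_
  filter_upwards [h.balance] with z hz
  simp only [costDensity]
  rw [← hz, dX_comm]
  congr 1
  ring

theorem distJ_le_of_forall_param {κ : ℝ} (hκ : 0 < κ) {u v : ℝ → ℝ} (hu : MemX u) (hv : MemX v)
    {c : ℝ≥0∞} (h : ∀ ψ φ₁ φ₂, IsPlan u v ψ φ₁ φ₂ →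
      c ≤ paramCost κ u v (fun x => x) ψ φ₁ (fun x => φ₂ (ψ x))) : c ≤ distJ κ u v :=
  le_distJ fun ψ φ₁ φ₂ hp => (h ψ φ₁ φ₂ hp).trans_eq
    (planCost_eq_paramCost hκ hu.continuous.measurable hv.continuous.measurable hp.reparam
      hp.weight₁ hp.weight₂).symm

theorem distJ_symm_le {κ : ℝ} (hκ : 0 < κ) {u v : ℝ → ℝ} (hu : MemX u) (hv : MemX v) :
    distJ κ v u ≤ distJ κ u v :=
  distJ_le_of_forall_param hκ hu hv fun _ _ _ hp =>
    (distJ_le_paramCost hκ hv hu hp.isParamPlan.symm).trans_eq hp.isParamPlan.paramCost_symm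

theorem distJ_comm {κ : ℝ} (hκ : 0 < κ) {u v : ℝ → ℝ} (hu : MemX u) (hv : MemX v) :
    distJ κ u v = distJ κ v u :=
  le_antisymm (distJ_symm_le hκ hv hu) (distJ_symm_le hκ hu hv)

/-- Three weights combined by a measurable function; having finite range makes products, minima and
quotients of weights weights again. -/
theorem IsWeight.map₃ {w₁ w₂ w₃ : ℝ → ℝ} (h₁ : IsWeight w₁) (h₂ : IsWeight w₂) (h₃ : IsWeight w₃)
    {F : ℝ × ℝ × ℝ → ℝ} (hF : Measurable F)
    (h01 : ∀ r ∈ Icc (0 : ℝ) 1, ∀ s ∈ Icc (0 : ℝ) 1, ∀ t ∈ Icc (0 : ℝ) 1,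
      F (r, s, t) ∈ Icc (0 : ℝ) 1) : IsWeight fun x => F (w₁ x, w₂ x, w₃ x) where
  measurable := hF.comp (h₁.measurable.prodMk (h₂.measurable.prodMk h₃.measurable))
  finite_range := ((h₁.finite_range.prod (h₂.finite_range.prod h₃.finite_range)).image F).subset (by
    rintro _ ⟨x, rfl⟩
    exact ⟨_, ⟨mem_range_self x, mem_range_self x, mem_range_self x⟩, rfl⟩)
  mem_Icc x := h01 _ (h₁.mem_Icc x) _ (h₂.mem_Icc x) _ (h₃.mem_Icc x)

theorem measurable_costDensity (κ : ℝ) {u v a b w₁ w₂ : ℝ → ℝ} (hu : Measurable u)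
    (hv : Measurable v) (ha : Measurable a) (hb : Measurable b) (h₁ : Measurable w₁)
    (h₂ : Measurable w₂) : Measurable (costDensity κ u v a b w₁ w₂) := by
  have hU : Measurable fun z => deriv u (a z) ^ 2 * deriv a z :=
    (((measurable_deriv u).comp ha).pow_const 2).mul (measurable_deriv a)
  have hV : Measurable fun z => deriv v (b z) ^ 2 * deriv b z :=
    (((measurable_deriv v).comp hb).pow_const 2).mul (measurable_deriv b)
  exact (((measurable_dX_pointAt κ hu hv ha hb).mul (h₁.mul hU)).add
    (((measurable_height κ u).comp ha).mul ((h₁.const_sub 1).mul hU))).add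
    (((measurable_height κ v).comp hb).mul ((h₂.const_sub 1).mul hV))

/-- The cost does not depend on the parametrisation. -/
theorem paramCost_comp {κ : ℝ} {u v a b w₁ w₂ c : ℝ → ℝ} (hu : Measurable u)
    (hv : Measurable v) (h : IsParamPlan u v a b w₁ w₂) (hc : Reparam c) :
    paramCost κ u v (fun z => a (c z)) (fun z => b (c z)) (fun z => w₁ (c z)) (fun z => w₂ (c z))
      = paramCost κ u v a b w₁ w₂ := by
  rw [paramCost, paramCost, ← hc.lintegral_ofReal_comp (measurable_costDensity κ hu hv
    h.left.continuous.measurable h.right.continuous.measurable h.weight₁.measurable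
    h.weight₂.measurable)]
  refine lintegral_congr_ae ?_
  filter_upwards [h.left.ae_deriv_comp hc, h.right.ae_deriv_comp hc] with z h1 h2
  congr 1
  simp only [costDensity, h1, h2]
  ring

theorem IsParamPlan.comp {u v a b w₁ w₂ c : ℝ → ℝ} (h : IsParamPlan u v a b w₁ w₂)
    (hc : Reparam c) :
    IsParamPlan u v (fun z => a (c z)) (fun z => b (c z)) (fun z => w₁ (c z))
      (fun z => w₂ (c z)) where
  left := h.left.comp hc
  right := h.right.comp hc
  weight₁ := h.weight₁.comp hc.continuous.measurable
  weight₂ := h.weight₂.comp hc.continuous.measurable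
  balance := by
    filter_upwards [h.left.ae_deriv_comp hc, h.right.ae_deriv_comp hc, hc.ae_comp h.balance]
      with z h1 h2 h3
    rw [h1, h2]
    rcases (hc.deriv_nonneg z).eq_or_lt with hz | hz
    · simp [← hz]
    · have := h3 hz
      linear_combination this * deriv c z

theorem min_div_mem_Icc {r s : ℝ} (hr : 0 ≤ r) (hs : 0 ≤ s) : min r s / r ∈ Icc (0 : ℝ) 1 :=
  ⟨div_nonneg (le_min hr hs) hr, div_le_one_of_le₀ (min_le_left _ _) hr⟩

theorem mul_min_div {r s : ℝ} (hs : 0 ≤ s) : r * (min r s / r) = min r s := by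
  rcases eq_or_ne r 0 with rfl | h
  · simp [hs]
  · field_simp

/-- Two plans with the same parametrisation `b` of the middle function are composed. The fraction
`min (p₂ z) (p₃ z)` of the energy of `v` that both plans transport is moved directly from `u` to
`w`; the rest goes to `∞`. Quotients by `p₂ z = 0` or `p₃ z = 0` have the value `0`, which is the
right one since the minimum vanishes as well. -/
theorem distJ_le_add_of_common {κ : ℝ} (hκ : 0 < κ) {u v w a b c p₁ p₂ p₃ p₄ : ℝ → ℝ}
    (hu : MemX u) (hv : MemX v) (hw : MemX w) (h₁ : IsParamPlan u v a b p₁ p₂)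
    (h₂ : IsParamPlan v w b c p₃ p₄) :
    distJ κ u w ≤ paramCost κ u v a b p₁ p₂ + paramCost κ v w b c p₃ p₄ := by
  have hq₁ : IsWeight fun z => p₁ z * (min (p₂ z) (p₃ z) / p₂ z) :=
    h₁.weight₁.map₃ h₁.weight₂ h₂.weight₁ (F := fun q => q.1 * (min q.2.1 q.2.2 / q.2.1))
      (by fun_prop) fun r hr s hs t ht =>
        ⟨mul_nonneg hr.1 (min_div_mem_Icc hs.1 ht.1).1,
          mul_le_one₀ hr.2 (min_div_mem_Icc hs.1 ht.1).1 (min_div_mem_Icc hs.1 ht.1).2⟩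
  have hq₂ : IsWeight fun z => p₄ z * (min (p₃ z) (p₂ z) / p₃ z) :=
    h₂.weight₂.map₃ h₂.weight₁ h₁.weight₂ (F := fun q => q.1 * (min q.2.1 q.2.2 / q.2.1))
      (by fun_prop) fun r hr s hs t ht =>
        ⟨mul_nonneg hr.1 (min_div_mem_Icc hs.1 ht.1).1,
          mul_le_one₀ hr.2 (min_div_mem_Icc hs.1 ht.1).1 (min_div_mem_Icc hs.1 ht.1).2⟩
  have key₁ : ∀ᵐ z, p₁ z * (min (p₂ z) (p₃ z) / p₂ z) * (deriv u (a z) ^ 2 * deriv a z) =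
      min (p₂ z) (p₃ z) * (deriv v (b z) ^ 2 * deriv b z) := by
    filter_upwards [h₁.balance] with z hz
    have h3 := mul_min_div (r := p₂ z) (h₂.weight₁.mem_Icc z).1
    linear_combination (min (p₂ z) (p₃ z) / p₂ z) * hz + (deriv v (b z) ^ 2 * deriv b z) * h3
  have key₂ : ∀ᵐ z, p₄ z * (min (p₃ z) (p₂ z) / p₃ z) * (deriv w (c z) ^ 2 * deriv c z) =
      min (p₂ z) (p₃ z) * (deriv v (b z) ^ 2 * deriv b z) := by
    filter_upwards [h₂.balance] with z hz
    have h3 := mul_min_div (r := p₃ z) (h₁.weight₂.mem_Icc z).1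
    rw [min_comm (p₂ z)]
    linear_combination -(min (p₃ z) (p₂ z) / p₃ z) * hz + (deriv v (b z) ^ 2 * deriv b z) * h3
  have hp : IsParamPlan u w a c (fun z => p₁ z * (min (p₂ z) (p₃ z) / p₂ z))
      (fun z => p₄ z * (min (p₃ z) (p₂ z) / p₃ z)) :=
    ⟨h₁.left, h₂.right, hq₁, hq₂, by
      filter_upwards [key₁, key₂] with z h1 h2
      rw [h1, h2]⟩
  refine (distJ_le_paramCost hκ hu hw hp).trans ?_
  rw [paramCost, paramCost, paramCost, ← lintegral_add_left (measurable_costDensity κ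
    hu.continuous.measurable hv.continuous.measurable h₁.left.continuous.measurable
    h₁.right.continuous.measurable h₁.weight₁.measurable h₁.weight₂.measurable).ennreal_ofReal]
  refine lintegral_mono_ae ?_
  filter_upwards [key₁, key₂, h₁.balance, h₂.balance] with z k1 k2 b1 b2
  refine (ENNReal.ofReal_le_ofReal ?_).trans ENNReal.ofReal_add_le
  simp only [costDensity]
  set U := deriv u (a z) ^ 2 * deriv a z
  set V := deriv v (b z) ^ 2 * deriv b z with hV
  set W := deriv w (c z) ^ 2 * deriv c z
  set m := min (p₂ z) (p₃ z) with hm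
  have hV0 : 0 ≤ V := mul_nonneg (sq_nonneg _) (h₁.right.deriv_nonneg z)
  have hm2 : m ≤ p₂ z := min_le_left _ _
  have hm3 : m ≤ p₃ z := min_le_right _ _
  have hm0 : 0 ≤ m := le_min (h₁.weight₂.mem_Icc z).1 (h₂.weight₁.mem_Icc z).1
  have hmax : p₂ z + p₃ z - m ≤ 1 := by
    rcases min_cases (p₂ z) (p₃ z) with ⟨h, -⟩ | ⟨h, -⟩ <;> rw [hm, h]
    · linarith [(h₂.weight₁.mem_Icc z).2]
    · linarith [(h₁.weight₂.mem_Icc z).2]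
  have t1 := dX_triangle hκ (pointAt u (a z)) (pointAt v (b z)) (pointAt w (c z))
  have t2 := dX_triangle hκ (pointAt u (a z)) (pointAt v (b z)) none
  have t3 := dX_triangle hκ none (pointAt v (b z)) (pointAt w (c z))
  rw [dX_comm κ none, dX_comm κ none] at t3
  simp only [dX_pointAt_none] at t2 t3
  have hh := (height_pos hκ v (b z)).le
  set D := dX κ (pointAt u (a z)) (pointAt w (c z))
  set D₁ := dX κ (pointAt u (a z)) (pointAt v (b z))
  set D₂ := dX κ (pointAt v (b z)) (pointAt w (c z))
  set hu' := height κ u (a z)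
  set hv' := height κ v (b z)
  set hw' := height κ w (c z)
  have e1 := mul_le_mul_of_nonneg_right t1 (mul_nonneg hm0 hV0)
  have e2 := mul_le_mul_of_nonneg_right t2 (mul_nonneg (sub_nonneg.2 hm2) hV0)
  have e3 := mul_le_mul_of_nonneg_right t3 (mul_nonneg (sub_nonneg.2 hm3) hV0)
  have e4 := mul_nonneg (mul_nonneg hh hV0) (sub_nonneg.2 hmax)
  have f1 : (1 - p₁ z * (m / p₂ z)) * U = U - m * V := by linear_combination -k1
  have f2 : (1 - p₄ z * (min (p₃ z) (p₂ z) / p₃ z)) * W = W - m * V := by linear_combination -k2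
  have f3 : (1 - p₁ z) * U = U - p₂ z * V := by linear_combination -b1
  have f4 : (1 - p₄ z) * W = W - p₃ z * V := by linear_combination b2
  rw [k1, f1, f2, f3, f4, b1]
  linarith

theorem distJ_triangle {κ : ℝ} (hκ : 0 < κ) {u v w : ℝ → ℝ} (hu : MemX u) (hv : MemX v)
    (hw : MemX w) : distJ κ u w ≤ distJ κ u v + distJ κ v w := by
  rw [← tsub_le_iff_right]
  refine distJ_le_of_forall_param hκ hu hv fun ψ₁ φ₁ φ₂ hp₁ => ?_
  rw [tsub_le_iff_left, ← tsub_le_iff_right]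
  refine distJ_le_of_forall_param hκ hv hw fun ψ₂ φ₃ φ₄ hp₂ => ?_
  rw [tsub_le_iff_left, ← paramCost_comp hv.continuous.measurable hw.continuous.measurable
    hp₂.isParamPlan hp₁.reparam]
  exact distJ_le_add_of_common hκ hu hv hw hp₁.isParamPlan (hp₂.isParamPlan.comp hp₁.reparam)

theorem costDensity_nonneg {κ : ℝ} (hκ : 0 < κ) {u v a b w₁ w₂ : ℝ → ℝ}
    (h : IsParamPlan u v a b w₁ w₂) (z : ℝ) : 0 ≤ costDensity κ u v a b w₁ w₂ z := by
  refine add_nonneg (add_nonneg ?_ ?_) ?_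
  · exact mul_nonneg (dX_nonneg hκ _ _) (mul_nonneg (h.weight₁.mem_Icc z).1
      (mul_nonneg (sq_nonneg _) (h.left.deriv_nonneg z)))
  · exact mul_nonneg (height_pos hκ _ _).le (mul_nonneg (by linarith [(h.weight₁.mem_Icc z).2])
      (mul_nonneg (sq_nonneg _) (h.left.deriv_nonneg z)))
  · exact mul_nonneg (height_pos hκ _ _).le (mul_nonneg (by linarith [(h.weight₂.mem_Icc z).2])
      (mul_nonneg (sq_nonneg _) (h.right.deriv_nonneg z)))

/-- Along plans with summable costs the cost density tends to `0` almost everywhere. Where `u' ≠ 0`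
it controls `min (|x - ψₙ x| + |u x - v (ψₙ x)|) (height κ u x)`, and so `ψₙ x → x` and
`v (ψₙ x) → u x`. -/
theorem ae_eq_of_distJ_eq_zero {κ : ℝ} (hκ : 0 < κ) {u v : ℝ → ℝ} (hu : MemX u) (hv : MemX v)
    (h : distJ κ u v = 0) : ∀ᵐ x, deriv u x ≠ 0 → u x = v x := by
  have hex : ∀ n : ℕ, ∃ ψ φ₁ φ₂, IsPlan u v ψ φ₁ φ₂ ∧
      paramCost κ u v (fun x => x) ψ φ₁ (fun x => φ₂ (ψ x)) ≤ (1 / 2 : ℝ≥0∞) ^ n := by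
    intro n
    by_contra hcon
    push Not at hcon
    have hle := distJ_le_of_forall_param hκ hu hv fun ψ φ₁ φ₂ hp => (hcon ψ φ₁ φ₂ hp).le
    rw [h, nonpos_iff_eq_zero] at hle
    exact absurd hle (by simp)
  choose ψ φ₁ φ₂ hp hcost using hex
  set c : ℕ → ℝ → ℝ := fun n => costDensity κ u v (fun x => x) (ψ n) (φ₁ n)
    (fun x => φ₂ n (ψ n x)) with hc
  have hcm : ∀ n, Measurable (c n) := fun n => measurable_costDensity κ hu.continuous.measurable
    hv.continuous.measurable measurable_id (hp n).reparam.continuous.measurable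
    (hp n).weight₁.measurable ((hp n).isParamPlan.weight₂.measurable)
  have hsum : ∫⁻ x, ∑' n, ENNReal.ofReal (c n x) ≠ ⊤ := by
    rw [lintegral_tsum fun n => (hcm n).ennreal_ofReal.aemeasurable]
    refine ne_top_of_le_ne_top ?_ (ENNReal.tsum_le_tsum hcost)
    rw [ENNReal.tsum_geometric]
    simp
  filter_upwards [ae_lt_top (Measurable.tsum fun n => (hcm n).ennreal_ofReal) hsum]
    with x hx hux
  have hlim := ENNReal.tendsto_atTop_zero_of_tsum_ne_top hx.ne
  have hU : 0 < deriv u x ^ 2 := by positivity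
  have hh := height_pos hκ u x
  have hc0 : Tendsto (fun n => c n x / deriv u x ^ 2) atTop (𝓝 0) := by
    have := (ENNReal.tendsto_toReal ENNReal.zero_ne_top).comp hlim
    have h2 := this.div_const (deriv u x ^ 2)
    simp only [Function.comp_def, ENNReal.toReal_zero, zero_div] at h2
    refine h2.congr fun n => ?_
    rw [ENNReal.toReal_ofReal (costDensity_nonneg hκ (hp n).isParamPlan x)]
  have hmin : ∀ n, min (|x - ψ n x| + |u x - v (ψ n x)|) (height κ u x) ≤ c n x / deriv u x ^ 2 := by
    intro n
    rw [le_div_iff₀ hU]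
    have hw := (hp n).weight₁.mem_Icc x
    have hV : 0 ≤ height κ v (ψ n x) * ((1 - φ₂ n (ψ n x)) *
        (deriv v (ψ n x) ^ 2 * deriv (ψ n) x)) :=
      mul_nonneg (height_pos hκ _ _).le (mul_nonneg
        (by linarith [((hp n).weight₂.mem_Icc (ψ n x)).2])
        (mul_nonneg (sq_nonneg _) ((hp n).reparam.deriv_nonneg x)))
    have hd : min (|x - ψ n x| + |u x - v (ψ n x)|) (height κ u x) ≤
        dX κ (pointAt u x) (pointAt v (ψ n x)) := by
      rw [dX_pointAt]
      refine min_le_min ?_ ?_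
      · have : 0 ≤ κ * |arctan (deriv u x) - arctan (deriv v (ψ n x))| := by positivity
        linarith
      · linarith [height_pos hκ v (ψ n x)]
    have h1 := mul_le_mul_of_nonneg_right hd (mul_nonneg hw.1 hU.le)
    have h2 := mul_le_mul_of_nonneg_right
      (min_le_right (|x - ψ n x| + |u x - v (ψ n x)|) (height κ u x))
      (mul_nonneg (sub_nonneg.2 hw.2) hU.le)
    simp only [hc, costDensity, deriv_id'', mul_one]
    linarith
  have hρ : Tendsto (fun n => |x - ψ n x| + |u x - v (ψ n x)|) atTop (𝓝 0) := by
    refine tendsto_of_tendsto_of_tendsto_of_le_of_le' tendsto_const_nhds hc0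
      (Eventually.of_forall fun n => by positivity) ?_
    filter_upwards [hc0.eventually (gt_mem_nhds hh)] with n hn
    rcases min_le_iff.1 (hmin n) with h | h
    · exact h
    · exact absurd h (not_le.2 hn)
  have h1 : Tendsto (fun n => ψ n x) atTop (𝓝 x) := by
    rw [tendsto_iff_dist_tendsto_zero]
    refine squeeze_zero (fun _ => dist_nonneg) (fun n => ?_) hρ
    rw [dist_comm, Real.dist_eq]
    linarith [abs_nonneg (u x - v (ψ n x))]
  have h2 : Tendsto (fun n => v (ψ n x)) atTop (𝓝 (u x)) := by
    rw [tendsto_iff_dist_tendsto_zero]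
    refine squeeze_zero (fun _ => dist_nonneg) (fun n => ?_) hρ
    rw [dist_comm, Real.dist_eq]
    linarith [abs_nonneg (x - ψ n x)]
  exact tendsto_nhds_unique h2 ((hv.continuous.tendsto x).comp h1)

theorem HasDensity.eq_const_of_ae_zero {f k : ℝ → ℝ} (hf : HasDensity f k)
    (h : ∀ᵐ x, k x = 0) : ∃ c, f = fun _ => c := by
  refine ⟨f 0, funext fun x => ?_⟩
  have h1 := hf.integral_eq 0 x
  rw [intervalIntegral.integral_congr_ae (g := fun _ => (0 : ℝ)) (h.mono fun z hz _ => hz)] at h1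
  simp at h1
  linarith

theorem distJ_eq_zero_iff {κ : ℝ} (hκ : 0 < κ) {u v : ℝ → ℝ} (hu : MemX u) (hv : MemX v) :
    distJ κ u v = 0 ↔ u = v ∨ ((∃ a : ℝ, u = fun _ => a) ∧ ∃ b : ℝ, v = fun _ => b) := by
  constructor
  · intro h
    have h1 := ae_eq_of_distJ_eq_zero hκ hu hv h
    have h2 := ae_eq_of_distJ_eq_zero hκ hv hu ((distJ_comm hκ hv hu).trans h)
    have hw : HasDensity (fun x => u x - v x) (fun x => deriv u x - deriv v x) := by
      have := hu.hasDensity.add (hv.hasDensity.const_mul (-1))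
      simpa [sub_eq_add_neg] using this
    -- wherever `u ≠ v`, both derivatives vanish, so `(u - v)²` is constant
    have hsq : HasDensity (fun x => (u x - v x) * (u x - v x))
        (deriv fun x => (u x - v x) * (u x - v x)) :=
      .of_ac fun a b => (hw.ac a b).mul (hw.ac a b)
    obtain ⟨c, hc⟩ := hsq.eq_const_of_ae_zero (by
      filter_upwards [h1, h2, hw.ae_hasDerivAt] with x h1 h2 h3
      refine (h3.mul h3).deriv.trans ?_
      by_cases hx : u x = v x
      · rw [hx]; ring
      · have e1 : deriv u x = 0 := by_contra fun h => hx (h1 h)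
        have e2 : deriv v x = 0 := by_contra fun h => hx (h2 h).symm
        rw [e1, e2]; ring)
    rcases eq_or_ne c 0 with rfl | hc0
    · left
      ext x
      have := congrFun hc x
      exact sub_eq_zero.1 (mul_self_eq_zero.1 this)
    · right
      have hne : ∀ x, u x ≠ v x := fun x hx => hc0 (by
        have := congrFun hc x
        simp only [hx, sub_self, mul_zero] at this
        exact this.symm)
      exact ⟨hu.hasDensity.eq_const_of_ae_zero (h1.mono fun x hx =>
          by_contra fun h => hne x (hx h)),
        hv.hasDensity.eq_const_of_ae_zero (h2.mono fun x hx =>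
          by_contra fun h => hne x (hx h).symm)⟩
  · intro h
    have h0 : IsWeight fun _ => (1 : ℝ) := .const (by simp)
    rw [← nonpos_iff_eq_zero]
    rcases h with rfl | ⟨⟨a, rfl⟩, ⟨b, rfl⟩⟩
    · refine (distJ_le_paramCost hκ hu hv (a := fun x => x) (b := fun x => x)
        ⟨.id, .id, h0, h0, by simp⟩).trans ?_
      simp [paramCost, costDensity, dX_pointAt_self hκ]
    · refine (distJ_le_paramCost hκ hu hv (a := fun x => x) (b := fun x => x)
        ⟨.id, .id, h0, h0, by simp⟩).trans ?_
      simp [paramCost, costDensity]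

/-! ### The surviving energy and the source term -/

theorem measurable_sign : Measurable Real.sign := by
  unfold Real.sign
  exact Measurable.ite measurableSet_Iio measurable_const
    (Measurable.ite measurableSet_Ioi measurable_const measurable_const)

theorem abs_sign_le (x : ℝ) : |Real.sign x| ≤ 1 := by
  rcases Real.sign_apply_eq x with h | h | h <;> simp [h]

/-- The energy density at time `t` on a characteristic with initial slope `p`: it is `p²` as long as
`t p > -2`, and `0` afterwards. -/
noncomputable def live (t p : ℝ) : ℝ := if -2 < t * p then p ^ 2 else 0

theorem live_nonneg (t p : ℝ) : 0 ≤ live t p := by unfold live; split_ifs <;> positivity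

theorem live_le (t p : ℝ) : live t p ≤ p ^ 2 := by
  unfold live; split_ifs
  · exact le_rfl
  · positivity

theorem measurable_live : Measurable fun q : ℝ × ℝ => live q.1 q.2 :=
  Measurable.ite (measurableSet_lt measurable_const (by fun_prop)) (by fun_prop) measurable_const

section
variable {u : ℝ → ℝ}

theorem MemX.integrable_live (hu : MemX u) (t : ℝ) : Integrable fun x => live t (deriv u x) := by
  refine hu.integrable_sq.mono' ?_ (Eventually.of_forall fun x => ?_)
  · exact (measurable_live.comp (measurable_const.prodMk (measurable_deriv u))).aestronglyMeasurable
  · rw [Real.norm_eq_abs, abs_of_nonneg (live_nonneg _ _)]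
    exact live_le _ _

theorem source_eq (u : ℝ → ℝ) (t y : ℝ) :
    source u t y = (1 / 4) * ∫ x, Real.sign (y - x) * live t (deriv u x) := by
  rw [source, ← integral_indicator (measurableSet_lt measurable_const
    ((measurable_deriv u).const_mul t))]
  congr 2
  ext x
  by_cases hx : -2 < t * deriv u x
  · rw [indicator_of_mem (by exact hx), live, if_pos hx]
  · rw [indicator_of_notMem (by exact hx), live, if_neg hx, mul_zero]

theorem MemX.integrable_sign_live (hu : MemX u) (t y : ℝ) :
    Integrable fun x => Real.sign (y - x) * live t (deriv u x) := by
  refine (hu.integrable_live t).mono ?_ (Eventually.of_forall fun x => ?_)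
  · exact ((measurable_sign.comp (measurable_const.sub measurable_id)).mul
      (measurable_live.comp (measurable_const.prodMk (measurable_deriv u)))).aestronglyMeasurable
  · rw [norm_mul]
    exact mul_le_of_le_one_left (norm_nonneg _) (abs_sign_le _)

theorem MemX.abs_source_le (hu : MemX u) (t y : ℝ) : |source u t y| ≤ energy u / 4 := by
  rw [source_eq, abs_mul, abs_of_pos (by norm_num : (0 : ℝ) < 1 / 4)]
  have : |∫ x, Real.sign (y - x) * live t (deriv u x)| ≤ energy u := by
    rw [← Real.norm_eq_abs]
    refine norm_integral_le_of_norm_le hu.integrable_sq (Eventually.of_forall fun x => ?_)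
    rw [norm_mul, Real.norm_eq_abs (live _ _), abs_of_nonneg (live_nonneg _ _)]
    exact (mul_le_of_le_one_left (live_nonneg _ _) (abs_sign_le _)).trans (live_le _ _)
  linarith

theorem measurable_source (u : ℝ → ℝ) (y : ℝ) : Measurable fun s => source u s y := by
  simp only [source_eq]
  have h : StronglyMeasurable (Function.uncurry fun s x : ℝ =>
      Real.sign (y - x) * live s (deriv u x)) :=
    ((measurable_sign.comp (measurable_const.sub measurable_snd)).mul (measurable_live.comp
      (measurable_fst.prodMk ((measurable_deriv u).comp measurable_snd)))).stronglyMeasurable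
  exact (h.integral_prod_right.measurable).const_mul _

theorem MemX.intervalIntegrable_source (hu : MemX u) {q : ℝ → ℝ} (hq : Continuous q) (y a b : ℝ) :
    IntervalIntegrable (fun s => q s * source u s y) volume a b := by
  refine IntervalIntegrable.continuousOn_mul ?_ hq.continuousOn
  refine (intervalIntegrable_const (c := energy u / 4)).mono_fun
    (measurable_source u y).aestronglyMeasurable (Eventually.of_forall fun s => ?_)
  simp only [Real.norm_eq_abs]
  rw [abs_of_nonneg (by linarith [energy_nonneg u] : 0 ≤ energy u / 4)]
  exact hu.abs_source_le s y

/-- The sign functions centred at `y₁` and `y₂` differ by `2` on `(y₁, y₂)` and agree elsewhere, up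
to two points. -/
theorem MemX.source_sub (hu : MemX u) (t : ℝ) {y₁ y₂ : ℝ} (h : y₁ ≤ y₂) :
    source u t y₂ - source u t y₁ = ∫ x in y₁..y₂, (1 / 2) * live t (deriv u x) := by
  rw [source_eq, source_eq, ← mul_sub, ← integral_sub (hu.integrable_sign_live t y₂)
    (hu.integrable_sign_live t y₁), intervalIntegral.integral_of_le h, integral_const_mul,
    ← integral_indicator measurableSet_Ioc]
  have : ∀ᵐ x, Real.sign (y₂ - x) * live t (deriv u x) - Real.sign (y₁ - x) * live t (deriv u x) =
      2 * (Ioc y₁ y₂).indicator (fun x => live t (deriv u x)) x := by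
    filter_upwards [Measure.ae_ne volume y₁, Measure.ae_ne volume y₂] with x h1 h2
    rcases lt_or_gt_of_ne h1 with h1 | h1
    · rw [Real.sign_of_pos (by linarith), Real.sign_of_pos (by linarith),
        indicator_of_notMem (fun hm => absurd hm.1 (by linarith))]
      ring
    · rcases lt_or_gt_of_ne h2 with h2 | h2
      · rw [Real.sign_of_pos (by linarith), Real.sign_of_neg (by linarith),
          indicator_of_mem (show x ∈ Ioc y₁ y₂ from ⟨h1, h2.le⟩)]
        ring
      · rw [Real.sign_of_neg (by linarith), Real.sign_of_neg (by linarith),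
          indicator_of_notMem (fun hm => absurd hm.2 (by linarith))]
        ring
  rw [integral_congr_ae this, integral_const_mul]
  ring

/-- Since `source u s` increases by half of the living energy, `∫₀ᵗ q(s) φ(s, ·) ds` has the density
`∫₀ᵗ q(s) live(s, ū_x)/2 ds`, by Fubini. -/
theorem MemX.hasDensity_integral_source (hu : MemX u) {q : ℝ → ℝ} (hq : Continuous q) (t : ℝ) :
    HasDensity (fun y => ∫ s in (0 : ℝ)..t, q s * source u s y)
      (fun x => ∫ s in (0 : ℝ)..t, q s * ((1 / 2) * live s (deriv u x))) := by
  obtain ⟨C, hC⟩ := (isCompact_uIcc (a := (0 : ℝ)) (b := t)).exists_bound_of_continuousOn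
    hq.continuousOn
  have hmeas : Measurable (Function.uncurry fun x s : ℝ => q s * ((1 / 2) * live s (deriv u x))) :=
    (hq.measurable.comp measurable_snd).mul ((measurable_live.comp (measurable_snd.prodMk
      ((measurable_deriv u).comp measurable_fst))).const_mul _)
  have hint : ∀ y₁ y₂ : ℝ, Integrable (Function.uncurry fun x s : ℝ =>
      q s * ((1 / 2) * live s (deriv u x)))
      ((volume.restrict (uIoc y₁ y₂)).prod (volume.restrict (uIoc 0 t))) := by
    intro y₁ y₂
    have h1 : Integrable (fun x => deriv u x ^ 2) (volume.restrict (uIoc y₁ y₂)) :=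
      hu.integrable_sq.restrict
    have h2 : Integrable (fun _ : ℝ => C) (volume.restrict (uIoc 0 t)) := by
      refine integrable_const_iff.2 (.inr ⟨?_⟩)
      simp [uIoc]
    refine (h1.mul_prod h2).mono' hmeas.aestronglyMeasurable ?_
    have hmem : ∀ᵐ p ∂((volume.restrict (uIoc y₁ y₂)).prod (volume.restrict (uIoc 0 t))),
        p.2 ∈ uIoc 0 t := by
      refine Measure.quasiMeasurePreserving_snd.ae ?_
      exact ae_restrict_mem measurableSet_uIoc
    filter_upwards [hmem] with p hp
    have h3 := hC p.2 (uIoc_subset_uIcc hp)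
    have h4 := live_le p.2 (deriv u p.1)
    have h5 := live_nonneg p.2 (deriv u p.1)
    simp only [Function.uncurry, norm_mul]
    rw [Real.norm_eq_abs (live _ _), abs_of_nonneg h5, Real.norm_eq_abs (1 / 2),
      abs_of_pos (by norm_num), mul_comm]
    refine mul_le_mul (by linarith) h3 (norm_nonneg _) (sq_nonneg _)
  refine .of_le (fun y₁ y₂ h => ?_) fun y₁ y₂ h => ?_
  · have h1 := (hint y₁ y₂).integral_prod_left
    rw [uIoc_of_le h] at h1
    rcases le_total 0 t with ht | ht
    · refine h1.congr (Eventually.of_forall fun x => ?_)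
      simp only [intervalIntegral.integral_of_le ht, uIoc_of_le ht, Function.uncurry]
    · refine h1.neg.congr (Eventually.of_forall fun x => ?_)
      simp only [intervalIntegral.integral_of_ge ht, uIoc_of_ge ht, Function.uncurry, Pi.neg_apply]
  · rw [← intervalIntegral.integral_sub (hu.intervalIntegrable_source hq _ _ _)
      (hu.intervalIntegrable_source hq _ _ _), intervalIntegral_intervalIntegral_swap]
    · refine intervalIntegral.integral_congr fun s _ => ?_
      simp only [intervalIntegral.integral_const_mul]
      rw [← mul_sub, hu.source_sub s h, intervalIntegral.integral_const_mul]
    · rw [IntegrableOn, Measure.volume_eq_prod, ← Measure.prod_restrict]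
      exact hint y₁ y₂

end

/-! ### Characteristics -/

/-- The factor `(1 + t p / 2)₊`; its square is the derivative of the characteristic map at a point
of initial slope `p`. -/
noncomputable def stretch (t p : ℝ) : ℝ := max 0 (1 + t * p / 2)

theorem stretch_pos_iff {t p : ℝ} : 0 < stretch t p ↔ -2 < t * p := by
  rw [stretch, lt_max_iff]
  constructor
  · rintro (h | h)
    · exact absurd h (lt_irrefl _)
    · linarith
  · intro h; right; linarith

theorem stretch_of_alive {t p : ℝ} (h : -2 < t * p) : stretch t p = 1 + t * p / 2 :=
  max_eq_right (by linarith)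

theorem stretch_of_dead {t p : ℝ} (h : ¬ -2 < t * p) : stretch t p = 0 :=
  max_eq_left (by linarith)

theorem alive_of_le {s t p : ℝ} (hs : 0 ≤ s) (hst : s ≤ t) (h : -2 < t * p) : -2 < s * p := by
  rcases le_total 0 p with hp | hp
  · nlinarith [mul_nonneg hs hp]
  · nlinarith

/-- The energy lives up to the time `-2 / p` if `t p ≤ -2`, and up to `t` otherwise. -/
theorem integral_live {q : ℝ → ℝ} (hq : Continuous q) {t : ℝ} (ht : 0 ≤ t) (p : ℝ) :
    ∫ s in (0 : ℝ)..t, q s * ((1 / 2) * live s p) =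
      (p ^ 2 / 2) * ∫ s in (0 : ℝ)..(if -2 < t * p then t else -2 / p), q s := by
  split_ifs with h
  · rw [← intervalIntegral.integral_const_mul]
    refine intervalIntegral.integral_congr fun s hs => ?_
    rw [uIcc_of_le ht] at hs
    simp only [live, if_pos (alive_of_le hs.1 hs.2 h)]
    ring
  · have hp : p < 0 := by
      by_contra hp
      exact h (by linarith [mul_nonneg ht (not_lt.1 hp)])
    have hτ : 0 ≤ -2 / p := by
      rw [← neg_div_neg_eq]; exact div_nonneg (by norm_num) (by linarith)
    have hτt : -2 / p ≤ t := by
      rw [div_le_iff_of_neg hp]; linarith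
    have h1 : ∫ s in (0 : ℝ)..(-2 / p), q s * ((1 / 2) * live s p) =
        ∫ s in (0 : ℝ)..(-2 / p), (p ^ 2 / 2) * q s := by
      refine intervalIntegral.integral_congr_Ioo_of_le hτ fun s hs => ?_
      have h2 : -2 < s * p := by
        have := hs.2
        rw [lt_div_iff_of_neg hp] at this
        exact this
      simp only [live, if_pos h2]
      ring
    have h2 : ∫ s in (-2 / p)..t, q s * ((1 / 2) * live s p) = ∫ s in (-2 / p)..t, (0 : ℝ) := by
      refine intervalIntegral.integral_congr_Ioo_of_le hτt fun s hs => ?_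
      have h2 : ¬ -2 < s * p := by
        have := hs.1
        rw [div_lt_iff_of_neg hp] at this
        linarith
      simp only [live, if_neg h2, mul_zero]
    have hi : ∀ a b, IntervalIntegrable (fun s => q s * ((1 / 2) * live s p)) volume a b := by
      intro a b
      refine IntervalIntegrable.continuousOn_mul ?_ hq.continuousOn
      refine (intervalIntegrable_const (c := p ^ 2)).mono_fun
        ((measurable_live.comp (measurable_id.prodMk measurable_const)).const_mul _).aestronglyMeasurable
        (Eventually.of_forall fun s => ?_)
      have := live_nonneg s p
      have := live_le s p
      simp only [Real.norm_eq_abs]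
      rw [abs_of_nonneg (by positivity), abs_of_nonneg (by positivity)]
      linarith
    rw [← intervalIntegral.integral_add_adjacent_intervals (hi 0 (-2 / p)) (hi (-2 / p) t), h1, h2,
      intervalIntegral.integral_const_mul]
    simp

section
variable {u : ℝ → ℝ} {t : ℝ}

theorem MemX.hasDensity_charValue (hu : MemX u) (ht : 0 ≤ t) :
    HasDensity (charValue u t) (fun x => deriv u x * stretch t (deriv u x)) := by
  have h := hu.hasDensity.add (hu.hasDensity_integral_source (q := fun _ => 1) continuous_const t)
  simp only [one_mul] at h
  have h2 := h.congr_density (l := fun x => deriv u x * stretch t (deriv u x)) (by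
    refine Eventually.of_forall fun x => ?_
    have h3 := integral_live (q := fun _ => 1) continuous_const ht (deriv u x)
    simp only [one_mul] at h3
    simp only [h3]
    split_ifs with hx
    · rw [stretch_of_alive hx]; simp; ring
    · rw [stretch_of_dead hx]
      have hp : deriv u x ≠ 0 := fun h0 => hx (by rw [h0]; norm_num)
      simp; field_simp; ring)
  exact h2

theorem MemX.hasDensity_char (hu : MemX u) (ht : 0 ≤ t) :
    HasDensity (char u t) (fun x => stretch t (deriv u x) ^ 2) := by
  have h := (Reparam.id.hasDensity.add (hu.hasDensity.const_mul t)).add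
    (hu.hasDensity_integral_source (q := fun s => t - s) (by fun_prop) t)
  have h2 := h.congr_density (l := fun x => stretch t (deriv u x) ^ 2) (by
    refine Eventually.of_forall fun x => ?_
    have h3 := integral_live (q := fun s => t - s) (by fun_prop) ht (deriv u x)
    have h4 : ∀ τ : ℝ, ∫ s in (0 : ℝ)..τ, (t - s) = t * τ - τ ^ 2 / 2 := fun τ => by
      rw [intervalIntegral.integral_sub (by simp) (by simp)]
      simp; ring
    simp only [h3, deriv_id'', h4]
    split_ifs with hx
    · rw [stretch_of_alive hx]; ring
    · rw [stretch_of_dead hx]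
      have hp : deriv u x ≠ 0 := fun h0 => hx (by rw [h0]; norm_num)
      field_simp; ring)
  exact h2

theorem MemX.le_supNorm (hu : MemX u) (x : ℝ) : |u x| ≤ supNorm u := by
  obtain ⟨C, hC⟩ := hu.bounded
  exact le_ciSup (f := fun x => |u x|) ⟨C, by rintro _ ⟨y, rfl⟩; exact hC y⟩ x

theorem supNorm_nonneg (u : ℝ → ℝ) : 0 ≤ supNorm u := Real.iSup_nonneg fun _ => abs_nonneg _

theorem MemX.abs_integral_source_le (hu : MemX u) {q : ℝ → ℝ} (hq : Continuous q) (y : ℝ)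
    {a b : ℝ} (hab : a ≤ b) (h0 : ∀ s ∈ Icc a b, 0 ≤ q s) :
    |∫ s in a..b, q s * source u s y| ≤ (∫ s in a..b, q s) * (energy u / 4) := by
  rw [← intervalIntegral.integral_mul_const, ← Real.norm_eq_abs]
  refine intervalIntegral.norm_integral_le_of_norm_le hab (Eventually.of_forall fun s hs => ?_)
    ((hq.mul continuous_const).intervalIntegrable _ _)
  rw [norm_mul, Real.norm_eq_abs, Real.norm_eq_abs, abs_of_nonneg (h0 s (Ioc_subset_Icc_self hs))]
  exact mul_le_mul_of_nonneg_left (hu.abs_source_le s y) (h0 s (Ioc_subset_Icc_self hs))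

theorem MemX.exists_abs_char_sub_le (hu : MemX u) (ht : 0 ≤ t) : ∃ C, ∀ y, |char u t y - y| ≤ C := by
  refine ⟨t * supNorm u + (∫ s in (0 : ℝ)..t, (t - s)) * (energy u / 4), fun y => ?_⟩
  have h1 := hu.abs_integral_source_le (q := fun s => t - s) (by fun_prop) y ht
    (fun s hs => by linarith [hs.2])
  have h2 := mul_le_mul_of_nonneg_left (hu.le_supNorm y) ht
  rw [char, show y + t * u y + (∫ s in (0 : ℝ)..t, (t - s) * source u s y) - y =
    t * u y + ∫ s in (0 : ℝ)..t, (t - s) * source u s y by ring]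
  refine (abs_add_le _ _).trans (add_le_add ?_ h1)
  rwa [abs_mul, abs_of_nonneg ht]

theorem MemX.reparam_char (hu : MemX u) (ht : 0 ≤ t) : Reparam (char u t) := by
  refine .of_hasDensity (hu.hasDensity_char ht) (fun x => sq_nonneg _) ?_
  obtain ⟨C, hC⟩ := hu.exists_abs_char_sub_le ht
  refine (hu.hasDensity_char ht).continuous.surjective ?_ ?_
  · refine tendsto_atTop_mono (f := fun y => y + -C) (fun y => ?_)
      (tendsto_atTop_add_const_right _ _ tendsto_id)
    linarith [(abs_le.1 (hC y)).1]
  · refine tendsto_atBot_mono (f := fun y => y + C) (fun y => ?_)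
      (tendsto_atBot_add_const_right _ _ tendsto_id)
    linarith [(abs_le.1 (hC y)).2]

theorem MemX.ae_deriv_char (hu : MemX u) (ht : 0 ≤ t) :
    ∀ᵐ y, deriv (char u t) y = stretch t (deriv u y) ^ 2 := (hu.hasDensity_char ht).ae_deriv_eq

/-- The solution is well defined: where the characteristic map is constant its density
`stretch²` vanishes, and with it the density of the value. -/
theorem MemX.charValue_eq_of_char_eq (hu : MemX u) (ht : 0 ≤ t) {y z : ℝ}
    (h : char u t y = char u t z) : charValue u t y = charValue u t z := by
  wlog hyz : y ≤ z generalizing y z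
  · exact (this h.symm (le_of_not_ge hyz)).symm
  have hconst : HasDensity (fun _ => char u t y) (fun _ => 0) :=
    ⟨locallyIntegrable_const 0, fun a b => by simp⟩
  have h1 := (hu.hasDensity_char ht).ae_eq_of_eqOn hconst (K := Icc y z) (fun x hx =>
    le_antisymm (((hu.reparam_char ht).mono hx.2).trans h.ge) ((hu.reparam_char ht).mono hx.1))
  have h2 := (hu.hasDensity_charValue ht).integral_eq y z
  rw [intervalIntegral.integral_congr_ae (g := fun _ => (0 : ℝ))] at h2
  · simp at h2; linarith
  · filter_upwards [h1] with x hx hmem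
    rw [uIoc_of_le hyz] at hmem
    have := hx (Ioc_subset_Icc_self hmem)
    rw [pow_eq_zero_iff two_ne_zero] at this
    rw [this, mul_zero]

theorem MemX.sol_char (hu : MemX u) (ht : 0 ≤ t) (y : ℝ) :
    sol u t (char u t y) = charValue u t y :=
  hu.charValue_eq_of_char_eq ht (Function.invFun_eq ⟨y, rfl⟩)

theorem sol_zero (u : ℝ → ℝ) : sol u 0 = u := by
  have h1 : char u 0 = id := by ext y; simp [char]
  have h2 : charValue u 0 = u := by ext y; simp [charValue]
  ext x
  have h3 : char u 0 (Function.invFun (char u 0) x) = x := Function.invFun_eq ⟨x, by simp [h1]⟩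
  rw [sol, h2]
  rw [h1] at h3 ⊢
  rw [id] at h3
  rw [h3]

end

/-! ### The slope and the energy of the solution -/

section
variable {u : ℝ → ℝ} {t : ℝ}

/-- The slope along a living characteristic solves `p' = -p²/2`. A measurable section of the
characteristic map provides the density of `sol u t` as a function of `x`. -/
theorem MemX.exists_hasDensity_sol (hu : MemX u) (ht : 0 ≤ t) :
    ∃ k, Measurable k ∧ HasDensity (sol u t) k ∧
      ∀ᵐ y, -2 < t * deriv u y →
        k (char u t y) = deriv u y / (1 + t * deriv u y / 2) := by
  have hξ := hu.reparam_char ht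
  obtain ⟨σ, hσm, -, hσ⟩ := hξ.exists_section
  have hda := (measurable_deriv u).comp hσm
  have hk : ∀ᵐ y, -2 < t * deriv u y → deriv u (σ (char u t y)) /
      (1 + t * deriv u (σ (char u t y)) / 2) = deriv u y / (1 + t * deriv u y / 2) := by
    filter_upwards [hu.ae_deriv_char ht] with y hy hal
    rw [hσ y (by rw [hy]; exact pow_pos (stretch_pos_iff.2 hal) 2)]
  refine ⟨fun x => deriv u (σ x) / (1 + t * deriv u (σ x) / 2),
    hda.div (((hda.const_mul t).div_const 2).const_add 1), ?_, hk⟩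
  refine hξ.hasDensity_of_comp (hda.div (((hda.const_mul t).div_const 2).const_add 1))
    (l := fun x => deriv u x * stretch t (deriv u x)) ?_ ?_
  · have : (fun y => sol u t (char u t y)) = charValue u t := funext (hu.sol_char ht)
    rw [this]
    exact hu.hasDensity_charValue ht
  · filter_upwards [hk, hu.ae_deriv_char ht] with y h1 h2
    rw [h2]
    by_cases hal : -2 < t * deriv u y
    · rw [h1 hal, stretch_of_alive hal]
      have : 1 + t * deriv u y / 2 ≠ 0 := by linarith
      field_simp
    · rw [stretch_of_dead hal]; simp

theorem MemX.hasDensity_sol (hu : MemX u) (ht : 0 ≤ t) :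
    HasDensity (sol u t) (deriv (sol u t)) := by
  obtain ⟨k, -, h, -⟩ := hu.exists_hasDensity_sol ht
  exact .of_ac h.ac

theorem MemX.ae_deriv_sol (hu : MemX u) (ht : 0 ≤ t) :
    ∀ᵐ y, -2 < t * deriv u y →
      deriv (sol u t) (char u t y) = deriv u y / (1 + t * deriv u y / 2) := by
  obtain ⟨k, -, h, hk⟩ := hu.exists_hasDensity_sol ht
  filter_upwards [hk, (hu.reparam_char ht).ae_comp h.ae_deriv_eq, hu.ae_deriv_char ht]
    with y h1 h2 h3 hal
  rw [h2 (by rw [h3]; exact pow_pos (stretch_pos_iff.2 hal) 2), h1 hal]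

/-- The energy measure of the solution, pulled back to the initial variable. -/
theorem MemX.ae_energy_sol (hu : MemX u) (ht : 0 ≤ t) :
    ∀ᵐ y, deriv (sol u t) (char u t y) ^ 2 * deriv (char u t) y = live t (deriv u y) := by
  filter_upwards [hu.ae_deriv_sol ht, hu.ae_deriv_char ht] with y h1 h2
  rw [h2, live]
  split_ifs with hal
  · rw [h1 hal, stretch_of_alive hal]
    have : 1 + t * deriv u y / 2 ≠ 0 := by linarith
    rw [div_pow, div_mul_cancel₀ _ (pow_ne_zero 2 this)]
  · rw [stretch_of_dead hal]; simp

theorem MemX.abs_charValue_sub_le (hu : MemX u) {s : ℝ} (hst : s ≤ t) (y : ℝ) :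
    |charValue u t y - charValue u s y| ≤ (t - s) * (energy u / 4) := by
  have hi : ∀ a b, IntervalIntegrable (fun s => source u s y) volume a b := fun a b => by
    simpa using hu.intervalIntegrable_source (q := fun _ => 1) continuous_const y a b
  have h := hu.abs_integral_source_le (q := fun _ => 1) continuous_const y hst
    (fun _ _ => zero_le_one)
  simp only [one_mul, intervalIntegral.integral_const, smul_eq_mul, mul_one] at h
  have e : charValue u t y - charValue u s y = ∫ r in s..t, source u r y := by
    rw [charValue, charValue, ← intervalIntegral.integral_add_adjacent_intervals (hi 0 s) (hi s t)]
    ring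
  rwa [e]

theorem MemX.memX_sol (hu : MemX u) (ht : 0 ≤ t) : MemX (sol u t) where
  bounded := by
    refine ⟨supNorm u + t * (energy u / 4), fun x => ?_⟩
    obtain ⟨y, rfl⟩ := (hu.reparam_char ht).surj x
    rw [hu.sol_char ht]
    have h1 := hu.abs_charValue_sub_le ht y
    have h2 : charValue u 0 y = u y := by simp [charValue]
    rw [h2, sub_zero] at h1
    have h3 := hu.le_supNorm y
    have h4 := abs_sub_abs_le_abs_sub (charValue u t y) (u y)
    linarith
  ac := (hu.hasDensity_sol ht).ac
  memLp := by
    have hm : Measurable fun x => deriv (sol u t) x ^ 2 := (measurable_deriv _).pow_const 2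
    rw [memLp_two_iff_integrable_sq (measurable_deriv _).aestronglyMeasurable,
      ← (hu.reparam_char ht).integrable_comp_iff hm.aestronglyMeasurable]
    exact (hu.integrable_live t).congr ((hu.ae_energy_sol ht).mono fun y hy => hy.symm)

theorem MemX.abs_char_sub_le (hu : MemX u) {s : ℝ} (hs : 0 ≤ s) (hst : s ≤ t) (y : ℝ) :
    |char u t y - char u s y| ≤
      (t - s) * (supNorm u + (s + (t - s) / 2) * (energy u / 4)) := by
  have hi : ∀ (q : ℝ → ℝ) (_ : Continuous q) (a b : ℝ),
      IntervalIntegrable (fun s => q s * source u s y) volume a b := fun q hq a b =>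
    hu.intervalIntegrable_source hq y a b
  have e : char u t y - char u s y = (t - s) * u y + (∫ r in (0 : ℝ)..s, (t - s) * source u r y)
      + ∫ r in s..t, (t - r) * source u r y := by
    have e1 := intervalIntegral.integral_add_adjacent_intervals (hi (fun r => t - r) (by fun_prop) 0 s)
      (hi (fun r => t - r) (by fun_prop) s t)
    have e2 := intervalIntegral.integral_sub (hi (fun r => t - r) (by fun_prop) 0 s)
      (hi (fun r => s - r) (by fun_prop) 0 s)
    have e3 : (∫ r in (0 : ℝ)..s, ((t - r) * source u r y - (s - r) * source u r y)) =
        ∫ r in (0 : ℝ)..s, (t - s) * source u r y :=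
      intervalIntegral.integral_congr fun r _ => by ring
    rw [char, char, ← e3, e2, ← e1]
    ring
  have h1 := hu.abs_integral_source_le (q := fun _ => t - s) continuous_const y hs
    (fun _ _ => by linarith)
  have h2 := hu.abs_integral_source_le (q := fun r => t - r) (by fun_prop) y hst
    (fun r hr => by linarith [hr.2])
  have i2 : ∫ r in s..t, (t - r) = (t - s) ^ 2 / 2 := by
    rw [intervalIntegral.integral_sub (by simp) (by simp)]
    simp; ring
  rw [i2] at h2
  simp only [intervalIntegral.integral_const, smul_eq_mul, sub_zero] at h1
  have h3 : |(t - s) * u y| ≤ (t - s) * supNorm u := by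
    rw [abs_mul, abs_of_nonneg (sub_nonneg.2 hst)]
    exact mul_le_mul_of_nonneg_left (hu.le_supNorm y) (sub_nonneg.2 hst)
  rw [e]
  refine (abs_add_three _ _ _).trans ((add_le_add (add_le_add h3 h1) h2).trans_eq ?_)
  ring

end

/-! ### The angle along a characteristic -/

/-- The angle `π/2 + arctan u_x` at time `t` on a characteristic with initial slope `p`; it
decreases to `0` at the death of the characteristic, and is set to `0` afterwards. -/
noncomputable def angle (t p : ℝ) : ℝ :=
  if -2 < t * p then π / 2 + arctan (p / (1 + t * p / 2)) else 0

theorem angle_zero (p : ℝ) : angle 0 p = π / 2 + arctan p := by simp [angle]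

theorem angle_of_alive {t p : ℝ} (h : -2 < t * p) :
    angle t p = π / 2 + arctan (p / (1 + t * p / 2)) := if_pos h

theorem angle_of_dead {t p : ℝ} (h : ¬ -2 < t * p) : angle t p = 0 := if_neg h

theorem angle_nonneg (t p : ℝ) : 0 ≤ angle t p := by
  unfold angle; split_ifs
  · linarith [neg_pi_div_two_lt_arctan (p / (1 + t * p / 2))]
  · exact le_rfl

/-- For a negative slope the angle is a continuous function of time, across the death of the
characteristic. -/
theorem angle_eq_of_neg {p : ℝ} (hp : p < 0) (t : ℝ) : angle t p = arctan (stretch t p / -p) := by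
  by_cases h : -2 < t * p
  · rw [angle_of_alive h, stretch_of_alive h]
    have hm : 0 < 1 + t * p / 2 := by linarith
    have h1 : 0 < -p / (1 + t * p / 2) := div_pos (by linarith) hm
    have h2 := arctan_inv_of_pos h1
    rw [inv_div] at h2
    rw [h2, neg_div, arctan_neg]
    ring
  · rw [angle_of_dead h, stretch_of_dead h]
    simp

theorem hasDerivAt_angle {t p : ℝ} (h : -2 < t * p) :
    HasDerivAt (fun s => angle s p) (-(cos (angle t p) ^ 2 / 2)) t := by
  have hm : (1 + t * p / 2) ≠ 0 := by linarith
  have hopen : ∀ᶠ s in 𝓝 t, -2 < s * p :=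
    (continuous_id.mul continuous_const).continuousAt.eventually (lt_mem_nhds h)
  have h1 : HasDerivAt (fun s => 1 + s * p / 2) (p / 2) t := by
    simpa using (((hasDerivAt_id t).mul_const p).div_const 2).const_add 1
  have h2 := ((h1.inv hm).const_mul p).arctan.const_add (π / 2)
  have h3 : HasDerivAt (fun s => π / 2 + arctan (p / (1 + s * p / 2)))
      (1 / (1 + (p / (1 + t * p / 2)) ^ 2) * (p * (-(p / 2) / (1 + t * p / 2) ^ 2))) t := by
    simpa only [div_eq_mul_inv, Pi.inv_apply] using h2
  refine (h3.congr_of_eventuallyEq (hopen.mono fun s hs => angle_of_alive hs)).congr_deriv ?_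
  rw [angle_of_alive h, add_comm (π / 2), cos_add_pi_div_two, neg_sq, sin_sq, cos_sq_arctan]
  have : (1 + (p / (1 + t * p / 2)) ^ 2) ≠ 0 := by positivity
  have : (1 + t * p / 2) ^ 2 + p ^ 2 ≠ 0 := by positivity
  field_simp
  ring

theorem continuousOn_angle (p : ℝ) : ContinuousOn (fun s => angle s p) (Ici 0) := by
  rcases lt_or_ge p 0 with hp | hp
  · have : (fun s => angle s p) = fun s => arctan (stretch s p / -p) := funext (angle_eq_of_neg hp)
    rw [this]
    refine (continuous_arctan.comp (Continuous.div_const ?_ _)).continuousOn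
    unfold stretch
    fun_prop
  · intro s hs
    have : -2 < s * p := by linarith [mul_nonneg (show (0 : ℝ) ≤ s from hs) hp]
    exact (hasDerivAt_angle this).continuousAt.continuousWithinAt

/-- A characteristic which is dead at time `t` has died at the time `-2 / p`. -/
theorem dead_time {t p : ℝ} (ht : 0 ≤ t) (h : ¬ -2 < t * p) :
    0 ≤ -2 / p ∧ -2 / p ≤ t ∧ ∀ r, -2 < r * p ↔ r < -2 / p := by
  have hp : p < 0 := by
    by_contra hp
    exact h (by linarith [mul_nonneg ht (not_lt.1 hp)])
  refine ⟨?_, ?_, fun r => ?_⟩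
  · rw [← neg_div_neg_eq]; exact div_nonneg (by norm_num) (by linarith)
  · rw [div_le_iff_of_neg hp]; linarith
  · rw [lt_div_iff_of_neg hp]

theorem le_of_hasDerivAt_nonpos {F F' : ℝ → ℝ} {s t : ℝ} (hst : s ≤ t)
    (hF : ContinuousOn F (Icc s t)) (hd : ∀ r ∈ Ioo s t, HasDerivAt F (F' r) r)
    (hneg : ∀ r ∈ Ioo s t, F' r ≤ 0) : F t ≤ F s := by
  have := antitoneOn_of_deriv_nonpos (convex_Icc s t) hF
    (by rw [interior_Icc]; exact fun r hr => (hd r hr).differentiableAt.differentiableWithinAt)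
    (by rw [interior_Icc]; exact fun r hr => by rw [(hd r hr).deriv]; exact hneg r hr)
  exact this (left_mem_Icc.2 hst) (right_mem_Icc.2 hst) hst

theorem continuousOn_angle_Icc {s : ℝ} (hs : 0 ≤ s) (t p : ℝ) :
    ContinuousOn (fun r => angle r p) (Icc s t) :=
  (continuousOn_angle p).mono fun _ hr => hs.trans hr.1

theorem angle_sub_le_of_alive {s t p : ℝ} (hs : 0 ≤ s) (hst : s ≤ t)
    (hal : ∀ r ∈ Ioo s t, -2 < r * p) :
    angle t p ≤ angle s p ∧ angle s p - angle t p ≤ (t - s) / 2 := by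
  have hc := continuousOn_angle_Icc hs t p
  constructor
  · exact le_of_hasDerivAt_nonpos hst hc (fun r hr => hasDerivAt_angle (hal r hr))
      fun r _ => by have := sq_nonneg (cos (angle r p)); linarith
  · have := le_of_hasDerivAt_nonpos (F := fun r => -angle r p - r / 2) hst
      (hc.neg.sub (by fun_prop))
      (fun r hr => (hasDerivAt_angle (hal r hr)).neg.sub ((hasDerivAt_id r).div_const 2))
      fun r _ => by have := cos_sq_le_one (angle r p); linarith
    linarith

theorem angle_sub_mem {s t p : ℝ} (hs : 0 ≤ s) (hst : s ≤ t) :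
    angle t p ≤ angle s p ∧ angle s p - angle t p ≤ (t - s) / 2 := by
  by_cases hal : -2 < t * p
  · exact angle_sub_le_of_alive hs hst fun r hr => alive_of_le (hs.trans hr.1.le) hr.2.le hal
  · obtain ⟨h0, hτt, hτ⟩ := dead_time (hs.trans hst) hal
    rw [angle_of_dead hal]
    rcases le_total (-2 / p) s with h | h
    · rw [angle_of_dead (by rw [hτ]; exact not_lt.2 h)]
      exact ⟨le_rfl, by linarith⟩
    · have h1 := angle_sub_le_of_alive (p := p) hs h fun r hr => (hτ r).2 hr.2
      rw [angle_of_dead (t := -2 / p) (by rw [hτ]; exact lt_irrefl _)] at h1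
      exact ⟨h1.1, by linarith [h1.2]⟩

/-- The indicator function of the survival at time `t` of a characteristic with initial slope `p`.
-/
noncomputable def aliveInd (t p : ℝ) : ℝ := if -2 < t * p then 1 else 0

theorem aliveInd_nonneg (t p : ℝ) : 0 ≤ aliveInd t p := by unfold aliveInd; split_ifs <;> norm_num

theorem aliveInd_le_one (t p : ℝ) : aliveInd t p ≤ 1 := by unfold aliveInd; split_ifs <;> norm_num

theorem live_eq (t p : ℝ) : live t p = aliveInd t p * p ^ 2 := by
  unfold live aliveInd; split_ifs <;> simp

theorem measurable_aliveInd : Measurable fun q : ℝ × ℝ => aliveInd q.1 q.2 :=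
  Measurable.ite (measurableSet_lt measurable_const (by fun_prop)) measurable_const measurable_const

theorem integral_exp_sub (t a b : ℝ) :
    ∫ r in a..b, exp (t - r) / 4 = (exp (t - a) - exp (t - b)) / 4 := by
  have hd : ∀ r ∈ uIcc a b, HasDerivAt (fun r => -(exp (t - r) / 4)) (exp (t - r) / 4) r := by
    intro r _
    have := (((hasDerivAt_id r).const_sub t).exp.div_const 4).neg
    refine this.congr_deriv ?_
    simp only [id]; ring
  rw [intervalIntegral.integral_eq_sub_of_hasDerivAt hd
    ((by fun_prop : Continuous fun r => exp (t - r) / 4).intervalIntegrable _ _)]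
  ring

theorem intervalIntegrable_exp_aliveInd (t p a b : ℝ) :
    IntervalIntegrable (fun r => exp (t - r) / 4 * aliveInd r p) volume a b := by
  refine IntervalIntegrable.continuousOn_mul ?_ (by fun_prop)
  refine (intervalIntegrable_const (c := (1 : ℝ))).mono_fun
    (measurable_aliveInd.comp (measurable_id.prodMk measurable_const)).aestronglyMeasurable
    (Eventually.of_forall fun s => ?_)
  simp only [Real.norm_eq_abs]
  rw [abs_of_nonneg (aliveInd_nonneg _ _), abs_one]
  exact aliveInd_le_one _ _

/-- Grönwall's inequality for `θ' = -cos² θ / 2 ≤ θ - 1/4`. -/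
theorem angle_add_integral_le_of_alive {s t p : ℝ} (hs : 0 ≤ s) (hst : s ≤ t)
    (hal : ∀ r ∈ Ioo s t, -2 < r * p) :
    angle t p + (exp (t - s) - 1) / 4 ≤ exp (t - s) * angle s p := by
  have hc := continuousOn_angle_Icc hs t p
  have h := le_of_hasDerivAt_nonpos (F := fun r => exp (-r) * (angle r p - 1 / 4)) hst
    (ContinuousOn.mul (by fun_prop) (hc.sub continuousOn_const))
    (fun r hr => ((hasDerivAt_id r).neg.exp).mul
      ((hasDerivAt_angle (hal r hr)).sub_const (1 / 4)))
    (fun r hr => by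
      -- either the angle is at least `1/4`, or its cosine is bounded away from `0`
      have h1 : 1 / 4 ≤ angle r p + cos (angle r p) ^ 2 / 2 := by
        rcases le_total (1 / 4) (angle r p) with h | h
        · have := sq_nonneg (cos (angle r p)); linarith
        · have h2 := one_sub_sq_div_two_le_cos (x := angle r p)
          have h3 := angle_nonneg r p
          have h4 : (31 / 32 : ℝ) ≤ cos (angle r p) := by nlinarith
          nlinarith
      have h2 := exp_pos (-r)
      simp only [id, Pi.neg_apply]
      nlinarith)
  have e1 : exp t * exp (-t) = 1 := by rw [← exp_add]; simp
  have e2 : exp t * exp (-s) = exp (t - s) := by rw [← exp_add]; ring_nf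
  have h2 := mul_le_mul_of_nonneg_left h (exp_pos t).le
  rw [← mul_assoc, ← mul_assoc, e1, e2] at h2
  linarith

/-- The angle grows at most like `exp`, with a gain of `1/4` per unit of the time lived. This also
holds with a death in `[s, t]`, after which both sides are only multiplied by the same exponential
factor. -/
theorem angle_add_integral_le {s t p : ℝ} (hs : 0 ≤ s) (hst : s ≤ t) :
    angle t p + ∫ r in s..t, exp (t - r) / 4 * aliveInd r p ≤ exp (t - s) * angle s p := by
  by_cases hal : -2 < t * p
  · have h := angle_add_integral_le_of_alive hs hst fun r hr =>
      alive_of_le (hs.trans hr.1.le) hr.2.le hal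
    rw [intervalIntegral.integral_congr (g := fun r => exp (t - r) / 4), integral_exp_sub, sub_self,
      exp_zero]
    · exact h
    · intro r hr
      rw [uIcc_of_le hst] at hr
      simp only [aliveInd, if_pos (alive_of_le (hs.trans hr.1) hr.2 hal), mul_one]
  · obtain ⟨h0, hτt, hτ⟩ := dead_time (hs.trans hst) hal
    have hz : ∀ a b, -2 / p ≤ a → a ≤ b → ∫ r in a..b, exp (t - r) / 4 * aliveInd r p = 0 := by
      intro a b ha hab
      rw [intervalIntegral.integral_congr (g := fun _ => (0 : ℝ))]
      · simp
      · intro r hr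
        rw [uIcc_of_le hab] at hr
        simp only [aliveInd]
        rw [if_neg (by rw [hτ]; exact not_lt.2 (ha.trans hr.1)), mul_zero]
    rw [angle_of_dead hal, zero_add]
    rcases le_total (-2 / p) s with h | h
    · rw [hz s t h hst]
      exact mul_nonneg (exp_pos _).le (angle_nonneg _ _)
    · have h1 := angle_add_integral_le_of_alive (p := p) hs h fun r hr => (hτ r).2 hr.2
      rw [angle_of_dead (t := -2 / p) (by rw [hτ]; exact lt_irrefl _)] at h1
      rw [← intervalIntegral.integral_add_adjacent_intervals
        (intervalIntegrable_exp_aliveInd t p s (-2 / p))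
        (intervalIntegrable_exp_aliveInd t p (-2 / p) t), hz _ _ le_rfl hτt, add_zero,
        intervalIntegral.integral_congr_Ioo_of_le (g := fun r => exp (t - r) / 4) h,
        integral_exp_sub]
      · have e : exp (t - s) = exp (t - -2 / p) * exp (-2 / p - s) := by
          rw [← exp_add]; ring_nf
        have h2 := mul_le_mul_of_nonneg_left h1 (exp_pos (t - -2 / p)).le
        rw [e]
        linarith
      · intro r hr
        simp only [aliveInd, if_pos ((hτ r).2 hr.2), mul_one]

theorem alive_mono {t p p' : ℝ} (ht : 0 ≤ t) (h : p' ≤ p) (hal : -2 < t * p') : -2 < t * p :=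
  hal.trans_le (mul_le_mul_of_nonneg_left h ht)

theorem angle_mono {t p p' : ℝ} (ht : 0 ≤ t) (h : p' ≤ p) : angle t p' ≤ angle t p := by
  by_cases hal : -2 < t * p'
  · have hal' := alive_mono ht h hal
    rw [angle_of_alive hal, angle_of_alive hal']
    have : p' / (1 + t * p' / 2) ≤ p / (1 + t * p / 2) := by
      rw [div_le_div_iff₀ (by linarith) (by linarith)]
      linarith
    linarith [arctan_mono this]
  · rw [angle_of_dead hal]; exact angle_nonneg _ _

/-- The difference of two angles grows at most like `exp`, since `cos²` is `2`-Lipschitz, until one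
of the two characteristics dies. -/
theorem angle_sub_le_exp_mul {s p p' : ℝ} (hs : 0 ≤ s) (h : p' ≤ p)
    (hal : ∀ r ∈ Ioo 0 s, -2 < r * p') :
    angle s p - angle s p' ≤ exp s * (angle 0 p - angle 0 p') := by
  have h1 := le_of_hasDerivAt_nonpos (F := fun r => exp (-r) * (angle r p - angle r p')) hs
    (ContinuousOn.mul (by fun_prop)
      ((continuousOn_angle_Icc le_rfl s p).sub (continuousOn_angle_Icc le_rfl s p')))
    (fun r hr => ((hasDerivAt_id r).neg.exp).mul
      ((hasDerivAt_angle (alive_mono hr.1.le h (hal r hr))).sub (hasDerivAt_angle (hal r hr))))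
    (fun r hr => by
      have hm := angle_mono hr.1.le h
      have hcos : cos (angle r p') ^ 2 - cos (angle r p) ^ 2 ≤ 2 * (angle r p - angle r p') := by
        have h2 := abs_cos_sub_cos_le (angle r p') (angle r p)
        rw [abs_sub_comm (angle r p'), abs_of_nonneg (sub_nonneg.2 hm)] at h2
        have h3 : |cos (angle r p') + cos (angle r p)| ≤ 2 := by
          refine (abs_add_le _ _).trans ?_
          linarith [abs_cos_le_one (angle r p'), abs_cos_le_one (angle r p)]
        calc cos (angle r p') ^ 2 - cos (angle r p) ^ 2
            = (cos (angle r p') + cos (angle r p)) * (cos (angle r p') - cos (angle r p)) := by ring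
          _ ≤ |cos (angle r p') + cos (angle r p)| * |cos (angle r p') - cos (angle r p)| := by
            rw [← abs_mul]; exact le_abs_self _
          _ ≤ 2 * (angle r p - angle r p') := mul_le_mul h3 h2 (abs_nonneg _) (by norm_num)
      have h2 := exp_pos (-r)
      simp only [id, Pi.neg_apply]
      nlinarith)
  simp only [neg_zero, exp_zero, one_mul] at h1
  have h2 := mul_le_mul_of_nonneg_left h1 (exp_pos s).le
  rwa [← mul_assoc, ← exp_add, add_neg_cancel, exp_zero, one_mul] at h2

theorem abs_angle_sub_le {t p p' : ℝ} (ht : 0 ≤ t) (h : -2 < t * p) (h' : -2 < t * p') :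
    |angle t p - angle t p'| ≤ exp t * |angle 0 p - angle 0 p'| := by
  wlog hle : p' ≤ p generalizing p p'
  · rw [abs_sub_comm, abs_sub_comm (angle 0 p)]
    exact this h' h (le_of_not_ge hle)
  rw [abs_of_nonneg (sub_nonneg.2 (angle_mono ht hle)),
    abs_of_nonneg (sub_nonneg.2 (angle_mono le_rfl hle))]
  exact angle_sub_le_exp_mul ht hle fun r hr => alive_of_le hr.1.le hr.2.le h'

theorem intervalIntegrable_exp_abs_aliveInd_sub (t p p' a b : ℝ) :
    IntervalIntegrable (fun r => exp (t - r) / 4 * |aliveInd r p - aliveInd r p'|) volume a b := by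
  have := ((intervalIntegrable_exp_aliveInd t p a b).sub
    (intervalIntegrable_exp_aliveInd t p' a b)).abs
  refine this.congr fun r _ => ?_
  rw [← mul_sub, abs_mul, abs_of_pos (by positivity)]

/-- If one of two paired characteristics is dead at time `t`, the other one is on its own since the
death `τ` of its partner. At that moment the difference of the angles is the angle of the survivor,
and from then on `angle_add_integral_le` applies. -/
theorem angle_add_angle_add_integral_le {t p p' : ℝ} (ht : 0 ≤ t)
    (hd : ¬ (-2 < t * p ∧ -2 < t * p')) :
    angle t p + angle t p' + ∫ r in (0 : ℝ)..t, exp (t - r) / 4 * |aliveInd r p - aliveInd r p'| ≤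
      exp t * |angle 0 p - angle 0 p'| := by
  wlog hle : p' ≤ p generalizing p p'
  · have h := this (p := p') (p' := p) (by tauto) (le_of_not_ge hle)
    simp only [abs_sub_comm (aliveInd _ p'), abs_sub_comm (angle 0 p')] at h
    linarith
  have hdead : ¬ -2 < t * p' := fun h => hd ⟨alive_mono ht hle h, h⟩
  obtain ⟨h0, hτt, hτ⟩ := dead_time ht hdead
  set τ := -2 / p'
  rw [abs_of_nonneg (sub_nonneg.2 (angle_mono le_rfl hle)), angle_of_dead hdead, add_zero]
  have hi := intervalIntegrable_exp_abs_aliveInd_sub t p p'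
  have hI : ∫ r in (0 : ℝ)..t, exp (t - r) / 4 * |aliveInd r p - aliveInd r p'| =
      ∫ r in τ..t, exp (t - r) / 4 * aliveInd r p := by
    rw [← intervalIntegral.integral_add_adjacent_intervals (hi 0 τ) (hi τ t),
      intervalIntegral.integral_congr_Ioo_of_le (g := fun _ => (0 : ℝ)) h0,
      intervalIntegral.integral_congr_Ioo_of_le (g := fun r => exp (t - r) / 4 * aliveInd r p) hτt]
    · simp
    · intro r hr
      have h1 : ¬ -2 < r * p' := by rw [hτ]; exact not_lt.2 hr.1.le
      simp only [aliveInd, if_neg h1, sub_zero]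
      split_ifs <;> simp
    · intro r hr
      have h1 : -2 < r * p' := by rw [hτ]; exact hr.2
      have h2 : -2 < r * p := alive_mono hr.1.le hle h1
      simp only [aliveInd, if_pos h1, if_pos h2, sub_self, abs_zero, mul_zero]
  rw [hI]
  refine (angle_add_integral_le h0 hτt).trans ?_
  have h1 := angle_sub_le_exp_mul h0 hle fun r hr => (hτ r).2 hr.2
  rw [angle_of_dead (p := p') (t := τ) (by rw [hτ]; exact lt_irrefl _), sub_zero] at h1
  have h2 := mul_le_mul_of_nonneg_left h1 (exp_pos (t - τ)).le
  rwa [← mul_assoc, ← exp_add, sub_add_cancel] at h2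

/-! ### Time regularity -/

theorem isWeight_aliveInd (t : ℝ) {f : ℝ → ℝ} (hf : Measurable f) :
    IsWeight fun x => aliveInd t (f x) where
  measurable := measurable_aliveInd.comp (measurable_const.prodMk hf)
  finite_range := (Set.toFinite {(0 : ℝ), 1}).subset (by
    rintro _ ⟨x, rfl⟩
    simp only [aliveInd]
    split_ifs <;> simp)
  mem_Icc x := ⟨aliveInd_nonneg _ _, aliveInd_le_one _ _⟩

section
variable {u : ℝ → ℝ} {s t κ : ℝ}

theorem MemX.ae_height_sol (hu : MemX u) (ht : 0 ≤ t) (κ : ℝ) :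
    ∀ᵐ y, -2 < t * deriv u y → height κ (sol u t) (char u t y) = κ * angle t (deriv u y) := by
  filter_upwards [hu.ae_deriv_sol ht] with y hy hal
  rw [height, hy hal, angle_of_alive hal]

/-- The plan sends `ξ(s, y)` to `ξ(t, y)` with the energy which is alive at time `t`. The angle of
the energy that dies in between is at most `(t - s) / 2`. -/
theorem MemX.distJ_sol_sol_le (hu : MemX u) (hκ : 0 < κ) (hs : 0 ≤ s) (hst : s ≤ t) :
    distJ κ (sol u s) (sol u t) ≤ ENNReal.ofReal
      ((t - s) * (κ / 2 + supNorm u + energy u / 4 + (s + (t - s) / 2) * (energy u / 4))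
        * energy u) := by
  have ht := hs.trans hst
  have hw := isWeight_aliveInd t (measurable_deriv u)
  have hp : IsParamPlan (sol u s) (sol u t) (char u s) (char u t)
      (fun y => aliveInd t (deriv u y)) (fun y => aliveInd t (deriv u y)) := by
    refine ⟨hu.reparam_char hs, hu.reparam_char ht, hw, hw, ?_⟩
    filter_upwards [hu.ae_energy_sol hs, hu.ae_energy_sol ht] with y h1 h2
    rw [h1, h2, live, live, aliveInd]
    split_ifs with h3 h4 h4
    · rfl
    · exact absurd (alive_of_le hs hst h3) h4
    · simp
    · simp
  set B := (t - s) * (κ / 2 + supNorm u + energy u / 4 + (s + (t - s) / 2) * (energy u / 4)) with hB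
  have hE := energy_nonneg u
  have hS := supNorm_nonneg u
  have hts : 0 ≤ t - s := sub_nonneg.2 hst
  have hBκ : κ * ((t - s) / 2) ≤ B := by
    have : 0 ≤ (t - s) * (supNorm u + energy u / 4 + (s + (t - s) / 2) * (energy u / 4)) := by
      positivity
    rw [hB]; linarith
  refine (distJ_le_paramCost hκ (hu.memX_sol hs) (hu.memX_sol ht) hp).trans ?_
  have hB0 : 0 ≤ B := le_trans (by positivity) hBκ
  rw [ENNReal.ofReal_mul hB0, ← hu.lintegral_eq, ← lintegral_const_mul' _ _ ENNReal.ofReal_ne_top,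
    paramCost]
  refine lintegral_mono_ae ?_
  filter_upwards [hu.ae_energy_sol hs, hu.ae_energy_sol ht, hu.ae_height_sol hs κ,
    hu.ae_height_sol ht κ, hu.ae_deriv_sol hs, hu.ae_deriv_sol ht] with y h1 h2 h3 h4 h5 h6
  rw [← ENNReal.ofReal_mul hB0]
  refine ENNReal.ofReal_le_ofReal ?_
  rw [costDensity, h1, h2]
  have hang := angle_sub_mem (p := deriv u y) hs hst
  by_cases hal : -2 < t * deriv u y
  · have hals := alive_of_le hs hst hal
    simp only [aliveInd, live, if_pos hal, if_pos hals, sub_self, zero_mul, mul_zero, add_zero,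
      one_mul]
    refine mul_le_mul_of_nonneg_right ?_ (sq_nonneg _)
    rw [dX_pointAt]
    refine (min_le_left _ _).trans ?_
    rw [hu.sol_char hs, hu.sol_char ht, h5 hals, h6 hal]
    have e1 := hu.abs_char_sub_le hs hst y
    have e2 := hu.abs_charValue_sub_le hst y
    rw [abs_sub_comm] at e1 e2
    have e3 : |arctan (deriv u y / (1 + s * deriv u y / 2)) -
        arctan (deriv u y / (1 + t * deriv u y / 2))| ≤ (t - s) / 2 := by
      rw [angle_of_alive hal, angle_of_alive hals] at hang
      rw [abs_of_nonneg (by linarith)]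
      linarith
    have e4 := mul_le_mul_of_nonneg_left e3 hκ.le
    rw [hB]
    linarith
  · simp only [aliveInd, live, if_neg hal, zero_mul, mul_zero, add_zero, zero_add, sub_zero, one_mul]
    split_ifs with hals
    · refine mul_le_mul_of_nonneg_right ?_ (sq_nonneg _)
      rw [h3 hals]
      rw [angle_of_dead hal] at hang
      refine le_trans (mul_le_mul_of_nonneg_left ?_ hκ.le) hBκ
      linarith [hang.2]
    · rw [mul_zero]; positivity

end

theorem distJ_sol_le {κ : ℝ} (hκ : 0 < κ) {c : ℝ}
    (hc : ∀ y : ℝ, y ≤ -1 → π / 2 + arctan y ≤ c / |y|) {u : ℝ → ℝ} (hu : MemX u) {t : ℝ}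
    (ht : 0 ≤ t) :
    distJ κ u (sol u t) ≤ ENNReal.ofReal ((π * t / 4 + (c + κ) / 2 + supNorm u
      + (t + 2) / 8 * energy u) * t * energy u) := by
  have h := hu.distJ_sol_sol_le hκ le_rfl ht
  rw [sol_zero] at h
  refine h.trans (ENNReal.ofReal_le_ofReal ?_)
  have hc0 : 0 ≤ c := by
    have h1 := hc (-1) le_rfl
    rw [abs_neg, abs_one, div_one] at h1
    linarith [neg_pi_div_two_lt_arctan (-1)]
  have hE := energy_nonneg u
  -- the bound of `MemX.distJ_sol_sol_le` is smaller by this term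
  have h2 : 0 ≤ (π * t / 4 + c / 2) * t * energy u := by positivity
  nlinarith

theorem normX_le_iff {u : ℝ → ℝ} {R : ℝ} (h : normX u ≤ R) :
    0 ≤ R ∧ supNorm u ≤ R ∧ energy u ≤ R ^ 2 := by
  have h1 := supNorm_nonneg u
  have h2 := sqrt_nonneg (energy u)
  have h3 := sq_sqrt (energy_nonneg u)
  unfold normX at h
  refine ⟨by linarith, by linarith, ?_⟩
  rw [← h3]
  exact pow_le_pow_left₀ h2 (by linarith) 2

theorem exists_lipschitz_bound {κ : ℝ} (hκ : 0 < κ) (R T : ℝ) : ∃ L : ℝ, 0 ≤ L ∧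
    ∀ u : ℝ → ℝ, MemX u → normX u ≤ R → ∀ s ∈ Icc (0 : ℝ) T, ∀ t ∈ Icc (0 : ℝ) T,
      distJ κ (sol u s) (sol u t) ≤ ENNReal.ofReal (L * |t - s|) := by
  refine ⟨(κ / 2 + |R| + R ^ 2 / 4 + |T| * (R ^ 2 / 4)) * R ^ 2, by positivity, ?_⟩
  intro u hu hR s hs t ht
  obtain ⟨hR0, hS, hE⟩ := normX_le_iff hR
  have hE0 := energy_nonneg u
  have hS0 := supNorm_nonneg u
  wlog hst : s ≤ t generalizing s t
  · rw [distJ_comm hκ (hu.memX_sol hs.1) (hu.memX_sol ht.1), abs_sub_comm]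
    exact this t ht s hs (le_of_not_ge hst)
  refine (hu.distJ_sol_sol_le hκ hs.1 hst).trans (ENNReal.ofReal_le_ofReal ?_)
  rw [abs_of_nonneg (sub_nonneg.2 hst), abs_of_nonneg hR0, abs_of_nonneg (hs.1.trans hs.2)]
  have hts : 0 ≤ t - s := sub_nonneg.2 hst
  have h0 := hs.1
  have hT := hs.1.trans hs.2
  calc (t - s) * (κ / 2 + supNorm u + energy u / 4 + (s + (t - s) / 2) * (energy u / 4)) * energy u
      ≤ (t - s) * (κ / 2 + R + R ^ 2 / 4 + T * (R ^ 2 / 4)) * R ^ 2 := by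
        gcongr
        linarith [ht.2]
    _ = (κ / 2 + R + R ^ 2 / 4 + T * (R ^ 2 / 4)) * R ^ 2 * (t - s) := by ring

/-- The quadrilateral inequality. -/
theorem abs_toReal_sub_le {κ : ℝ} (hκ : 0 < κ) {u v u' v' : ℝ → ℝ} (hu : MemX u) (hv : MemX v)
    (hu' : MemX u') (hv' : MemX v') {r : ℝ} (hr : 0 ≤ r)
    (h : distJ κ u u' ≤ ENNReal.ofReal r) (h' : distJ κ v v' ≤ ENNReal.ofReal r) :
    |(distJ κ u' v').toReal - (distJ κ u v).toReal| ≤ 2 * r := by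
  have key : ∀ {u v u' v' : ℝ → ℝ}, MemX u → MemX v → MemX u' → MemX v' →
      distJ κ u' u ≤ ENNReal.ofReal r → distJ κ v v' ≤ ENNReal.ofReal r →
      (distJ κ u' v').toReal ≤ (distJ κ u v).toReal + 2 * r := by
    intro u v u' v' hu hv hu' hv' h h'
    have hle : distJ κ u' v' ≤ ENNReal.ofReal r + (distJ κ u v + ENNReal.ofReal r) :=
      (distJ_triangle hκ hu' hu hv').trans (add_le_add h
        ((distJ_triangle hκ hu hv hv').trans (add_le_add le_rfl h')))
    have hfin := (distJ_lt_top hκ hu hv).ne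
    have := ENNReal.toReal_mono (by simp [hfin]) hle
    rw [ENNReal.toReal_add ENNReal.ofReal_ne_top (by simp [hfin]),
      ENNReal.toReal_add hfin ENNReal.ofReal_ne_top, ENNReal.toReal_ofReal hr] at this
    linarith
  rw [abs_sub_le_iff]
  constructor
  · linarith [key hu hv hu' hv' ((distJ_comm hκ hu' hu).trans_le h) h']
  · linarith [key hu' hv' hu hv h ((distJ_comm hκ hv' hv).trans_le h')]

/-! ### The cost as an integral of real functions -/

theorem integrable_costDensity {κ : ℝ} (hκ : 0 < κ) {u v a b w₁ w₂ : ℝ → ℝ} (hu : MemX u)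
    (hv : MemX v) (h : IsParamPlan u v a b w₁ w₂) :
    Integrable (costDensity κ u v a b w₁ w₂) := by
  have hU : Integrable fun z => deriv u (a z) ^ 2 * deriv a z :=
    (h.left.integrable_comp_iff ((measurable_deriv u).pow_const 2).aestronglyMeasurable).2
      hu.integrable_sq
  have hV : Integrable fun z => deriv v (b z) ^ 2 * deriv b z :=
    (h.right.integrable_comp_iff ((measurable_deriv v).pow_const 2).aestronglyMeasurable).2
      hv.integrable_sq
  refine ((hU.const_mul (3 * (κ * π))).add (hV.const_mul (κ * π))).mono'
    (measurable_costDensity κ hu.continuous.measurable hv.continuous.measurable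
      h.left.continuous.measurable h.right.continuous.measurable h.weight₁.measurable
      h.weight₂.measurable).aestronglyMeasurable (Eventually.of_forall fun z => ?_)
  rw [Real.norm_eq_abs, abs_of_nonneg (costDensity_nonneg hκ h z)]
  have hU0 : 0 ≤ deriv u (a z) ^ 2 * deriv a z := mul_nonneg (sq_nonneg _) (h.left.deriv_nonneg z)
  have hV0 : 0 ≤ deriv v (b z) ^ 2 * deriv b z := mul_nonneg (sq_nonneg _) (h.right.deriv_nonneg z)
  have h1 := height_le hκ u (a z)
  have h2 := height_le hκ v (b z)
  have hd : dX κ (pointAt u (a z)) (pointAt v (b z)) ≤ 2 * (κ * π) := by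
    rw [dX_pointAt]
    exact (min_le_right _ _).trans (by linarith)
  obtain ⟨w10, w11⟩ := h.weight₁.mem_Icc z
  obtain ⟨w20, w21⟩ := h.weight₂.mem_Icc z
  have hκπ : 0 ≤ κ * π := by positivity
  have e1 := mul_le_mul hd (mul_le_of_le_one_left hU0 w11) (mul_nonneg w10 hU0) (by positivity)
  have e2 := mul_le_mul h1 (mul_le_of_le_one_left hU0 (by linarith : 1 - w₁ z ≤ 1))
    (mul_nonneg (by linarith) hU0) hκπ
  have e3 := mul_le_mul h2 (mul_le_of_le_one_left hV0 (by linarith : 1 - w₂ z ≤ 1))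
    (mul_nonneg (by linarith) hV0) hκπ
  simp only [costDensity, Pi.add_apply]
  linarith

theorem paramCost_eq_ofReal {κ : ℝ} (hκ : 0 < κ) {u v a b w₁ w₂ : ℝ → ℝ} (hu : MemX u)
    (hv : MemX v) (h : IsParamPlan u v a b w₁ w₂) :
    paramCost κ u v a b w₁ w₂ = ENNReal.ofReal (∫ z, costDensity κ u v a b w₁ w₂ z) :=
  (ofReal_integral_eq_lintegral_ofReal (integrable_costDensity hκ hu hv h)
    (Eventually.of_forall (costDensity_nonneg hκ h))).symm

/-! ### Growth of the distance between two solutions -/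

/-- The density, at the parameter `x` and time `r`, of the energy which is alive and has no living
partner under the plan `(ψ, φ₁, φ₂)`: untransported energy of `u`, untransported energy of `v`, and
transported energy for which exactly one of the two characteristics is alive. -/
noncomputable def orphan (u v ψ φ₁ φ₂ : ℝ → ℝ) (r x : ℝ) : ℝ :=
  aliveInd r (deriv u x) * ((1 - φ₁ x) * deriv u x ^ 2)
  + aliveInd r (deriv v (ψ x)) * ((1 - φ₂ (ψ x)) * (deriv v (ψ x) ^ 2 * deriv ψ x))
  + |aliveInd r (deriv u x) - aliveInd r (deriv v (ψ x))| * (φ₁ x * deriv u x ^ 2)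

section
variable {u v ψ φ₁ φ₂ : ℝ → ℝ}

theorem IsPlan.orphan_nonneg (hp : IsPlan u v ψ φ₁ φ₂) (r x : ℝ) : 0 ≤ orphan u v ψ φ₁ φ₂ r x := by
  have h1 := hp.weight₁.mem_Icc x
  have h2 := hp.weight₂.mem_Icc (ψ x)
  refine add_nonneg (add_nonneg ?_ ?_) ?_
  · exact mul_nonneg (aliveInd_nonneg _ _) (mul_nonneg (by linarith [h1.2]) (sq_nonneg _))
  · exact mul_nonneg (aliveInd_nonneg _ _) (mul_nonneg (by linarith [h2.2])
      (mul_nonneg (sq_nonneg _) (hp.reparam.deriv_nonneg x)))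
  · exact mul_nonneg (abs_nonneg _) (mul_nonneg h1.1 (sq_nonneg _))

theorem IsPlan.orphan_le (hp : IsPlan u v ψ φ₁ φ₂) (r x : ℝ) :
    orphan u v ψ φ₁ φ₂ r x ≤ deriv u x ^ 2 + deriv v (ψ x) ^ 2 * deriv ψ x := by
  have h1 := hp.weight₁.mem_Icc x
  have h2 := hp.weight₂.mem_Icc (ψ x)
  have hU := sq_nonneg (deriv u x)
  have hV := mul_nonneg (sq_nonneg (deriv v (ψ x))) (hp.reparam.deriv_nonneg x)
  have e1 := mul_le_of_le_one_left (mul_nonneg (by linarith [h1.2] : 0 ≤ 1 - φ₁ x) hU)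
    (aliveInd_le_one r (deriv u x))
  have e2 := mul_le_of_le_one_left (mul_nonneg (by linarith [h2.2] : 0 ≤ 1 - φ₂ (ψ x)) hV)
    (aliveInd_le_one r (deriv v (ψ x)))
  have e3 : |aliveInd r (deriv u x) - aliveInd r (deriv v (ψ x))| ≤ 1 := by
    unfold aliveInd; split_ifs <;> simp
  have e4 := mul_le_of_le_one_left (mul_nonneg h1.1 hU) e3
  have e5 := mul_nonneg h2.1 hV
  unfold orphan
  linarith

theorem IsPlan.measurable_orphan (hp : IsPlan u v ψ φ₁ φ₂) :
    Measurable (Function.uncurry (orphan u v ψ φ₁ φ₂)) := by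
  have mψ := hp.reparam.continuous.measurable
  have m1 : Measurable fun q : ℝ × ℝ => deriv u q.2 := (measurable_deriv u).comp measurable_snd
  have m2 : Measurable fun q : ℝ × ℝ => deriv v (ψ q.2) :=
    (measurable_deriv v).comp (mψ.comp measurable_snd)
  have m3 : Measurable fun q : ℝ × ℝ => φ₁ q.2 := hp.weight₁.measurable.comp measurable_snd
  have m4 : Measurable fun q : ℝ × ℝ => φ₂ (ψ q.2) :=
    hp.weight₂.measurable.comp (mψ.comp measurable_snd)
  have m5 : Measurable fun q : ℝ × ℝ => deriv ψ q.2 := (measurable_deriv ψ).comp measurable_snd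
  have a1 : Measurable fun q : ℝ × ℝ => aliveInd q.1 (deriv u q.2) :=
    measurable_aliveInd.comp (measurable_fst.prodMk m1)
  have a2 : Measurable fun q : ℝ × ℝ => aliveInd q.1 (deriv v (ψ q.2)) :=
    measurable_aliveInd.comp (measurable_fst.prodMk m2)
  exact ((a1.mul ((m3.const_sub 1).mul (m1.pow_const 2))).add
    (a2.mul ((m4.const_sub 1).mul ((m2.pow_const 2).mul m5)))).add
    ((a1.sub a2).abs.mul (m3.mul (m1.pow_const 2)))

theorem IsPlan.integrable_energy_right (hp : IsPlan u v ψ φ₁ φ₂) (hv : MemX v) :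
    Integrable fun x => deriv v (ψ x) ^ 2 * deriv ψ x :=
  (hp.reparam.integrable_comp_iff ((measurable_deriv v).pow_const 2).aestronglyMeasurable).2
    hv.integrable_sq

theorem IsPlan.integrable_orphan (hp : IsPlan u v ψ φ₁ φ₂) (hu : MemX u) (hv : MemX v) (r : ℝ) :
    Integrable (orphan u v ψ φ₁ φ₂ r) := by
  refine (hu.integrable_sq.add (hp.integrable_energy_right hv)).mono'
    (hp.measurable_orphan.comp (measurable_const.prodMk measurable_id)).aestronglyMeasurable
    (Eventually.of_forall fun x => ?_)
  rw [Real.norm_eq_abs, abs_of_nonneg (hp.orphan_nonneg r x)]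
  exact hp.orphan_le r x

theorem IsPlan.ae_abs_live_sub_le (hp : IsPlan u v ψ φ₁ φ₂) (r : ℝ) :
    ∀ᵐ x, |live r (deriv u x) - live r (deriv v (ψ x)) * deriv ψ x| ≤ orphan u v ψ φ₁ φ₂ r x := by
  filter_upwards [hp.balance] with x hx
  have h1 := hp.weight₁.mem_Icc x
  have h2 := hp.weight₂.mem_Icc (ψ x)
  have q1 := mul_nonneg (aliveInd_nonneg r (deriv u x))
    (mul_nonneg (by linarith [h1.2] : 0 ≤ 1 - φ₁ x) (sq_nonneg (deriv u x)))
  have q2 := mul_nonneg (aliveInd_nonneg r (deriv v (ψ x)))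
    (mul_nonneg (by linarith [h2.2] : 0 ≤ 1 - φ₂ (ψ x))
      (mul_nonneg (sq_nonneg (deriv v (ψ x))) (hp.reparam.deriv_nonneg x)))
  have q3 := mul_nonneg h1.1 (sq_nonneg (deriv u x))
  have e : live r (deriv u x) - live r (deriv v (ψ x)) * deriv ψ x =
      aliveInd r (deriv u x) * ((1 - φ₁ x) * deriv u x ^ 2)
      - aliveInd r (deriv v (ψ x)) * ((1 - φ₂ (ψ x)) * (deriv v (ψ x) ^ 2 * deriv ψ x))
      + (aliveInd r (deriv u x) - aliveInd r (deriv v (ψ x))) * (φ₁ x * deriv u x ^ 2) := by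
    rw [live_eq, live_eq]
    linear_combination aliveInd r (deriv v (ψ x)) * hx
  rw [e, orphan]
  refine (abs_add_le _ _).trans (add_le_add ?_ ?_)
  · rw [abs_le]; constructor <;> linarith
  · rw [abs_mul, abs_of_nonneg q3]

/-- The energy of `v` is written in the variable of `u`; the contributions of living pairs to the
two source terms then cancel, because `ψ` preserves the order. -/
theorem IsPlan.abs_source_sub_le (hp : IsPlan u v ψ φ₁ φ₂) (hu : MemX u) (hv : MemX v) (r y : ℝ) :
    |source u r y - source v r (ψ y)| ≤ (∫ x, orphan u v ψ φ₁ φ₂ r x) / 4 := by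
  have hψ := hp.reparam
  have hi := hv.integrable_sign_live r (ψ y)
  have e1 : ∫ x, Real.sign (ψ y - x) * live r (deriv v x) =
      ∫ x, Real.sign (y - x) * (live r (deriv v (ψ x)) * deriv ψ x) := by
    rw [← hψ.integral_comp hi.aestronglyMeasurable]
    refine integral_congr_ae (Eventually.of_forall fun x => ?_)
    simp only
    -- `ψ` is injective at the points where its derivative is positive
    rcases (hψ.deriv_nonneg x).eq_or_lt with hx | hx
    · simp [← hx]
    · have hs : Real.sign (ψ y - ψ x) = Real.sign (y - x) := by
        rcases lt_trichotomy y x with h | h | h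
        · have := hψ.lt_of_lt_of_deriv_pos h (.inr hx)
          rw [Real.sign_of_neg (by linarith), Real.sign_of_neg (by linarith)]
        · rw [h, sub_self, sub_self]
        · have := hψ.lt_of_lt_of_deriv_pos h (.inl hx)
          rw [Real.sign_of_pos (by linarith), Real.sign_of_pos (by linarith)]
      rw [hs, mul_assoc]
  have hi2 : Integrable fun x => live r (deriv v (ψ x)) * deriv ψ x :=
    (hψ.integrable_comp_iff (hv.integrable_live r).aestronglyMeasurable).2 (hv.integrable_live r)
  have hi3 : Integrable fun x => Real.sign (y - x) * (live r (deriv v (ψ x)) * deriv ψ x) := by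
    refine hi2.mono ((measurable_sign.comp (measurable_const.sub
      measurable_id)).aestronglyMeasurable.mul hi2.aestronglyMeasurable)
      (Eventually.of_forall fun x => ?_)
    rw [norm_mul]
    exact mul_le_of_le_one_left (norm_nonneg _) (abs_sign_le _)
  rw [source_eq, source_eq, e1, ← mul_sub, ← integral_sub (hu.integrable_sign_live r y) hi3, abs_mul,
    abs_of_pos (by norm_num : (0 : ℝ) < 1 / 4)]
  have : |∫ x, (Real.sign (y - x) * live r (deriv u x) -
      Real.sign (y - x) * (live r (deriv v (ψ x)) * deriv ψ x))| ≤
      ∫ x, orphan u v ψ φ₁ φ₂ r x := by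
    rw [← Real.norm_eq_abs]
    refine norm_integral_le_of_norm_le (hp.integrable_orphan hu hv r) ?_
    filter_upwards [hp.ae_abs_live_sub_le r] with x hx
    rw [← mul_sub, norm_mul]
    exact (mul_le_of_le_one_left (norm_nonneg _) (abs_sign_le _)).trans hx
  linarith

/-- The amount `∫₀ᵗ e^(t-r)/4 · (orphan energy at time r) dr`, which bounds the effect of the
difference of the source terms on the transport distance at time `t`. -/
noncomputable def orphanIntegral (u v ψ φ₁ φ₂ : ℝ → ℝ) (t : ℝ) : ℝ :=
  ∫ r in (0 : ℝ)..t, exp (t - r) / 4 * ∫ x, orphan u v ψ φ₁ φ₂ r x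

theorem IsPlan.intervalIntegrable_orphan (hp : IsPlan u v ψ φ₁ φ₂) (hu : MemX u) (hv : MemX v)
    {q : ℝ → ℝ} (hq : Continuous q) (a b : ℝ) :
    IntervalIntegrable (fun r => q r * ∫ x, orphan u v ψ φ₁ φ₂ r x) volume a b := by
  refine IntervalIntegrable.continuousOn_mul ?_ hq.continuousOn
  have hm : StronglyMeasurable fun r => ∫ x, orphan u v ψ φ₁ φ₂ r x :=
    hp.measurable_orphan.stronglyMeasurable.integral_prod_right
  refine (intervalIntegrable_const
    (c := ∫ x, (deriv u x ^ 2 + deriv v (ψ x) ^ 2 * deriv ψ x))).mono_fun hm.aestronglyMeasurable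
    (Eventually.of_forall fun r => ?_)
  simp only [Real.norm_eq_abs]
  rw [abs_of_nonneg (integral_nonneg (hp.orphan_nonneg r))]
  exact (integral_mono (hp.integrable_orphan hu hv r)
    (hu.integrable_sq.add (hp.integrable_energy_right hv)) (hp.orphan_le r)).trans (le_abs_self _)

theorem IsPlan.orphanIntegral_nonneg (hp : IsPlan u v ψ φ₁ φ₂) {t : ℝ} (ht : 0 ≤ t) :
    0 ≤ orphanIntegral u v ψ φ₁ φ₂ t :=
  intervalIntegral.integral_nonneg ht fun r _ =>
    mul_nonneg (by positivity) (integral_nonneg (hp.orphan_nonneg r))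

/-- The exchange of the integrals over time and space in `orphanIntegral`, with the integrability in
space of the integral over time. -/
theorem IsPlan.orphanIntegral_eq (hp : IsPlan u v ψ φ₁ φ₂) (hu : MemX u) (hv : MemX v) {t : ℝ}
    (ht : 0 ≤ t) :
    Integrable (fun x => ∫ r in (0 : ℝ)..t, exp (t - r) / 4 * orphan u v ψ φ₁ φ₂ r x) ∧
    orphanIntegral u v ψ φ₁ φ₂ t =
      ∫ x, ∫ r in (0 : ℝ)..t, exp (t - r) / 4 * orphan u v ψ φ₁ φ₂ r x := by
  have hint : Integrable (Function.uncurry fun r x =>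
      exp (t - r) / 4 * orphan u v ψ φ₁ φ₂ r x) ((volume.restrict (uIoc 0 t)).prod volume) := by
    have h1 : Integrable (fun r => exp (t - r) / 4) (volume.restrict (uIoc 0 t)) := by
      rw [uIoc_of_le ht]
      exact (intervalIntegrable_iff_integrableOn_Ioc_of_le ht).1
        ((by fun_prop : Continuous fun r => exp (t - r) / 4).intervalIntegrable _ _)
    have h2 := h1.mul_prod (hu.integrable_sq.add (hp.integrable_energy_right hv))
    refine h2.mono' ?_ (Eventually.of_forall fun q => ?_)
    · exact (((by fun_prop : Measurable fun r => exp (t - r) / 4).comp measurable_fst).mul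
        hp.measurable_orphan).aestronglyMeasurable
    · simp only [Function.uncurry, norm_mul, Pi.add_apply]
      rw [Real.norm_eq_abs, Real.norm_eq_abs, abs_of_pos (by positivity),
        abs_of_nonneg (hp.orphan_nonneg _ _)]
      exact mul_le_mul_of_nonneg_left (hp.orphan_le _ _) (by positivity)
  constructor
  · have h3 := hint.integral_prod_right
    refine h3.congr (Eventually.of_forall fun x => ?_)
    simp only [intervalIntegral.integral_of_le ht, uIoc_of_le ht, Function.uncurry]
  · rw [← intervalIntegral_integral_swap hint, orphanIntegral]
    refine intervalIntegral.integral_congr fun r _ => ?_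
    simp only [integral_const_mul]

theorem IsPlan.abs_char_sub_add_le (hp : IsPlan u v ψ φ₁ φ₂) (hu : MemX u) (hv : MemX v) {t : ℝ}
    (ht : 0 ≤ t) (x : ℝ) :
    |char u t x - char v t (ψ x)| + |charValue u t x - charValue v t (ψ x)| ≤
      exp t * (|x - ψ x| + |u x - v (ψ x)|) + orphanIntegral u v ψ φ₁ φ₂ t := by
  have key : ∀ q : ℝ → ℝ, Continuous q → (∀ s ∈ Icc 0 t, 0 ≤ q s) →
      |(∫ s in (0 : ℝ)..t, q s * source u s x) - ∫ s in (0 : ℝ)..t, q s * source v s (ψ x)| ≤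
      ∫ s in (0 : ℝ)..t, q s / 4 * ∫ z, orphan u v ψ φ₁ φ₂ s z := by
    intro q hq hq0
    rw [← intervalIntegral.integral_sub (hu.intervalIntegrable_source hq _ _ _)
      (hv.intervalIntegrable_source hq _ _ _), ← Real.norm_eq_abs]
    refine intervalIntegral.norm_integral_le_of_norm_le ht (Eventually.of_forall fun s hs => ?_)
      (hp.intervalIntegrable_orphan hu hv (hq.div_const 4) _ _)
    have h0 := hq0 s (Ioc_subset_Icc_self hs)
    rw [← mul_sub, norm_mul, Real.norm_eq_abs, Real.norm_eq_abs, abs_of_nonneg h0]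
    have := mul_le_mul_of_nonneg_left (hp.abs_source_sub_le hu hv s x) h0
    linarith
  have k1 := key (fun s => t - s) (by fun_prop) fun s hs => by linarith [hs.2]
  have k2 := key (fun _ => 1) continuous_const fun _ _ => zero_le_one
  simp only [one_mul] at k2
  have h1 : |char u t x - char v t (ψ x)| ≤ |x - ψ x| + t * |u x - v (ψ x)| +
      ∫ s in (0 : ℝ)..t, (t - s) / 4 * ∫ z, orphan u v ψ φ₁ φ₂ s z := by
    have e : char u t x - char v t (ψ x) = (x - ψ x) + t * (u x - v (ψ x)) +
        ((∫ s in (0 : ℝ)..t, (t - s) * source u s x) -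
          ∫ s in (0 : ℝ)..t, (t - s) * source v s (ψ x)) := by
      rw [char, char]; ring
    rw [e]
    refine (abs_add_three _ _ _).trans (add_le_add (add_le_add le_rfl ?_) k1)
    rw [abs_mul, abs_of_nonneg ht]
  have h2 : |charValue u t x - charValue v t (ψ x)| ≤ |u x - v (ψ x)| +
      ∫ s in (0 : ℝ)..t, 1 / 4 * ∫ z, orphan u v ψ φ₁ φ₂ s z := by
    have e : charValue u t x - charValue v t (ψ x) = (u x - v (ψ x)) +
        ((∫ s in (0 : ℝ)..t, source u s x) - ∫ s in (0 : ℝ)..t, source v s (ψ x)) := by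
      rw [charValue, charValue]; ring
    rw [e]
    exact (abs_add_le _ _).trans (add_le_add le_rfl k2)
  have h3 : (∫ s in (0 : ℝ)..t, (t - s) / 4 * ∫ z, orphan u v ψ φ₁ φ₂ s z) +
      (∫ s in (0 : ℝ)..t, 1 / 4 * ∫ z, orphan u v ψ φ₁ φ₂ s z) ≤
      orphanIntegral u v ψ φ₁ φ₂ t := by
    rw [orphanIntegral, ← intervalIntegral.integral_add
      (hp.intervalIntegrable_orphan hu hv (by fun_prop) _ _)
      (hp.intervalIntegrable_orphan hu hv (by fun_prop) _ _)]
    refine intervalIntegral.integral_mono_on ht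
      ((hp.intervalIntegrable_orphan hu hv (q := fun s => (t - s) / 4) (by fun_prop) _ _).add
      (hp.intervalIntegrable_orphan hu hv (q := fun _ => 1 / 4) (by fun_prop) _ _))
      (hp.intervalIntegrable_orphan hu hv (by fun_prop) _ _) fun s _ => ?_
    rw [← add_mul]
    refine mul_le_mul_of_nonneg_right ?_ (integral_nonneg (hp.orphan_nonneg s))
    linarith [add_one_le_exp (t - s)]
  have h4 := add_one_le_exp t
  have h5 := one_le_exp ht
  have h6 := mul_le_mul_of_nonneg_right h5 (abs_nonneg (x - ψ x))
  have h7 := mul_le_mul_of_nonneg_right h4 (abs_nonneg (u x - v (ψ x)))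
  linarith

theorem IsPlan.ae_energy_sol_right (hp : IsPlan u v ψ φ₁ φ₂) (hv : MemX v) {t : ℝ} (ht : 0 ≤ t) :
    ∀ᵐ x, deriv (sol v t) (char v t (ψ x)) ^ 2 * deriv (fun x => char v t (ψ x)) x =
      live t (deriv v (ψ x)) * deriv ψ x := by
  filter_upwards [(hv.reparam_char ht).ae_deriv_comp hp.reparam,
    hp.reparam.ae_comp (hv.ae_energy_sol ht)] with x h1 h2
  rw [h1]
  rcases (hp.reparam.deriv_nonneg x).eq_or_lt with hx | hx
  · simp [← hx]
  · rw [← h2 hx]; ring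

/-- The plan transported along the two flows, keeping only the energy which is alive for both. -/
theorem IsPlan.evolve (hp : IsPlan u v ψ φ₁ φ₂) (hu : MemX u) (hv : MemX v) {t : ℝ} (ht : 0 ≤ t) :
    IsParamPlan (sol u t) (sol v t) (char u t) (fun x => char v t (ψ x))
      (fun x => φ₁ x * (aliveInd t (deriv u x) * aliveInd t (deriv v (ψ x))))
      (fun x => φ₂ (ψ x) * (aliveInd t (deriv u x) * aliveInd t (deriv v (ψ x)))) := by
  have mψ := hp.reparam.continuous.measurable
  have a1 := isWeight_aliveInd t (measurable_deriv u)
  have a2 := isWeight_aliveInd t ((measurable_deriv v).comp mψ)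
  have hF : ∀ r ∈ Icc (0 : ℝ) 1, ∀ s ∈ Icc (0 : ℝ) 1, ∀ t ∈ Icc (0 : ℝ) 1,
      r * (s * t) ∈ Icc (0 : ℝ) 1 := fun r hr s hs t ht =>
    ⟨mul_nonneg hr.1 (mul_nonneg hs.1 ht.1),
      mul_le_one₀ hr.2 (mul_nonneg hs.1 ht.1) (mul_le_one₀ hs.2 ht.1 ht.2)⟩
  refine ⟨hu.reparam_char ht, (hv.reparam_char ht).comp hp.reparam,
    hp.weight₁.map₃ a1 a2 (F := fun q => q.1 * (q.2.1 * q.2.2)) (by fun_prop) hF,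
    (hp.weight₂.comp mψ).map₃ a1 a2 (F := fun q => q.1 * (q.2.1 * q.2.2)) (by fun_prop) hF, ?_⟩
  filter_upwards [hp.balance, hu.ae_energy_sol ht, hp.ae_energy_sol_right hv ht] with x h1 h2 h3
  have h4 : ∀ p : ℝ, aliveInd t p * aliveInd t p = aliveInd t p := fun p => by
    unfold aliveInd; split_ifs <;> simp
  have h5 := h4 (deriv u x)
  have h6 := h4 (deriv v (ψ x))
  rw [h2, h3, live_eq, live_eq]
  linear_combination (φ₁ x * deriv u x ^ 2 * aliveInd t (deriv v (ψ x))) * h5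
    - (φ₂ (ψ x) * deriv v (ψ x) ^ 2 * deriv ψ x * aliveInd t (deriv u x)) * h6
    + aliveInd t (deriv u x) * aliveInd t (deriv v (ψ x)) * h1

theorem IsPlan.integral_orphan_eq (u v ψ φ₁ φ₂ : ℝ → ℝ) (t x : ℝ) :
    ∫ r in (0 : ℝ)..t, exp (t - r) / 4 * orphan u v ψ φ₁ φ₂ r x =
      (1 - φ₁ x) * deriv u x ^ 2 * (∫ r in (0 : ℝ)..t, exp (t - r) / 4 * aliveInd r (deriv u x))
      + (1 - φ₂ (ψ x)) * (deriv v (ψ x) ^ 2 * deriv ψ x) *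
        (∫ r in (0 : ℝ)..t, exp (t - r) / 4 * aliveInd r (deriv v (ψ x)))
      + φ₁ x * deriv u x ^ 2 * ∫ r in (0 : ℝ)..t, exp (t - r) / 4 *
        |aliveInd r (deriv u x) - aliveInd r (deriv v (ψ x))| := by
  have i1 := intervalIntegrable_exp_aliveInd t (deriv u x) 0 t
  have i2 := intervalIntegrable_exp_aliveInd t (deriv v (ψ x)) 0 t
  have i3 := intervalIntegrable_exp_abs_aliveInd_sub t (deriv u x) (deriv v (ψ x)) 0 t
  rw [← intervalIntegral.integral_const_mul, ← intervalIntegral.integral_const_mul,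
    ← intervalIntegral.integral_const_mul, ← intervalIntegral.integral_add (i1.const_mul _)
    (i2.const_mul _), ← intervalIntegral.integral_add ((i1.const_mul _).add (i2.const_mul _))
    (i3.const_mul _)]
  refine intervalIntegral.integral_congr fun r _ => ?_
  simp only [orphan]
  ring

theorem IsPlan.dX_evolve_le {κ : ℝ} (hκ : 0 < κ) (hp : IsPlan u v ψ φ₁ φ₂) (hu : MemX u)
    (hv : MemX v) {t : ℝ} (ht : 0 ≤ t) {x : ℝ} (h1 : -2 < t * deriv u x)
    (h2 : -2 < t * deriv v (ψ x))
    (e1 : deriv (sol u t) (char u t x) = deriv u x / (1 + t * deriv u x / 2))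
    (e2 : deriv (sol v t) (char v t (ψ x)) = deriv v (ψ x) / (1 + t * deriv v (ψ x) / 2)) :
    dX κ (pointAt (sol u t) (char u t x)) (pointAt (sol v t) (char v t (ψ x))) ≤
      exp t * dX κ (pointAt u x) (pointAt v (ψ x)) + orphanIntegral u v ψ φ₁ φ₂ t := by
  have hΔ := hp.orphanIntegral_nonneg ht
  have het := one_le_exp ht
  rw [dX_pointAt, dX_pointAt, hu.sol_char ht, hv.sol_char ht, height, height, height, height, e1, e2]
  have hang := abs_angle_sub_le ht h1 h2
  have hu1 := (angle_sub_mem (p := deriv u x) le_rfl ht).1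
  have hv1 := (angle_sub_mem (p := deriv v (ψ x)) le_rfl ht).1
  have n1 := angle_nonneg 0 (deriv u x)
  have n2 := angle_nonneg 0 (deriv v (ψ x))
  simp only [angle_zero, angle_of_alive h1, angle_of_alive h2, add_sub_add_left_eq_sub]
    at hang hu1 hv1 n1 n2
  rcases min_cases (|x - ψ x| + |u x - v (ψ x)| + κ * |arctan (deriv u x) - arctan (deriv v (ψ x))|)
    (κ * (π / 2 + arctan (deriv u x)) + κ * (π / 2 + arctan (deriv v (ψ x)))) with ⟨h, -⟩ | ⟨h, -⟩
  · rw [h]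
    refine (min_le_left _ _).trans ?_
    have h3 := hp.abs_char_sub_add_le hu hv ht x
    have h4 := mul_le_mul_of_nonneg_left hang hκ.le
    linarith
  · rw [h]
    refine (min_le_right _ _).trans ?_
    have h3 := mul_le_mul_of_nonneg_left hu1 hκ.le
    have h4 := mul_le_mul_of_nonneg_left hv1 hκ.le
    have h5 := mul_le_mul_of_nonneg_right het
      (add_nonneg (mul_nonneg hκ.le n1) (mul_nonneg hκ.le n2))
    linarith

theorem le_dX_pointAt {κ : ℝ} (hκ : 0 < κ) (u v : ℝ → ℝ) (x y : ℝ) :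
    κ * |angle 0 (deriv u x) - angle 0 (deriv v y)| ≤ dX κ (pointAt u x) (pointAt v y) := by
  have n1 := angle_nonneg 0 (deriv u x)
  have n2 := angle_nonneg 0 (deriv v y)
  rw [dX_pointAt, height, height, ← angle_zero, ← angle_zero]
  refine le_min ?_ ?_
  · rw [angle_zero, angle_zero, add_sub_add_left_eq_sub]
    have := abs_nonneg (x - y); have := abs_nonneg (u x - v y)
    linarith
  · rw [← mul_add]
    refine mul_le_mul_of_nonneg_left ?_ hκ.le
    rw [abs_le]
    constructor <;> linarith

/-- The pointwise form of the estimate. On the left, the waiting energy gains `κ` times the orphan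
energy density; on the right, the transported energy pays for `orphanIntegral`. If both
characteristics at `x` are alive the transported energy stays in motion; otherwise it is now sent to
`∞`, at the cost of the angle of the surviving one. -/
theorem IsPlan.ae_costDensity_evolve_le {κ : ℝ} (hκ : 0 < κ) (hp : IsPlan u v ψ φ₁ φ₂) (hu : MemX u)
    (hv : MemX v) {t : ℝ} (ht : 0 ≤ t) :
    ∀ᵐ x, costDensity κ (sol u t) (sol v t) (char u t) (fun x => char v t (ψ x))
        (fun x => φ₁ x * (aliveInd t (deriv u x) * aliveInd t (deriv v (ψ x))))
        (fun x => φ₂ (ψ x) * (aliveInd t (deriv u x) * aliveInd t (deriv v (ψ x)))) x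
      + κ * ∫ r in (0 : ℝ)..t, exp (t - r) / 4 * orphan u v ψ φ₁ φ₂ r x ≤
      exp t * costDensity κ u v (fun x => x) ψ φ₁ (fun x => φ₂ (ψ x)) x
        + orphanIntegral u v ψ φ₁ φ₂ t * (φ₁ x * deriv u x ^ 2) := by
  filter_upwards [hp.balance, hu.ae_energy_sol ht, hp.ae_energy_sol_right hv ht,
    hu.ae_height_sol ht κ, hp.reparam.ae_comp (hv.ae_height_sol ht κ), hu.ae_deriv_sol ht,
    hp.reparam.ae_comp (hv.ae_deriv_sol ht)] with x hbal hE1 hE2 hh1 hh2 hd1 hd2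
  have hw1 := hp.weight₁.mem_Icc x
  have hw2 := hp.weight₂.mem_Icc (ψ x)
  have hΔ := hp.orphanIntegral_nonneg ht
  rw [IsPlan.integral_orphan_eq]
  simp only [costDensity, hE1, hE2, deriv_id'', mul_one]
  have hx1 : height κ u x = κ * angle 0 (deriv u x) := by rw [height, angle_zero]
  have hx2 : height κ v (ψ x) = κ * angle 0 (deriv v (ψ x)) := by rw [height, angle_zero]
  rw [hx1, hx2, live_eq, live_eq]
  have c1 := angle_add_integral_le (p := deriv u x) le_rfl ht
  have c2 := angle_add_integral_le (p := deriv v (ψ x)) le_rfl ht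
  rw [sub_zero] at c1 c2
  have hle := le_dX_pointAt hκ u v x (ψ x)
  set I₁ := ∫ r in (0 : ℝ)..t, exp (t - r) / 4 * aliveInd r (deriv u x)
  set I₂ := ∫ r in (0 : ℝ)..t, exp (t - r) / 4 * aliveInd r (deriv v (ψ x))
  have hU := sq_nonneg (deriv u x)
  have hV := mul_nonneg (sq_nonneg (deriv v (ψ x))) (hp.reparam.deriv_nonneg x)
  have hbal' : φ₂ (ψ x) * (deriv v (ψ x) ^ 2 * deriv ψ x) = φ₁ x * deriv u x ^ 2 := by
    rw [hbal]; ring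
  have hg := mul_nonneg hw1.1 hU
  have hq1 := mul_nonneg (by linarith [hw1.2] : 0 ≤ 1 - φ₁ x) hU
  have hq2 := mul_nonneg (by linarith [hw2.2] : 0 ≤ 1 - φ₂ (ψ x)) hV
  have k1 := mul_le_mul_of_nonneg_left c1 (mul_nonneg hκ.le hq1)
  have k2 := mul_le_mul_of_nonneg_left c2 (mul_nonneg hκ.le hq2)
  have hh1' : height κ (sol u t) (char u t x) * aliveInd t (deriv u x) =
      κ * angle t (deriv u x) := by
    unfold aliveInd
    split_ifs with h
    · rw [hh1 h, mul_one]
    · rw [angle_of_dead h, mul_zero, mul_zero]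
  have hh2' : height κ (sol v t) (char v t (ψ x)) * aliveInd t (deriv v (ψ x)) * deriv ψ x =
      κ * angle t (deriv v (ψ x)) * deriv ψ x := by
    rcases (hp.reparam.deriv_nonneg x).eq_or_lt with hx | hx
    · simp [← hx]
    · unfold aliveInd
      split_ifs with h
      · rw [hh2 hx h, mul_one]
      · rw [angle_of_dead h]; ring
  by_cases hal : -2 < t * deriv u x ∧ -2 < t * deriv v (ψ x)
  · have hN : ∫ r in (0 : ℝ)..t, exp (t - r) / 4 *
        |aliveInd r (deriv u x) - aliveInd r (deriv v (ψ x))| = 0 := by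
      rw [intervalIntegral.integral_congr (g := fun _ => (0 : ℝ))]
      · simp
      · intro r hr
        rw [uIcc_of_le ht] at hr
        simp only [aliveInd, if_pos (alive_of_le hr.1 hr.2 hal.1),
          if_pos (alive_of_le hr.1 hr.2 hal.2), sub_self, abs_zero, mul_zero]
    rw [hN]
    have ha1 : aliveInd t (deriv u x) = 1 := if_pos hal.1
    have ha2 : aliveInd t (deriv v (ψ x)) = 1 := if_pos hal.2
    rw [ha1, mul_one] at hh1'
    rw [ha2, mul_one] at hh2'
    simp only [ha1, ha2, mul_one, one_mul, mul_zero, add_zero]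
    have hD : dX κ (pointAt (sol u t) (char u t x)) (pointAt (sol v t) (char v t (ψ x))) *
        (φ₁ x * deriv u x ^ 2) ≤ (exp t * dX κ (pointAt u x) (pointAt v (ψ x)) +
          orphanIntegral u v ψ φ₁ φ₂ t) * (φ₁ x * deriv u x ^ 2) := by
      rcases (hp.reparam.deriv_nonneg x).eq_or_lt with hx | hx
      · rw [hbal, ← hx]; simp
      · exact mul_le_mul_of_nonneg_right
          (hp.dX_evolve_le hκ hu hv ht hal.1 hal.2 (hd1 hal.1) (hd2 hx hal.2)) hg
    rw [hh1']
    have e2 : height κ (sol v t) (char v t (ψ x)) *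
        ((1 - φ₂ (ψ x)) * (deriv v (ψ x) ^ 2 * deriv ψ x)) = κ * angle t (deriv v (ψ x)) *
        ((1 - φ₂ (ψ x)) * (deriv v (ψ x) ^ 2 * deriv ψ x)) := by
      linear_combination (1 - φ₂ (ψ x)) * deriv v (ψ x) ^ 2 * hh2'
    rw [e2]
    linarith
  · have hzero : aliveInd t (deriv u x) * aliveInd t (deriv v (ψ x)) = 0 := by
      unfold aliveInd
      split_ifs with h3 h4 <;> simp
      exact hal ⟨h3, h4⟩
    simp only [hzero, mul_zero, zero_mul, sub_zero, one_mul, zero_add]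
    have c3 := angle_add_angle_add_integral_le ht hal
    set N := ∫ r in (0 : ℝ)..t, exp (t - r) / 4 *
        |aliveInd r (deriv u x) - aliveInd r (deriv v (ψ x))|
    have k3 := mul_le_mul_of_nonneg_left c3 (mul_nonneg hκ.le hg)
    have k4 := mul_le_mul_of_nonneg_left hle (mul_nonneg (exp_pos t).le hg)
    have k5 := mul_nonneg hΔ hg
    have e1 : height κ (sol u t) (char u t x) * (aliveInd t (deriv u x) * deriv u x ^ 2) =
        κ * angle t (deriv u x) * deriv u x ^ 2 := by rw [← mul_assoc, hh1']
    have e2 : height κ (sol v t) (char v t (ψ x)) *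
        (aliveInd t (deriv v (ψ x)) * deriv v (ψ x) ^ 2 * deriv ψ x) =
        κ * angle t (deriv v (ψ x)) * ((1 - φ₂ (ψ x)) * (deriv v (ψ x) ^ 2 * deriv ψ x))
          + κ * angle t (deriv v (ψ x)) * (φ₁ x * deriv u x ^ 2) := by
      rw [← hbal']
      linear_combination deriv v (ψ x) ^ 2 * hh2'
    rw [e1, e2]
    linarith

/-- The gain `κ · orphanIntegral` outweighs the loss, because the transported energy is at most
`energy u ≤ κ`. -/
theorem distJ_sol_le_exp_mul {κ : ℝ} (hκ : 0 < κ) (hu : MemX u) (hv : MemX v) (hE : energy u ≤ κ)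
    {t : ℝ} (ht : 0 ≤ t) :
    distJ κ (sol u t) (sol v t) ≤ ENNReal.ofReal (exp t) * distJ κ u v := by
  have het : ENNReal.ofReal (exp t) ≠ 0 := by simp [exp_pos]
  rw [mul_comm, ← ENNReal.div_le_iff_le_mul (.inl het) (.inl ENNReal.ofReal_ne_top)]
  refine distJ_le_of_forall_param hκ hu hv fun ψ φ₁ φ₂ hp => ?_
  rw [ENNReal.div_le_iff_le_mul (.inl het) (.inl ENNReal.ofReal_ne_top), mul_comm]
  have hp0 := hp.isParamPlan
  have hpt := hp.evolve hu hv ht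
  refine (distJ_le_paramCost hκ (hu.memX_sol ht) (hv.memX_sol ht) hpt).trans ?_
  rw [paramCost_eq_ofReal hκ (hu.memX_sol ht) (hv.memX_sol ht) hpt,
    paramCost_eq_ofReal hκ hu hv hp0, ← ENNReal.ofReal_mul (exp_pos t).le]
  refine ENNReal.ofReal_le_ofReal ?_
  obtain ⟨ho, hoe⟩ := hp.orphanIntegral_eq hu hv ht
  have ic0 := integrable_costDensity hκ hu hv hp0
  have ict := integrable_costDensity hκ (hu.memX_sol ht) (hv.memX_sol ht) hpt
  have iφ : Integrable fun x => φ₁ x * deriv u x ^ 2 := by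
    refine hu.integrable_sq.mono' (hp.weight₁.measurable.mul
      ((measurable_deriv u).pow_const 2)).aestronglyMeasurable (Eventually.of_forall fun x => ?_)
    have h1 := hp.weight₁.mem_Icc x
    rw [Real.norm_eq_abs, abs_of_nonneg (mul_nonneg h1.1 (sq_nonneg _))]
    exact mul_le_of_le_one_left (sq_nonneg _) h1.2
  have hφE : ∫ x, φ₁ x * deriv u x ^ 2 ≤ κ := (integral_mono iφ hu.integrable_sq fun x =>
    mul_le_of_le_one_left (sq_nonneg _) (hp.weight₁.mem_Icc x).2).trans hE
  have h := integral_mono_ae (ict.add (ho.const_mul κ)) ((ic0.const_mul (exp t)).add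
    (iφ.const_mul (orphanIntegral u v ψ φ₁ φ₂ t))) (hp.ae_costDensity_evolve_le hκ hu hv ht)
  rw [integral_add' ict (ho.const_mul κ), integral_add' (ic0.const_mul _) (iφ.const_mul _),
    integral_const_mul, integral_const_mul, integral_const_mul, ← hoe] at h
  have h2 := mul_le_mul_of_nonneg_left hφE (hp.orphanIntegral_nonneg ht)
  linarith

end

end HunterSaxton

theorem theorem2 (κ : ℝ) (hκ : 0 < κ) :
    -- `J` is a finite distance on `𝒳`, up to the identification of the constant functions
    ((∀ u v : ℝ → ℝ, HunterSaxton.MemX u → HunterSaxton.MemX v →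
        HunterSaxton.distJ κ u v < ⊤ ∧
        HunterSaxton.distJ κ u v = HunterSaxton.distJ κ v u ∧
        (HunterSaxton.distJ κ u v = 0 ↔
          u = v ∨ ((∃ a : ℝ, u = fun _ => a) ∧ ∃ b : ℝ, v = fun _ => b))) ∧
      (∀ u v w : ℝ → ℝ, HunterSaxton.MemX u → HunterSaxton.MemX v → HunterSaxton.MemX w →
        HunterSaxton.distJ κ u w ≤ HunterSaxton.distJ κ u v + HunterSaxton.distJ κ v w)) ∧
    -- the trajectories take values in `𝒳`, start at the datum, and are given by the formula
    -- along every characteristic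
    (∀ ubar : ℝ → ℝ, HunterSaxton.MemX ubar →
      HunterSaxton.sol ubar 0 = ubar ∧
      ∀ t : ℝ, 0 ≤ t →
        HunterSaxton.MemX (HunterSaxton.sol ubar t) ∧
        Function.Surjective (HunterSaxton.char ubar t) ∧
        ∀ y : ℝ, HunterSaxton.sol ubar t (HunterSaxton.char ubar t y)
          = HunterSaxton.charValue ubar t y) ∧
    -- the explicit bound on the distance to the initial datum
    (∀ c : ℝ, (∀ y : ℝ, y ≤ -1 → Real.pi / 2 + Real.arctan y ≤ c / |y|) →
      ∀ ubar : ℝ → ℝ, HunterSaxton.MemX ubar → ∀ t : ℝ, 0 ≤ t →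
        HunterSaxton.distJ κ ubar (HunterSaxton.sol ubar t) ≤
          ENNReal.ofReal ((Real.pi * t / 4 + (c + κ) / 2 + HunterSaxton.supNorm ubar
            + (t + 2) / 8 * HunterSaxton.energy ubar) * t * HunterSaxton.energy ubar)) ∧
    -- local Lipschitz continuity of the trajectories and of the distance between two of them,
    -- uniformly for initial data in bounded subsets of `𝒳`
    (∀ R T : ℝ, ∃ L : ℝ, 0 ≤ L ∧
      (∀ ubar : ℝ → ℝ, HunterSaxton.MemX ubar → HunterSaxton.normX ubar ≤ R →
        ∀ s ∈ Set.Icc (0 : ℝ) T, ∀ t ∈ Set.Icc (0 : ℝ) T,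
          HunterSaxton.distJ κ (HunterSaxton.sol ubar s) (HunterSaxton.sol ubar t) ≤
            ENNReal.ofReal (L * |t - s|)) ∧
      (∀ ubar vbar : ℝ → ℝ, HunterSaxton.MemX ubar → HunterSaxton.MemX vbar →
        HunterSaxton.normX ubar ≤ R → HunterSaxton.normX vbar ≤ R →
        ∀ s ∈ Set.Icc (0 : ℝ) T, ∀ t ∈ Set.Icc (0 : ℝ) T,
          |(HunterSaxton.distJ κ (HunterSaxton.sol ubar t) (HunterSaxton.sol vbar t)).toReal
            - (HunterSaxton.distJ κ (HunterSaxton.sol ubar s) (HunterSaxton.sol vbar s)).toReal|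
            ≤ L * |t - s|)) ∧
    -- Lipschitz dependence on the initial data
    (∀ ubar vbar : ℝ → ℝ, HunterSaxton.MemX ubar → HunterSaxton.MemX vbar →
      HunterSaxton.energy ubar ≤ κ →
      ∀ t : ℝ, 0 ≤ t →
        HunterSaxton.distJ κ (HunterSaxton.sol ubar t) (HunterSaxton.sol vbar t) ≤
          ENNReal.ofReal (Real.exp (2 * t)) * HunterSaxton.distJ κ ubar vbar) := by
  refine ⟨⟨fun u v hu hv => ⟨HunterSaxton.distJ_lt_top hκ hu hv, HunterSaxton.distJ_comm hκ hu hv,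
    HunterSaxton.distJ_eq_zero_iff hκ hu hv⟩, fun u v w hu hv hw =>
    HunterSaxton.distJ_triangle hκ hu hv hw⟩, fun u hu => ⟨HunterSaxton.sol_zero u, fun t ht =>
    ⟨hu.memX_sol ht, (hu.reparam_char ht).surj, hu.sol_char ht⟩⟩, fun c hc u hu t ht =>
    HunterSaxton.distJ_sol_le hκ hc hu ht, fun R T => ?_, fun u v hu hv hE t ht => ?_⟩
  · obtain ⟨L, hL, h⟩ := HunterSaxton.exists_lipschitz_bound hκ R T
    refine ⟨2 * L, by positivity, fun u hu hR s hs t ht => ?_,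
      fun u v hu hv hR hR' s hs t ht => ?_⟩
    · refine (h u hu hR s hs t ht).trans (ENNReal.ofReal_le_ofReal ?_)
      have := mul_nonneg hL (abs_nonneg (t - s))
      linarith
    · have := HunterSaxton.abs_toReal_sub_le hκ (hu.memX_sol hs.1) (hv.memX_sol hs.1)
        (hu.memX_sol ht.1) (hv.memX_sol ht.1) (mul_nonneg hL (abs_nonneg (t - s)))
        (h u hu hR s hs t ht) (h v hv hR' s hs t ht)
      linarith
  · refine (HunterSaxton.distJ_sol_le_exp_mul hκ hu hv hE ht).trans ?_
    gcongr
    linarith
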